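/- Let $R$ be a commutative ring with unit. For a topological space $X$ and $a,b\in X$ let $\mathsf PX(a,b)$ be the space of Moore paths $(\gamma,T)$, $T\ge 0$, $\gamma\colon[0,T]\to X$ continuous with $\gamma(0)=a$, $\gamma(T)=b$ (compact-open topology). Let $\mathsf C^{\square}(\mathsf PX)$ be the dg category whose objects are the points of $X$, whose morphism complexes are the normalized cubical singular chains of $\mathsf PX(a,b)$ with coefficients in $R$, with boundary $\partial^\square\lambda=\sum_{i\ge1}(-1)^{i-1}(\lambda|_{x_i=0}-\lambda|_{x_i=1})$, and whose composition is the product of cubes followed by concatenation of paths. Let $C(X)$ be the dg coalgebra of normalized simplicial singular chains of $X$ with the Alexander–Whitney coproduct $\Delta$, and let $\mathsf{Cobar}^{\prod}(C(X))$ be the dg category whose objects are the points of $X$ and whose morphism complex from $a$ to $b$ is the totalization of the cosimplicial chain complex $n\mapsto R_a\otimes C(X)^{\otimes n}\otimes R_b$. Here $R_a$ and $R_b$ denote copies of $R$ labelled by the points $a$ and $b$; the coface $\delta_0$ inserts $a$ in front, $\delta_{n+1}$ appends $b$, and $\delta_i$ ($1\le i\le n$) applies $\Delta$ to the $i$-th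 factor. Thus an element $x$ of degree $k$ is a family $(x_n)_{n\ge0}$ with $x_n\in C(X)^{\otimes n}$ of degree $k+n$; the differential is $(Dx)_{n}=\partial x_{n}+(-1)^{k}\sum_{i=0}^{n}(-1)^i\delta_i x_{n-1}$ (with no second term for $n=0$); and the composition is $(xy)_n=\sum_{i+j=n}(-1)^{i|y|}x_i\otimes y_j$. Let $It_X\colon \mathsf C^{\square}(\mathsf PX)(a,b)\to\mathsf{Cobar}^{\prod}(C(X))(a,b)$ be the map whose $n$-th component sends a cube $\lambda$ to $(-1)^n AW_n\big((\mathrm{Ev}_n)_*(\eta(\lambda)\times \mathrm{id}_{\Delta^n})\big)$. Here $\eta$ is the standard triangulation of cubes into simplices (the sum over all permutations of the coordinates, with signs), $\Delta^n=\{0\le t_1\le\dots\le t_n\le1\}$, $\times$ is the Eilenberg–Zilber cross product, $\mathrm{Ev}_n((\gamma,T),(t_1,\dots,t_n))=(\gamma(t_1T),\dots,\gamma(t_nT))$, and $AW_n\colon C(X^n)\to C(X)^{\otimes n}$ is the iterated Alexander–Whitney map. Then there is a family $\mathcal I=\{\mathcal I_X\}_X$, indexed by all topological spaces $X$, such that: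 1. for every $X$, $\mathcal I_X=\{\mathcal I_{X,n}\}_{n\ge1}\colon\mathsf C^{\square}(\mathsf PX)\to\mathsf{Cobar}^{\prod}(C(X))$ is an $A_\infty$-functor that is the identity on objects. That is, the $\mathcal I_{X,n}\colon \mathsf C^{\square}(\mathsf PX)(a_0,a_1)\otimes\dots\otimes\mathsf C^{\square}(\mathsf PX)(a_{n-1},a_n)\to\mathsf{Cobar}^{\prod}(C(X))(a_0,a_n)$ are $R$-linear of degree $n-1$ and satisfy, for all $n\ge1$, $$\sum_{p+q+r=n}(-1)^{p+qr}\,\mathcal I_{X,p+1+r}(1^{\otimes p}\otimes m_q\otimes1^{\otimes r})=\sum_{i_1+\dots+i_k=n}(-1)^{\sum_j(k-j)(i_j-1)}\,m_k(\mathcal I_{X,i_1}\otimes\dots\otimes\mathcal I_{X,i_k}),$$ where $m_1$ is the differential, $m_2$ the composition, $m_q=0$ for $q>2$, and the Koszul sign rule is used; 2. $\mathcal I_{X,1}=It_X$ for every $X$; 3. $\mathcal I$ is natural in $X$: for every continuous map $f\colon X\to Y$ and every $n\ge1$, $\mathcal I_{Y,n}(f_*x_1\otimes\dots\otimes f_*x_n)=f_*\,\mathcal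 I_{X,n}(x_1\otimes\dots\otimes x_n)$. -/

import Mathlib

universe u v w

open scoped NNReal DirectSum TensorProduct

noncomputable section

namespace Chen

/-! ### Normalized chains -/

/-- The free `R`-module on a set `G` of generators modulo the span of the degenerate ones. -/
def NormChains (R : Type v) [CommRing R] {G : Type w} (degen : Set G) : Type (max v w) :=
  (G →₀ R) ⧸ Submodule.span R ((fun g => Finsupp.single g (1 : R)) '' degen)

instance (R : Type v) [CommRing R] {G : Type w} (degen : Set G) :
    AddCommGroup (NormChains R degen) :=
  inferInstanceAs (AddCommGroup
    ((G →₀ R) ⧸ Submodule.span R ((fun g => Finsupp.single g (1 : R)) '' degen)))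

instance (R : Type v) [CommRing R] {G : Type w} (degen : Set G) : Module R (NormChains R degen) :=
  inferInstanceAs (Module R
    ((G →₀ R) ⧸ Submodule.span R ((fun g => Finsupp.single g (1 : R)) '' degen)))

section NormChains

variable {R : Type v} [CommRing R] {G : Type w} {degen : Set G}
  {M : Type*} [AddCommGroup M] [Module R M]

/-- The class of a generator. -/
def cls (R : Type v) [CommRing R] {G : Type w} (degen : Set G) (g : G) : NormChains R degen :=
  (Submodule.mkQ _ (Finsupp.single g 1) : (G →₀ R) ⧸
    Submodule.span R ((fun g => Finsupp.single g (1 : R)) '' degen))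

theorem cls_eq_zero {g : G} (h : g ∈ degen) : cls R degen g = 0 :=
  (Submodule.Quotient.mk_eq_zero _).2 (Submodule.subset_span ⟨g, h, rfl⟩)

/-- Linear maps out of normalized chains: values on generators that vanish on degenerate ones. -/
def liftChains (f : G → M) (h : ∀ g ∈ degen, f g = 0) : NormChains R degen →ₗ[R] M :=
  Submodule.liftQ _ (Finsupp.linearCombination R f) (by
    rw [Submodule.span_le]
    rintro _ ⟨g, hg, rfl⟩
    simp [h g hg])

theorem liftChains_cls (f : G → M) (h : ∀ g ∈ degen, f g = 0) (g : G) :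
    liftChains (R := R) f h (cls R degen g) = f g :=
  (Submodule.liftQ_apply _ _ _).trans (by simp)

theorem chains_ext {f f' : NormChains R degen →ₗ[R] M}
    (h : ∀ g, f (cls R degen g) = f' (cls R degen g)) : f = f' :=
  Submodule.linearMap_qext _ (Finsupp.lhom_ext' fun g => LinearMap.ext_ring (h g))

end NormChains

/-! ### Normalized simplicial singular chains -/

section Simplicial

variable {X : Type u} [TopologicalSpace X] {Y : Type w} [TopologicalSpace Y]

/-- Singular `n`-simplices of `X`. -/
abbrev Simp (n : ℕ) (X : Type u) [TopologicalSpace X] : Type u :=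
  C(stdSimplex ℝ (Fin (n + 1)), X)

/-- Precomposition with the affine map `Δ^m → Δ^n` given by `θ` on vertices. -/
def pull {m n : ℕ} (θ : Fin (m + 1) → Fin (n + 1)) (σ : Simp n X) : Simp m X :=
  σ.comp ⟨stdSimplex.map θ, stdSimplex.continuous_map θ⟩

theorem pull_pull {l m n : ℕ} (φ : Fin (l + 1) → Fin (m + 1)) (θ : Fin (m + 1) → Fin (n + 1))
    (σ : Simp n X) : pull φ (pull θ σ) = pull (θ ∘ φ) σ := by
  ext s
  simp [pull, stdSimplex.map_comp_apply]

theorem pull_comp {m n : ℕ} (θ : Fin (m + 1) → Fin (n + 1)) (f : C(X, Y)) (σ : Simp n X) :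
    pull θ (f.comp σ) = f.comp (pull θ σ) := rfl

/-- A simplex is degenerate if it is of the form `τ ∘ s_j` for a codegeneracy `s_j`. -/
def IsDegenSimp : Set (Σ n, Simp n X) :=
  {s | ∃ (m : ℕ) (τ : Simp m X) (j : Fin (m + 1)), s = ⟨m + 1, pull j.predAbove τ⟩}

/-- The idempotent of `{0, …, m}` sending `i + 1` to `i` and fixing everything else. -/
def collapse {m : ℕ} (i : Fin m) (l : Fin (m + 1)) : Fin (m + 1) :=
  if l = i.succ then i.castSucc else l

theorem val_succAbove {n : ℕ} (i : Fin (n + 1)) (l : Fin n) :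
    (i.succAbove l : ℕ) = if (l : ℕ) < i then (l : ℕ) else l + 1 := by
  simp only [Fin.succAbove, Fin.lt_def, Fin.val_castSucc]
  split_ifs <;> simp

theorem val_predAbove {n : ℕ} (j : Fin n) (l : Fin (n + 1)) :
    (j.predAbove l : ℕ) = if (j : ℕ) < l then (l : ℕ) - 1 else l := by
  simp only [Fin.predAbove, Fin.lt_def, Fin.val_castSucc]
  split_ifs <;> simp

theorem isDegenSimp_of_collapse {m : ℕ} (i : Fin m) (ρ : Simp m X)
    (h : pull (collapse i) ρ = ρ) : (⟨m, ρ⟩ : Σ n, Simp n X) ∈ IsDegenSimp := by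
  cases m with
  | zero => exact i.elim0
  | succ m =>
    refine ⟨m, pull i.succ.succAbove ρ, i, ?_⟩
    rw [pull_pull]
    conv_lhs => rw [← h]
    congr 2
    funext l
    simp only [collapse, Function.comp, Fin.ext_iff, val_succAbove, val_predAbove, apply_ite Fin.val,
      Fin.val_succ, Fin.val_castSucc]
    split_ifs <;> omega

theorem pull_collapse {m n : ℕ} (θ : Fin (m + 1) → Fin (n + 1)) (σ : Simp n X) (i : Fin m)
    (h : θ i.succ = θ i.castSucc) : pull (collapse i) (pull θ σ) = pull θ σ := by
  rw [pull_pull]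
  congr 1
  funext l
  by_cases hl : l = i.succ <;> simp [collapse, hl, h]

theorem isDegenSimp_pull {m n : ℕ} (θ : Fin (m + 1) → Fin (n + 1)) (σ : Simp n X) (i : Fin m)
    (h : θ i.succ = θ i.castSucc) : (⟨m, pull θ σ⟩ : Σ n, Simp n X) ∈ IsDegenSimp :=
  isDegenSimp_of_collapse i _ (pull_collapse θ σ i h)

/-- Normalized simplicial singular chains (all degrees together). -/
abbrev SChains (R : Type v) [CommRing R] (X : Type u) [TopologicalSpace X] : Type (max u v) :=
  NormChains R (IsDegenSimp (X := X))

/-- The class of a singular simplex in the normalized chains. -/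
abbrev scls (R : Type v) [CommRing R] {n : ℕ} (σ : Simp n X) : SChains R X :=
  cls R IsDegenSimp ⟨n, σ⟩

variable (R : Type v) [CommRing R]

theorem scls_pull_eq_zero {m n : ℕ} (θ : Fin (m + 1) → Fin (n + 1)) (σ : Simp n X) (i : Fin m)
    (h : θ i.succ = θ i.castSucc) : scls R (pull θ σ) = 0 :=
  cls_eq_zero (isDegenSimp_pull θ σ i h)

/-- `∑ i, (-1)^i d_i σ`. -/
def simpBoundaryGen : (Σ n, Simp n X) → SChains R X
  | ⟨0, _⟩ => 0
  | ⟨n + 1, σ⟩ => ∑ i : Fin (n + 2), (-1 : R) ^ (i : ℕ) • scls R (n := n) (pull i.succAbove σ)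

theorem simpBoundaryGen_degen (s : Σ n, Simp n X) (hs : s ∈ IsDegenSimp) :
    simpBoundaryGen R s = 0 := by
  obtain ⟨m, τ, j, rfl⟩ := hs
  simp only [simpBoundaryGen, pull_pull]
  rw [Fintype.sum_eq_add j.castSucc j.succ (by simp [Fin.ext_iff])]
  · have : (j.predAbove ∘ j.castSucc.succAbove : Fin (m + 1) → Fin (m + 1)) =
        j.predAbove ∘ j.succ.succAbove := by
      funext l
      simp only [Function.comp, Fin.ext_iff, val_succAbove, val_predAbove, Fin.val_succ,
        Fin.val_castSucc]
      split_ifs <;> omega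
    rw [this]
    simp [pow_succ]
  · rintro i ⟨h1, h2⟩
    have key : ∃ l : Fin m, (j.predAbove ∘ i.succAbove : Fin (m + 1) → Fin (m + 1)) l.succ =
        (j.predAbove ∘ i.succAbove : Fin (m + 1) → Fin (m + 1)) l.castSucc := by
      simp only [ne_eq, Fin.ext_iff, Fin.val_castSucc, Fin.val_succ] at h1 h2
      have := j.isLt
      have := i.isLt
      rcases lt_or_ge (i : ℕ) j with h | h
      · refine ⟨⟨j - 1, by omega⟩, ?_⟩
        simp only [Function.comp, Fin.ext_iff, val_succAbove, val_predAbove, Fin.val_succ,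
          Fin.val_castSucc]
        split_ifs <;> omega
      · refine ⟨⟨j, by omega⟩, ?_⟩
        simp only [Function.comp, Fin.ext_iff, val_succAbove, val_predAbove, Fin.val_succ,
          Fin.val_castSucc]
        split_ifs <;> omega
    obtain ⟨l, hl⟩ := key
    rw [scls_pull_eq_zero R _ _ l hl, smul_zero]

/-- The boundary of normalized simplicial chains. -/
def simpBoundary : SChains R X →ₗ[R] SChains R X :=
  liftChains (simpBoundaryGen R) (simpBoundaryGen_degen R)

/-- The sign involution `c ↦ (-1)^{|c|} c`. -/
def simpParity : SChains R X →ₗ[R] SChains R X :=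
  liftChains (fun s => (-1 : R) ^ s.1 • cls R IsDegenSimp s)
    (fun s hs => by rw [cls_eq_zero hs, smul_zero])

/-- The pushforward along a continuous map. -/
def simpMap (f : C(X, Y)) : SChains R X →ₗ[R] SChains R Y :=
  liftChains (fun s => scls R (f.comp s.2)) (by
    rintro _ ⟨m, τ, j, rfl⟩
    exact cls_eq_zero ⟨m, f.comp τ, j, rfl⟩)

/-- The restriction of a simplex to the vertices `p, p + 1, …, q` (used for `p ≤ q`). -/
def seg {n : ℕ} (p q : Fin (n + 1)) (σ : Simp n X) : Simp ((q : ℕ) - p) X :=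
  pull (fun l => ⟨p + l, by omega⟩) σ

theorem exists_step {k : ℕ} (g : Fin (k + 1) → ℕ) (j : ℕ) (h0 : g 0 ≤ j)
    (h1 : j < g (Fin.last k)) : ∃ s : Fin k, g s.castSucc ≤ j ∧ j < g s.succ := by
  by_contra! h
  have : ∀ i, g i ≤ j := fun i => Fin.induction h0 (fun i hi => h i hi) i
  exact absurd (this _) (not_le.2 h1)

/-- The coordinate projections of `X^n`. -/
def coordMap (n : ℕ) (i : Fin n) : C(Fin n → X, X) := ⟨fun x => x i, continuous_apply i⟩

open Classical in
/-- `∑ σ_1|[p_0, p_1] ⊗ ⋯ ⊗ σ_n|[p_{n-1}, p_n]` over all `0 = p_0 ≤ p_1 ≤ ⋯ ≤ p_n = k`, for a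
`k`-simplex `(σ_1, …, σ_n)` of `X^n`. -/
def alexanderWhitneyGen (n : ℕ) (s : Σ k, Simp k (Fin n → X)) : ⨂[R]^n (SChains R X) :=
  ∑ p : {p : Fin (n + 1) → Fin (s.1 + 1) // Monotone p ∧ p 0 = 0 ∧ p (Fin.last n) = Fin.last s.1},
    PiTensorProduct.tprod R fun i : Fin n =>
      scls R (seg (p.1 i.castSucc) (p.1 i.succ) ((coordMap n i).comp s.2))

/-- The iterated Alexander–Whitney map `C(X^n) → C(X)^{⊗ n}`. -/
def alexanderWhitney (n : ℕ) : SChains R (Fin n → X) →ₗ[R] ⨂[R]^n (SChains R X) :=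
  liftChains (M := ⨂[R]^n (SChains R X)) (alexanderWhitneyGen R (X := X) n) (by
    rintro _ ⟨m, τ, j, rfl⟩
    refine Finset.sum_eq_zero ?_
    rintro ⟨p, hp, hp0, hp1⟩ -
    dsimp only at p hp hp0 hp1 ⊢
    obtain ⟨i, hi0, hi1⟩ := exists_step (fun i => (p i : ℕ)) j (by simp [hp0])
      (by simp only [hp1, Fin.val_last]; omega)
    refine MultilinearMap.map_coord_zero _ i ?_
    have := (p i.succ).isLt
    simp only [seg, ← pull_comp, pull_pull]
    refine scls_pull_eq_zero R _ _ ⟨(j : ℕ) - p i.castSucc, by omega⟩ ?_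
    simp only [Function.comp, Fin.ext_iff, val_predAbove, Fin.val_succ, Fin.val_castSucc]
    split_ifs <;> omega)

/-- The coproduct `Δ : C(X) → C(X) ⊗ C(X)` given by the Alexander–Whitney diagonal approximation. -/
def simpDiag : SChains R X →ₗ[R] ⨂[R]^2 (SChains R X) :=
  alexanderWhitney R 2 ∘ₗ simpMap R (⟨fun x _ => x, by fun_prop⟩ : C(X, Fin 2 → X))

/-- The number of elements of `S` below `k`. -/
def countBelow {N : ℕ} (S : Finset (Fin N)) (k : Fin (N + 1)) : ℕ :=
  (S.filter fun s => s.castSucc < k).card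

theorem countBelow_le {N : ℕ} (S : Finset (Fin N)) (k : Fin (N + 1)) : countBelow S k ≤ S.card :=
  Finset.card_filter_le _ _

/-- The number of pairs `s' < s` with `s ∈ S` and `s' ∉ S`. -/
def inversions {N : ℕ} (S : Finset (Fin N)) : ℕ :=
  ((S ×ˢ Sᶜ).filter fun s => s.2 < s.1).card

/-- The Eilenberg–Zilber product of a `p`-simplex `α` with a `q`-simplex `β`: the signed sum over all
`(p, q)`-shuffles. A shuffle is given by the set `S` of those steps `s → s + 1` of a lattice path
from `(0, 0)` to `(p, q)` that go in the first direction. -/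
def crossGen {q : ℕ} (β : Simp q Y) (s : Σ p, Simp p X) : SChains R (X × Y) :=
  ∑ S : {S : Finset (Fin (s.1 + q)) // S.card = s.1}, (-1 : R) ^ inversions S.1 •
    scls R (n := s.1 + q) (ContinuousMap.prodMk
      (pull (fun k => ⟨countBelow S.1 k, by have := countBelow_le S.1 k; have := S.2; omega⟩) s.2)
      (pull (fun k => ⟨countBelow S.1ᶜ k, by
        have := countBelow_le S.1ᶜ k
        have := S.2
        have := Finset.card_compl S.1
        simp only [Fintype.card_fin] at this
        omega⟩) β))

theorem countBelow_succ {N : ℕ} (S : Finset (Fin N)) (s : Fin N) :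
    countBelow S s.succ = countBelow S s.castSucc + if s ∈ S then 1 else 0 := by
  have : (S.filter fun t => t.castSucc < s.succ) =
      (S.filter fun t => t.castSucc < s.castSucc) ∪ (S.filter fun t => t = s) := by
    ext t
    simp only [Finset.mem_filter, Finset.mem_union, Fin.lt_def, Fin.ext_iff, Fin.val_succ,
      Fin.val_castSucc, ← and_or_left]
    exact and_congr_right fun _ => by omega
  rw [countBelow, this, Finset.card_union_of_disjoint, countBelow, Finset.filter_eq']
  · split_ifs <;> simp
  · rw [Finset.disjoint_left]
    intro t h1 h2
    simp only [Finset.mem_filter, Fin.lt_def, Fin.val_castSucc] at h1 h2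
    rw [h2.2] at h1
    omega

theorem crossGen_degen {q : ℕ} (β : Simp q Y) (s : Σ p, Simp p X) (hs : s ∈ IsDegenSimp) :
    crossGen R β s = 0 := by
  obtain ⟨m, τ, j, rfl⟩ := hs
  refine Finset.sum_eq_zero ?_
  rintro ⟨S, hS⟩ -
  dsimp only at S hS ⊢
  obtain ⟨t, ht0, ht1⟩ := exists_step (countBelow S) j (by simp [countBelow])
    (by
      have : countBelow S (Fin.last _) = S.card := by
        simp [countBelow, Fin.castSucc_lt_last]
      omega)
  have h1 := countBelow_succ S t
  have h2 := countBelow_succ Sᶜ t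
  have htS : t ∈ S := by
    by_contra h
    simp only [h, if_false] at h1
    omega
  simp only [htS, if_true] at h1
  simp only [Finset.mem_compl, htS, not_true, if_false] at h2
  refine smul_eq_zero_of_right _ (cls_eq_zero (isDegenSimp_of_collapse t _ ?_))
  have e1 : ∀ (f : Simp (m + 1 + q) X) (g : Simp (m + 1 + q) Y),
      pull (collapse t) (ContinuousMap.prodMk f g) =
        ContinuousMap.prodMk (pull (collapse t) f) (pull (collapse t) g) := fun _ _ => rfl
  rw [e1, pull_pull _ j.predAbove, pull_collapse _ τ, pull_collapse _ β]
  · simp only [h2, add_zero]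
  · simp only [Function.comp, Fin.ext_iff, val_predAbove]
    split_ifs <;> omega

end Simplicial

/-! ### Normalized cubical singular chains -/

section Cubical

variable {X : Type u} [TopologicalSpace X] {Y : Type w} [TopologicalSpace Y]

/-- Singular `n`-cubes of `X`. -/
abbrev Cube (n : ℕ) (X : Type u) [TopologicalSpace X] : Type u := C(Fin n → unitInterval, X)

/-- A cube is degenerate if it does not depend on one of its coordinates. -/
def IsDegenCube : Set (Σ n, Cube n X) :=
  {s | ∃ i : Fin s.1, ∀ x y, (∀ j, j ≠ i → x j = y j) → s.2 x = s.2 y}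

/-- Normalized cubical singular chains (all degrees together). -/
abbrev CubeChains (R : Type v) [CommRing R] (X : Type u) [TopologicalSpace X] : Type (max u v) :=
  NormChains R (IsDegenCube (X := X))

/-- The class of a singular cube in the normalized chains. -/
abbrev ccls (R : Type v) [CommRing R] {n : ℕ} (c : Cube n X) : CubeChains R X :=
  cls R IsDegenCube ⟨n, c⟩

/-- The restriction of a cube to the face where the `i`-th coordinate equals `e`. -/
def cubeFace {n : ℕ} (i : Fin (n + 1)) (e : unitInterval) (c : Cube (n + 1) X) : Cube n X :=
  c.comp ⟨fun x => i.insertNth (α := fun _ => unitInterval) e x, by fun_prop⟩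

variable (R : Type v) [CommRing R]

/-- `∑ i, (-1)^i (c|_{x_i = 0} - c|_{x_i = 1})`, where the coordinates are numbered from `0`. -/
def cubeBoundaryGen : (Σ n, Cube n X) → CubeChains R X
  | ⟨0, _⟩ => 0
  | ⟨n + 1, c⟩ => ∑ i : Fin (n + 1), (-1 : R) ^ (i : ℕ) •
      (ccls R (n := n) (cubeFace i 0 c) - ccls R (n := n) (cubeFace i 1 c))

theorem cubeBoundaryGen_degen (s : Σ n, Cube n X) (hs : s ∈ IsDegenCube) :
    cubeBoundaryGen R s = 0 := by
  obtain ⟨_ | n, c⟩ := s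
  · rfl
  obtain ⟨i, hi⟩ := hs
  dsimp only at i hi
  refine Finset.sum_eq_zero fun k _ => ?_
  by_cases hk : k = i
  · subst hk
    have : cubeFace k 0 c = cubeFace k 1 c := by
      ext x
      refine hi _ _ fun j hj => ?_
      obtain ⟨j, rfl⟩ := Fin.exists_succAbove_eq hj
      simp
    rw [this, sub_self, smul_zero]
  · obtain ⟨l, hl⟩ := Fin.exists_succAbove_eq (Ne.symm hk)
    have key : ∀ e, ccls R (n := n) (cubeFace k e c) = 0 := fun e => by
      refine cls_eq_zero ⟨l, fun x y hxy => hi _ _ fun j hj => ?_⟩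
      induction j using Fin.succAboveCases k with
      | x => simp
      | p j =>
        have : j ≠ l := fun h => hj (h ▸ hl)
        simpa using hxy j this
    rw [key, key, sub_zero, smul_zero]

/-- The boundary of normalized cubical chains. -/
def cubeBoundary : CubeChains R X →ₗ[R] CubeChains R X :=
  liftChains (cubeBoundaryGen R) (cubeBoundaryGen_degen R)

/-- The cubical chains of degree `k`. -/
def cubeDeg (k : ℤ) : Submodule R (CubeChains R X) :=
  Submodule.span R {z | ∃ (n : ℕ) (c : Cube n X), (n : ℤ) = k ∧ z = ccls R c}

/-- The pushforward along a continuous map. -/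
def cubeMap (f : C(X, Y)) : CubeChains R X →ₗ[R] CubeChains R Y :=
  liftChains (fun s => ccls R (f.comp s.2)) (by
    rintro s ⟨i, hi⟩
    exact cls_eq_zero ⟨i, fun x y h => congrArg f (hi x y h)⟩)

/-- The product of an `m`-cube `c` and an `n`-cube `d`, followed by `μ : X × Y → Z`. -/
def cubeProd {Z : Type*} [TopologicalSpace Z] (μ : C(X × Y, Z)) {m n : ℕ} (c : Cube m X)
    (d : Cube n Y) : Cube (m + n) Z :=
  μ.comp ⟨fun x => (c fun i => x (Fin.castAdd n i), d fun i => x (Fin.natAdd m i)), by fun_prop⟩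

theorem cubeProd_degen_right {Z : Type*} [TopologicalSpace Z] (μ : C(X × Y, Z))
    (s : Σ n, Cube n X) (t : Σ n, Cube n Y) (ht : t ∈ IsDegenCube) :
    ccls R (cubeProd μ s.2 t.2) = 0 := by
  obtain ⟨i, hi⟩ := ht
  refine cls_eq_zero ⟨Fin.natAdd s.1 i, fun x y h => ?_⟩
  have h1 : (fun j => x (Fin.castAdd t.1 j)) = fun j => y (Fin.castAdd t.1 j) := by
    funext j
    refine h _ fun e => ?_
    simp only [Fin.ext_iff, Fin.val_castAdd, Fin.val_natAdd] at e
    omega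
  have h2 := hi (fun j => x (Fin.natAdd s.1 j)) (fun j => y (Fin.natAdd s.1 j))
    fun j hj => h _ fun e => hj (by simpa [Fin.ext_iff] using e)
  change μ (_, _) = μ (_, _)
  rw [h1, h2]

theorem cubeProd_degen_left {Z : Type*} [TopologicalSpace Z] (μ : C(X × Y, Z))
    (s : Σ n, Cube n X) (t : Σ n, Cube n Y) (hs : s ∈ IsDegenCube) :
    ccls R (cubeProd μ s.2 t.2) = 0 := by
  obtain ⟨i, hi⟩ := hs
  refine cls_eq_zero ⟨Fin.castAdd t.1 i, fun x y h => ?_⟩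
  have h1 : (fun j => x (Fin.natAdd s.1 j)) = fun j => y (Fin.natAdd s.1 j) := by
    funext j
    refine h _ fun e => ?_
    simp only [Fin.ext_iff, Fin.val_castAdd, Fin.val_natAdd] at e
    omega
  have h2 := hi (fun j => x (Fin.castAdd t.1 j)) (fun j => y (Fin.castAdd t.1 j))
    fun j hj => h _ fun e => hj (by simpa [Fin.ext_iff] using e)
  change μ (_, _) = μ (_, _)
  rw [h1, h2]

/-- The bilinear map on normalized cubical chains induced by products of cubes and `μ`. -/
def cubeCross {Z : Type*} [TopologicalSpace Z] (μ : C(X × Y, Z)) :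
    CubeChains R X →ₗ[R] CubeChains R Y →ₗ[R] CubeChains R Z :=
  liftChains
    (fun s => liftChains (fun t => ccls R (cubeProd μ s.2 t.2)) (cubeProd_degen_right R μ s))
    (fun s hs => chains_ext fun t => by
      rw [liftChains_cls, cubeProd_degen_left R μ s t hs, LinearMap.zero_apply])

/-! ### Triangulation of cubes -/

/-- The coordinate `t_i` on `Δ^n ≅ {0 ≤ t_1 ≤ ⋯ ≤ t_n ≤ 1}`: in barycentric coordinates,
`t_i = s_0 + ⋯ + s_{i-1}`. In these coordinates the coface maps insert `0` in front, repeat a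
coordinate, or append `1`. -/
def tCoord {n : ℕ} (i : Fin n) (s : stdSimplex ℝ (Fin (n + 1))) : unitInterval :=
  ⟨∑ j with j ≤ i.castSucc, s j, Finset.sum_nonneg fun j _ => stdSimplex.zero_le s j,
    (Finset.sum_le_sum_of_subset_of_nonneg (Finset.filter_subset _ _)
      fun j _ _ => stdSimplex.zero_le s j).trans_eq (stdSimplex.sum_eq_one s)⟩

theorem continuous_tCoord {n : ℕ} (i : Fin n) : Continuous (tCoord i) :=
  Continuous.subtype_mk (continuous_finsetSum _ fun j _ =>
    (continuous_apply j).comp continuous_subtype_val) _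

theorem tCoord_map_collapse {n : ℕ} {i k : Fin n} (h : i ≠ k)
    (s : stdSimplex ℝ (Fin (n + 1))) : tCoord i (stdSimplex.map (collapse k) s) = tCoord i s := by
  classical
  apply Subtype.ext
  simp only [tCoord, stdSimplex.map_coe, FunOnFinite.linearMap_apply_apply]
  refine Eq.trans ?_ (Finset.sum_fiberwise_of_maps_to
    (s := Finset.univ.filter fun j => j ≤ i.castSucc)
    (t := Finset.univ.filter fun j => j ≤ i.castSucc) (g := collapse k) ?_ (fun x => s x))
  · refine Finset.sum_congr rfl fun y hy => Finset.sum_congr ?_ fun _ _ => rfl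
    ext x
    simp only [collapse, Finset.mem_filter, Finset.mem_univ, true_and, Fin.le_def, Fin.ext_iff,
      apply_ite Fin.val, Fin.val_castSucc, Fin.val_succ] at hy ⊢
    have : (i : ℕ) ≠ k := fun e => h (Fin.ext e)
    split_ifs <;> omega
  · intro x hx
    simp only [collapse, Finset.mem_filter, Finset.mem_univ, true_and, Fin.le_def, Fin.ext_iff,
      apply_ite Fin.val, Fin.val_castSucc, Fin.val_succ] at hx ⊢
    split_ifs <;> omega

/-- The singular simplex `c ∘ ι_τ`, where `ι_τ (t_1, …, t_n) = (t_{τ 1}, …, t_{τ n})`. -/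
def cubeSimplex {n : ℕ} (τ : Equiv.Perm (Fin n)) (c : Cube n X) : Simp n X :=
  c.comp ⟨fun s i => tCoord (τ i) s, continuous_pi fun i => continuous_tCoord (τ i)⟩

/-- The standard triangulation `c ↦ ∑_τ sgn(τ) c ∘ ι_τ`. -/
def triangulate : CubeChains R X →ₗ[R] SChains R X :=
  liftChains (fun s => ∑ τ : Equiv.Perm (Fin s.1),
      ((Equiv.Perm.sign τ : ℤ) : R) • scls R (cubeSimplex τ s.2)) (by
    rintro ⟨n, c⟩ ⟨i, hi⟩
    refine Finset.sum_eq_zero fun τ _ => smul_eq_zero_of_right _ (cls_eq_zero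
      (isDegenSimp_of_collapse (τ i) _ (ContinuousMap.ext fun s => hi _ _ fun j hj => ?_)))
    exact tCoord_map_collapse (fun e => hj (τ.injective e)) s)

end Cubical

/-! ### Moore paths -/

section Paths

variable {X : Type u} [TopologicalSpace X] {Y : Type w} [TopologicalSpace Y]

/-- The space of Moore paths from `a` to `b`: pairs `(γ, T)` with `T ≥ 0` and `γ : [0, T] → X`
continuous, `γ 0 = a`, `γ T = b`. Here `γ` is extended to `[0, ∞)` by the constant value `b`, and the
topology is induced by the compact-open topology on `C([0, ∞), X)` and the topology of `[0, ∞)`. -/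
abbrev MoorePath (a b : X) : Type u :=
  {p : C(ℝ≥0, X) × ℝ≥0 // p.1 0 = a ∧ ∀ t, p.2 ≤ t → p.1 t = b}

/-- Concatenation of Moore paths as a function on `[0, ∞)`. -/
def concatFun {a b c : X} (p : MoorePath a b × MoorePath b c) (t : ℝ≥0) : X :=
  if t ≤ p.1.1.2 then p.1.1.1 t else p.2.1.1 (t - p.1.1.2)

theorem continuous_concatFun {a b c : X} :
    Continuous fun q : (MoorePath a b × MoorePath b c) × ℝ≥0 => concatFun q.1 q.2 := by
  refine Continuous.if_le ?_ ?_ (by fun_prop) (by fun_prop) ?_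
  · fun_prop
  · fun_prop
  · rintro ⟨⟨p, p'⟩, t⟩ h
    dsimp only at h ⊢
    rw [p.2.2 t h.ge, h, tsub_self, p'.2.1]

/-- Concatenation `(γ, T) * (γ', T')`, of length `T + T'`. -/
def concat (a b c : X) : C(MoorePath a b × MoorePath b c, MoorePath a c) where
  toFun p := ⟨(⟨concatFun p, continuous_concatFun.comp (by fun_prop : Continuous fun t => (p, t))⟩,
      p.1.1.2 + p.2.1.2), by
    refine ⟨?_, fun t ht => ?_⟩
    · change concatFun p 0 = a
      rw [concatFun, if_pos zero_le]
      exact p.1.2.1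
    · change concatFun p t = c
      rw [concatFun]
      split_ifs with h
      · have h0 : p.2.1.2 = 0 := by
          have := ht.trans h
          simpa using this
        have h1 : p.2.1.1 0 = c := p.2.2.2 0 h0.le
        rw [p.1.2.2 t ((le_add_of_nonneg_right zero_le).trans ht), ← h1, p.2.2.1]
      · exact p.2.2.2 _ (le_tsub_of_add_le_left ht)⟩
  continuous_toFun := by
    refine Continuous.subtype_mk (Continuous.prodMk ?_ (by fun_prop)) _
    exact ContinuousMap.continuous_of_continuous_uncurry _ continuous_concatFun

/-- The map of Moore path spaces induced by a continuous map. -/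
def pathMap (f : C(X, Y)) (a b : X) : C(MoorePath a b, MoorePath (f a) (f b)) where
  toFun p := ⟨(f.comp p.1.1, p.1.2), congrArg f p.2.1, fun t ht => congrArg f (p.2.2 t ht)⟩
  continuous_toFun := by
    refine Continuous.subtype_mk (Continuous.prodMk ?_ (by fun_prop)) _
    exact (ContinuousMap.continuous_postcomp f).comp (by fun_prop)

/-- The evaluation `((γ, T), (t_1, …, t_n)) ↦ (γ (t_1 T), …, γ (t_n T))`. -/
def evalMap (a b : X) (n : ℕ) : C(MoorePath a b × stdSimplex ℝ (Fin (n + 1)), Fin n → X) where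
  toFun p i := p.1.1.1 (unitInterval.toNNReal (tCoord i p.2) * p.1.1.2)
  continuous_toFun := by
    refine continuous_pi fun i => ?_
    have := continuous_tCoord i
    fun_prop

end Paths

/-! ### The dual iterated integral map -/

section IteratedIntegral

variable (R : Type v) [CommRing R] {X : Type u} [TopologicalSpace X] {Y : Type w}
  [TopologicalSpace Y]

/-- The cross product `x ↦ x × β` with a singular simplex `β`. -/
def crossWith {q : ℕ} (β : Simp q Y) : SChains R X →ₗ[R] SChains R (X × Y) :=
  liftChains (crossGen R β) (crossGen_degen R β)

/-- The map `It_X`, composed of triangulation of cubes, `x ↦ ((-1)^n x × u_n)_n` with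
`u_n = id : Δ^n → Δ^n`, evaluation of paths, and the Alexander–Whitney maps. -/
def iteratedIntegral (a b : X) :
    CubeChains R (MoorePath a b) →ₗ[R] ∀ n : ℕ, ⨂[R]^n (SChains R X) :=
  LinearMap.pi fun n => (-1 : R) ^ n • (alexanderWhitney R n ∘ₗ simpMap R (evalMap a b n) ∘ₗ
    crossWith R (ContinuousMap.id (stdSimplex ℝ (Fin (n + 1)))) ∘ₗ triangulate R)

end IteratedIntegral

/-! ### The data of a dg category -/

/-- The data of a dg category over `R`: objects, graded modules of morphisms, differential and
composition. The module `Hom a b` contains the homogeneous morphisms of all degrees, and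
`deg a b k` is the module of morphisms of degree `k`. Composition is written from left to right.
The structure only collects these data, so that one can speak of `A_∞`-functors between the two
concrete dg categories `pathCubes` and `cobarProd` below. -/
structure DGData (R : Type v) [CommRing R] where
  Obj : Type u
  Hom : Obj → Obj → Type w
  [addCommGroup : ∀ a b, AddCommGroup (Hom a b)]
  [module : ∀ a b, Module R (Hom a b)]
  deg : ∀ a b, ℤ → Submodule R (Hom a b)
  d : ∀ a b, Hom a b →ₗ[R] Hom a b
  comp : ∀ a b c, Hom a b →ₗ[R] Hom b c →ₗ[R] Hom a c

attribute [instance] DGData.addCommGroup DGData.module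

/-- The dg category `C^□(PX)`: its objects are the points of `X`, its morphisms are the normalized
cubical chains on the spaces of Moore paths, and its composition is induced by concatenation. -/
def pathCubes (R : Type v) [CommRing R] (X : Type u) [TopologicalSpace X] :
    DGData.{u, v, max u v} R where
  Obj := X
  Hom a b := CubeChains R (MoorePath a b)
  deg _ _ := cubeDeg R
  d _ _ := cubeBoundary R
  comp a b c := cubeCross R (concat a b c)

section Cobar

variable (R : Type v) [CommRing R] {X : Type u} [TopologicalSpace X] {Y : Type w}
  [TopologicalSpace Y]

/-- The tensor algebra `⨁ n, C(X)^{⊗ n}`, used to concatenate tensors. -/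
abbrev Tensors (R : Type v) [CommRing R] (X : Type u) [TopologicalSpace X] : Type (max u v) :=
  ⨁ n : ℕ, ⨂[R]^n (SChains R X)

/-- The inclusion of `C(X)^{⊗ n}` into the tensor algebra. -/
abbrev inc (n : ℕ) : ⨂[R]^n (SChains R X) →ₗ[R] Tensors R X :=
  DirectSum.lof R ℕ (fun n => ⨂[R]^n (SChains R X)) n

/-- The inclusion of `C(X)` into the tensor algebra (as the summand with `n = 1`). -/
def inc₁ : SChains R X →ₗ[R] Tensors R X :=
  (TensorAlgebra.toDirectSum (R := R) (M := SChains R X)).toLinearMap ∘ₗ TensorAlgebra.ι R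

/-- The projection of the tensor algebra to `C(X)^{⊗ n}`. -/
abbrev proj (n : ℕ) : Tensors R X →ₗ[R] ⨂[R]^n (SChains R X) :=
  DirectSum.component R ℕ (fun n => ⨂[R]^n (SChains R X)) n

/-- The elements of degree `q` of `C(X)^{⊗ n}`. -/
def tensorDeg (n : ℕ) (q : ℤ) : Submodule R (⨂[R]^n (SChains R X)) :=
  Submodule.span R {z | ∃ s : Fin n → Σ k, Simp k X, ∑ i, ((s i).1 : ℤ) = q ∧
    z = PiTensorProduct.tprod R fun i => cls R IsDegenSimp (s i)}

/-- The differential of `C(X)^{⊗ n}`: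
`c_1 ⊗ ⋯ ⊗ c_n ↦ ∑ i, (-1)^{|c_1| + ⋯ + |c_{i-1}|} c_1 ⊗ ⋯ ⊗ ∂ c_i ⊗ ⋯ ⊗ c_n`. -/
def tensorBoundary (n : ℕ) : ⨂[R]^n (SChains R X) →ₗ[R] ⨂[R]^n (SChains R X) :=
  ∑ i : Fin n, PiTensorProduct.map fun j =>
    if j < i then simpParity R else if j = i then simpBoundary R else LinearMap.id

/-- The sign involution `x ↦ (-1)^{|x|} x` of `C(X)^{⊗ n}`. -/
def tensorParity (n : ℕ) : ⨂[R]^n (SChains R X) →ₗ[R] ⨂[R]^n (SChains R X) :=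
  PiTensorProduct.map fun _ => simpParity R

/-- The point `a` as a `0`-chain. -/
def pointChain (a : X) : SChains R X := scls R (n := 0) (ContinuousMap.const _ a)

/-- The coface `c_1 ⊗ ⋯ ⊗ c_n ↦ c_1 ⊗ ⋯ ⊗ Δ c_i ⊗ ⋯ ⊗ c_n`. -/
def innerCoface (n : ℕ) (i : Fin n) : ⨂[R]^n (SChains R X) →ₗ[R] ⨂[R]^(n + 1) (SChains R X) :=
  proj R (n + 1) ∘ₗ PiTensorProduct.lift
    ((MultilinearMap.mkPiAlgebraFin R n (Tensors R X)).compLinearMap fun j =>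
      if j = i then inc R 2 ∘ₗ simpDiag R else inc₁ R)

/-- The alternating sum `∑ i, (-1)^i δ_i` of the cofaces
`R_a ⊗ C(X)^{⊗ n} ⊗ R_b → R_a ⊗ C(X)^{⊗ (n + 1)} ⊗ R_b`, where `δ_0` inserts `a` in front, `δ_i`
applies the coproduct to the `i`-th factor, and `δ_{n+1}` appends `b`. -/
def cofaceSum (a b : X) (n : ℕ) : ⨂[R]^n (SChains R X) →ₗ[R] ⨂[R]^(n + 1) (SChains R X) :=
  proj R (n + 1) ∘ₗ LinearMap.mulLeft R (inc₁ R (pointChain R a)) ∘ₗ inc R n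
    + ∑ i : Fin n, (-1 : R) ^ ((i : ℕ) + 1) • innerCoface R n i
    + (-1 : R) ^ (n + 1) •
      (proj R (n + 1) ∘ₗ LinearMap.mulRight R (inc₁ R (pointChain R b)) ∘ₗ inc R n)

/-- The part of the differential of the totalization that comes from the cofaces. An element of
total degree `k` has its `n`-th component `x n` in degree `k + n` of `C(X)^{⊗ n}`, so that the
sign `(-1)^n` together with the sign involution amounts to the sign `(-1)^k`. -/
def cobarDelta (a b : X) : ∀ n : ℕ,
    (∀ n : ℕ, ⨂[R]^n (SChains R X)) →ₗ[R] ⨂[R]^n (SChains R X)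
  | 0 => 0
  | n + 1 => (-1 : R) ^ n • (cofaceSum R a b n ∘ₗ tensorParity R n ∘ₗ LinearMap.proj n)

/-- The differential `D x = ∂ x + δ x`, where `(δ x)_{n+1} = (-1)^{|x|} ∑ i, (-1)^i δ_i x_n` with `|x|`
the total degree of `x`. -/
def cobarD (a b : X) :
    (∀ n : ℕ, ⨂[R]^n (SChains R X)) →ₗ[R] ∀ n : ℕ, ⨂[R]^n (SChains R X) :=
  LinearMap.pi fun n => tensorBoundary R n ∘ₗ LinearMap.proj n + cobarDelta R a b n

/-- The composition `(x y)_n = ∑_{i + j = n} (-1)^{i |y|} x_i ⊗ y_j`, where `|y|` is the total degree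
of `y`; the component `y_j` has degree `|y| + j` in `C(X)^{⊗ j}`. -/
def cobarComp : (∀ n : ℕ, ⨂[R]^n (SChains R X)) →ₗ[R] (∀ n : ℕ, ⨂[R]^n (SChains R X)) →ₗ[R]
    ∀ n : ℕ, ⨂[R]^n (SChains R X) :=
  LinearMap.mk₂ R
    (fun x y n => ∑ p ∈ Finset.HasAntidiagonal.antidiagonal n, (-1 : R) ^ (p.1 * p.2) •
      proj R n (inc R p.1 (x p.1) * inc R p.2 ((tensorParity R p.2 ^ p.1) (y p.2))))
    (fun x x' y => by
      funext n
      simp only [Pi.add_apply, map_add, add_mul, smul_add, Finset.sum_add_distrib])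
    (fun r x y => by
      funext n
      simp only [Pi.smul_apply, map_smul, smul_mul_assoc, Finset.smul_sum, smul_comm r])
    (fun x y y' => by
      funext n
      simp only [Pi.add_apply, map_add, mul_add, smul_add, Finset.sum_add_distrib])
    (fun r x y => by
      funext n
      simp only [Pi.smul_apply, map_smul, mul_smul_comm, Finset.smul_sum, smul_comm r])

/-- The map `∏ n, C(X)^{⊗ n} → ∏ n, C(Y)^{⊗ n}` induced by a continuous map. -/
def cobarMap (f : C(X, Y)) :
    (∀ n : ℕ, ⨂[R]^n (SChains R X)) →ₗ[R] ∀ n : ℕ, ⨂[R]^n (SChains R Y) :=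
  LinearMap.pi fun n => PiTensorProduct.map (fun _ => simpMap R f) ∘ₗ LinearMap.proj n

end Cobar

/-- The dg category `Cobar^∏(C(X))`: its objects are the points of `X`, and its morphism complex from
`a` to `b` is the totalization of the cosimplicial chain complex
`n ↦ R_a ⊗ C(X)^{⊗ n} ⊗ R_b = C(X)^{⊗ n}`, whose elements of degree `k` are the families `x` with
`x n` of degree `k + n` in `C(X)^{⊗ n}`. -/
def cobarProd (R : Type v) [CommRing R] (X : Type u) [TopologicalSpace X] :
    DGData.{u, v, max u v} R where
  Obj := X
  Hom _ _ := ∀ n : ℕ, ⨂[R]^n (SChains R X)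
  deg _ _ k := Submodule.pi Set.univ fun n => tensorDeg R n (k + n)
  d a b := cobarD R a b
  comp _ _ _ := cobarComp R

/-! ### `A_∞`-functors between dg categories -/

section AInfinity

variable {R : Type v} [CommRing R]

/-- The transport of a morphism along an equality of targets. -/
def DGData.castHom (C : DGData.{u, v, w} R) {a b b' : C.Obj} (h : b = b') (x : C.Hom a b) :
    C.Hom a b' :=
  h ▸ x

/-- The sequence `a_0, …, a_p, a_{p+2}, …` of objects, with `a_{p+1}` left out. -/
def contractObj {Ob : Type u} (a : ℕ → Ob) (p : ℕ) : ℕ → Ob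
  | 0 => a 0
  | i + 1 => match p with
    | 0 => a (i + 2)
    | p + 1 => contractObj (fun j => a (j + 1)) p i
termination_by structural i => i

theorem contractObj_of_lt {Ob : Type u} (a : ℕ → Ob) (p n : ℕ) (h : p < n) :
    contractObj a p n = a (n + 1) := by
  induction n generalizing a p with
  | zero => omega
  | succ n ih =>
    cases p with
    | zero => rfl
    | succ p => exact ih (fun j => a (j + 1)) p (by omega)

/-- The sequence `x_0, …, x_{p-1}, m_2(x_p, x_{p+1}), x_{p+2}, …` of composable morphisms. -/
def contractHom (C : DGData.{u, v, w} R) (a : ℕ → C.Obj) (x : ∀ i, C.Hom (a i) (a (i + 1)))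
    (p : ℕ) : ∀ i, C.Hom (contractObj a p i) (contractObj a p (i + 1))
  | 0 => match p with
    | 0 => C.comp _ _ _ (x 0) (x 1)
    | _ + 1 => x 0
  | i + 1 => match p with
    | 0 => x (i + 2)
    | p + 1 => contractHom C (fun j => a (j + 1)) (fun j => x (j + 1)) p i
termination_by structural i => i

/-- Families of multilinear maps
`F_n : Hom(a_0, a_1) ⊗ ⋯ ⊗ Hom(a_{n-1}, a_n) → Hom'(φ a_0, φ a_n)`. -/
abbrev Components (C : DGData.{u, v, w} R) (C' : DGData.{u, v, w} R) (φ : C.Obj → C'.Obj) :=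
  ∀ (n : ℕ) (a : Fin (n + 1) → C.Obj),
    MultilinearMap R (fun i : Fin n => C.Hom (a i.castSucc) (a i.succ))
      (C'.Hom (φ (a 0)) (φ (a (Fin.last n))))

/-- The value `F_n (x_0, …, x_{n-1})` on the first `n` members of a sequence of composable
morphisms. -/
def Components.ev {C C' : DGData.{u, v, w} R} {φ : C.Obj → C'.Obj} (F : Components C C' φ) (n : ℕ)
    (a : ℕ → C.Obj) (x : ∀ i, C.Hom (a i) (a (i + 1))) : C'.Hom (φ (a 0)) (φ (a n)) :=
  F n (fun i => a i) fun i => x i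

/-- The structure of an `A_∞`-functor between dg categories (that is, `A_∞`-categories with `m_1 = d`,
`m_2` the composition, and `m_n = 0` for `n > 2`), with a given map `φ` on objects: a family of
multilinear maps `F_n`, `n ≥ 1`, of degree `n - 1` satisfying
`∑_{p+q+r=n} (-1)^{p+qr} F_{p+1+r} (1^{⊗ p} ⊗ m_q ⊗ 1^{⊗ r})
  = ∑_{i_1+⋯+i_k=n} (-1)^ε m_k (F_{i_1} ⊗ ⋯ ⊗ F_{i_k})`, `ε = ∑ j, (k - j) (i_j - 1)`.
Tensor products of maps are evaluated on homogeneous elements with the Koszul sign rule. The relation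
is written for `n + 1` inputs `x_0, …, x_n`, which are the first members of an infinite sequence. -/
structure AInfinityFunctor (C C' : DGData.{u, v, w} R) (φ : C.Obj → C'.Obj) where
  map : Components C C' φ
  map_zero : ∀ a, map 0 a = 0
  map_mem : ∀ (n : ℕ), 1 ≤ n → ∀ (a : Fin (n + 1) → C.Obj)
    (x : ∀ i : Fin n, C.Hom (a i.castSucc) (a i.succ)) (k : Fin n → ℤ),
    (∀ i, x i ∈ C.deg _ _ (k i)) → map n a x ∈ C'.deg _ _ (∑ i, k i + n - 1)
  relation : ∀ (n : ℕ) (a : ℕ → C.Obj) (x : ∀ i, C.Hom (a i) (a (i + 1))) (k : ℕ → ℤ),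
    (∀ i, x i ∈ C.deg _ _ (k i)) →
    ∑ p : Fin (n + 1), (n + ∑ j ∈ Finset.range p, k j).negOnePow •
        map.ev (n + 1) a (Function.update x p (C.d _ _ (x p)))
      + ∑ p : Fin n, (p : ℤ).negOnePow • C'.castHom
          (congrArg φ (contractObj_of_lt a p n p.isLt))
          (map.ev n (contractObj a p) (contractHom C a x p))
    = C'.d _ _ (map.ev (n + 1) a x)
      + ∑ i : Fin n, (i + (n - i - 1) * ∑ j ∈ Finset.range (i + 1), k j : ℤ).negOnePow •
          C'.castHom (congrArg (fun m => φ (a m)) (by omega : (i + 1 : ℕ) + (n - i) = n + 1))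
            (C'.comp _ _ _ (map.ev (i + 1) a x)
              (map.ev (n - i) (fun j => a ((i + 1 : ℕ) + j)) fun j => x ((i + 1 : ℕ) + j)))

end AInfinity

end Chen

end

noncomputable section

namespace Chen

/-! ### Ordered chains -/

section Ordered

/-! The functor is built by acyclic models, with an explicit contraction in place of an existence
argument. Put `n + 1` composable chains end to end: their product is a cube of paths γ that carry
lengths T_0, …, T_n. A point of (Δ^m)^{n+1} has coordinates t_j^{(i)} with i ≤ n and j < m, and γ
can be evaluated at the m moments Σ_i t_j^{(i)} T_i. A chain of degree n + m in (Δ^m)^{n+1},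
multiplied by the cube and followed by evaluation and the Alexander–Whitney map, thus gives an
element of C(X)^{⊗m}. It remains to choose chains e_{n,m} (`universalChain`) that depend neither on
X nor on the arguments; naturality is then automatic.

In this picture concatenating two neighbouring paths adds two lengths, which is the diagonal that
doubles a coordinate (`fdup`). Composition in the cobar category puts the first p moments on the
first path and the other q on the second, which is an embedding of a product of copies of Δ^p and
Δ^q into a power of Δ^{p+q} (`fmul`). The cofaces of the cobar construction become the cofaces of
Δ^m. The A_∞ relation therefore follows from ∂e_n + (-1)^n δe_n = Σ_p (-1)^p dup_p e_{n-1} -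
Σ_{i+j=n-1} (-1)^i e_i · e_j, with e_{0,m} the fundamental simplex of Δ^m up to the sign (-1)^m,
which yields It_X. The right side is compatible with itself (`universalRhs_cycle`), and as every
power of Δ^m is a cone on the vertex 0, the equation is solved by induction on n and m with the cone
operator (`fdel_solve`, `fdel_universalChain`).

Cubes and simplices are modelled by normalized ordered chains, spanned by sequences of vertices.
Several identities between such chains come from uniqueness in a cone: a chain killed by the cone
operator is determined by its boundary and augmentation (`eq_of_ocons_eq_zero`). This gives the
interchange law of shuffle products with its sign (`omap_swapMid_oprod`), and the fact that a
product of fundamental cubes is a fundamental cube (`omap_joinAt_cubeChain`).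

The Alexander–Whitney map is treated as an iterated cup product of cochains with values in the
tensor algebra (`tlift_alexanderWhitney`). Compatibility with differentials is then the Leibniz rule
(`cup_odel`), inner cofaces are associativity of the cup product, outer cofaces are products with
constant cochains, and composition is the identity AW ∘ EZ = id (`cup_oprod`). With these facts
`cobarD_famChain` and `cobarComp_famChain` translate the cobar operations into operations on
families of ordered chains, and `componentEv_relation` collects the signs. Finally
`cubeChain_eq_sum` and `prodGen_eq_sum` unroll the recursive definitions into sums over permutations
and shuffles, which identifies the first component with It_X. -/

/-- A sequence is degenerate if two adjacent members agree. -/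
def IsDegenSeq (V : Type*) : Set (Σ n, Fin (n + 1) → V) :=
  {s | ∃ i : Fin s.1, s.2 i.castSucc = s.2 i.succ}

/-- The normalized ordered chains on a set `V` of vertices. -/
abbrev OChains (R : Type v) [CommRing R] (V : Type w) : Type (max v w) :=
  NormChains R (IsDegenSeq V)

variable (R : Type v) [CommRing R] {V W V' W' Z : Type*}

/-- The class of a sequence of vertices. -/
abbrev ocls {n : ℕ} (g : Fin (n + 1) → V) : OChains R V := cls R (IsDegenSeq V) ⟨n, g⟩

/-- The class of a single vertex. -/
abbrev opt (a : V) : OChains R V := ocls R (n := 0) fun _ => a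

/-- The chain map induced by a map of vertices. -/
def omap (h : V → W) : OChains R V →ₗ[R] OChains R W :=
  liftChains (fun s => ocls R (h ∘ s.2)) (by
    rintro s ⟨i, hi⟩
    exact cls_eq_zero ⟨i, congrArg h hi⟩)

/-- The cone operator, which prepends a vertex. -/
def ocons (a : V) : OChains R V →ₗ[R] OChains R V :=
  liftChains (fun s => ocls R (n := s.1 + 1) (Fin.cons a s.2)) (by
    rintro s ⟨i, hi⟩
    refine cls_eq_zero ⟨i.succ, ?_⟩
    simpa using hi)

/-- The augmentation. -/
def oaug : OChains R V →ₗ[R] R :=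
  liftChains (fun s => if s.1 = 0 then 1 else 0) (by
    rintro ⟨_ | n, g⟩ ⟨i, hi⟩
    · exact i.elim0
    · rfl)

/-- The sign involution. -/
def opar : OChains R V →ₗ[R] OChains R V :=
  liftChains (fun s => (-1 : R) ^ s.1 • cls R _ s)
    (fun s hs => by rw [cls_eq_zero hs, smul_zero])

variable {R}

theorem omap_ocls (h : V → W) {n : ℕ} (g : Fin (n + 1) → V) :
    omap R h (ocls R g) = ocls R (h ∘ g) := liftChains_cls _ _ _

theorem ocons_ocls (a : V) {n : ℕ} (g : Fin (n + 1) → V) :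
    ocons R a (ocls R g) = ocls R (n := n + 1) (Fin.cons a g : Fin (n + 2) → V) :=
  liftChains_cls _ _ _

theorem oaug_ocls {n : ℕ} (g : Fin (n + 1) → V) :
    oaug R (ocls R g) = if n = 0 then 1 else 0 := liftChains_cls _ _ _

theorem opar_ocls {n : ℕ} (g : Fin (n + 1) → V) :
    opar R (ocls R g) = (-1 : R) ^ n • ocls R g := liftChains_cls _ _ _

theorem ocls_zero (g : Fin 1 → V) : ocls R g = opt R (g 0) := by
  congr 2
  funext i
  rw [Subsingleton.elim i 0]

theorem ocls_succ {n : ℕ} (g : Fin (n + 2) → V) :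
    ocls R g = ocons R (g 0) (ocls R (Fin.tail g)) := by
  rw [ocons_ocls, Fin.cons_self_tail]

/-- Two linear maps that agree on vertices and on cones agree. -/
theorem ochains_ext {M : Type*} [AddCommGroup M] [Module R M] {f f' : OChains R V →ₗ[R] M}
    (h0 : ∀ a, f (opt R a) = f' (opt R a))
    (h1 : ∀ a x, f (ocons R a x) = f' (ocons R a x)) : f = f' := by
  refine chains_ext ?_
  rintro ⟨_ | n, g⟩
  · exact (congrArg f (ocls_zero g)).trans ((h0 _).trans (congrArg f' (ocls_zero g)).symm)
  · exact (congrArg f (ocls_succ g)).trans ((h1 _ _).trans (congrArg f' (ocls_succ g)).symm)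

/-- A property closed under linear combinations may be checked on sequences. -/
theorem ochains_induction_ocls {p : OChains R V → Prop} (hz : p 0)
    (hadd : ∀ x y, p x → p y → p (x + y)) (hsmul : ∀ (r : R) x, p x → p (r • x))
    (hg : ∀ n (g : Fin (n + 1) → V), p (ocls R g)) (x : OChains R V) : p x := by
  obtain ⟨x, rfl⟩ := Submodule.mkQ_surjective _ x
  induction x using Finsupp.induction_linear with
  | zero => rw [map_zero]; exact hz
  | add f g hf hg => rw [map_add]; exact hadd _ _ hf hg
  | single s r =>
    have : Finsupp.single s r = r • Finsupp.single s 1 := by simp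
    rw [this, map_smul]
    exact hsmul _ _ (hg _ _)

/-- A property closed under linear combinations may be proved by induction on the dimension. -/
theorem ochains_induction {p : OChains R V → Prop} (hz : p 0) (hadd : ∀ x y, p x → p y → p (x + y))
    (hsmul : ∀ (r : R) x, p x → p (r • x)) (h0 : ∀ a, p (opt R a))
    (h1 : ∀ a x, p x → p (ocons R a x)) (x : OChains R V) : p x := by
  refine ochains_induction_ocls hz hadd hsmul (fun n => ?_) x
  induction n with
  | zero => intro g; rw [ocls_zero]; exact h0 _
  | succ n ih => intro g; rw [ocls_succ]; exact h1 _ _ (ih _)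

@[simp] theorem omap_opt (h : V → W) (a : V) : omap R h (opt R a) = opt R (h a) := omap_ocls _ _

@[simp] theorem omap_ocons (h : V → W) (a : V) (x : OChains R V) :
    omap R h (ocons R a x) = ocons R (h a) (omap R h x) := by
  suffices H : omap R h ∘ₗ ocons R a = ocons R (h a) ∘ₗ omap R h from LinearMap.congr_fun H x
  refine chains_ext fun s => ?_
  change omap R h (ocons R a (ocls R s.2)) = ocons R (h a) (omap R h (ocls R s.2))
  rw [ocons_ocls, omap_ocls, omap_ocls, ocons_ocls]
  congr 2
  funext i
  refine Fin.cases ?_ (fun i => ?_) i <;> simp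

@[simp] theorem oaug_opt (a : V) : oaug R (opt R a) = 1 := (oaug_ocls _).trans (if_pos rfl)

@[simp] theorem oaug_ocons (a : V) (x : OChains R V) : oaug R (ocons R a x) = 0 := by
  suffices H : oaug R ∘ₗ ocons R a = 0 from LinearMap.congr_fun H x
  refine chains_ext fun s => ?_
  change oaug R (ocons R a (ocls R s.2)) = 0
  rw [ocons_ocls, oaug_ocls, if_neg (Nat.succ_ne_zero _)]

@[simp] theorem oaug_omap (h : V → W) (x : OChains R V) : oaug R (omap R h x) = oaug R x := by
  suffices H : oaug R ∘ₗ omap R h = oaug R from LinearMap.congr_fun H x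
  exact ochains_ext (by simp) (by simp)

@[simp] theorem opar_opt (a : V) : opar R (opt R a) = opt R a := by
  rw [opar_ocls, pow_zero, one_smul]

@[simp] theorem opar_ocons (a : V) (x : OChains R V) :
    opar R (ocons R a x) = -ocons R a (opar R x) := by
  suffices H : opar R ∘ₗ ocons R a = -(ocons R a ∘ₗ opar R) from LinearMap.congr_fun H x
  refine chains_ext fun s => ?_
  change opar R (ocons R a (ocls R s.2)) = -ocons R a (opar R (ocls R s.2))
  rw [ocons_ocls, opar_ocls, opar_ocls, map_smul, ocons_ocls, pow_succ, mul_neg_one, neg_smul]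

@[simp] theorem opar_opar (x : OChains R V) : opar R (opar R x) = x := by
  suffices H : opar R ∘ₗ opar R = LinearMap.id from LinearMap.congr_fun H x
  refine chains_ext fun s => ?_
  change opar R (opar R (ocls R s.2)) = ocls R s.2
  rw [opar_ocls, map_smul, opar_ocls, smul_smul, ← mul_pow, neg_one_mul, neg_neg, one_pow, one_smul]

@[simp] theorem oaug_opar (x : OChains R V) : oaug R (opar R x) = oaug R x := by
  suffices H : oaug R ∘ₗ opar R = oaug R from LinearMap.congr_fun H x
  exact ochains_ext (by simp) (by simp)

@[simp] theorem opar_omap (h : V → W) (x : OChains R V) :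
    opar R (omap R h x) = omap R h (opar R x) := by
  suffices H : opar R ∘ₗ omap R h = omap R h ∘ₗ opar R from LinearMap.congr_fun H x
  refine chains_ext fun s => ?_
  change opar R (omap R h (ocls R s.2)) = omap R h (opar R (ocls R s.2))
  rw [omap_ocls, opar_ocls, opar_ocls, map_smul, omap_ocls]

theorem omap_omap (h : V → W) (k : W → Z) (x : OChains R V) :
    omap R k (omap R h x) = omap R (k ∘ h) x := by
  suffices H : omap R k ∘ₗ omap R h = omap R (k ∘ h) from LinearMap.congr_fun H x
  refine chains_ext fun s => ?_
  change omap R k (omap R h (ocls R s.2)) = omap R _ (ocls R s.2)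
  rw [omap_ocls, omap_ocls, omap_ocls]
  rfl

theorem omap_id (x : OChains R V) : omap R id x = x := by
  suffices H : omap R (id : V → V) = LinearMap.id from LinearMap.congr_fun H x
  refine chains_ext fun s => ?_
  exact omap_ocls _ _

@[simp] theorem ocons_opt_self (a : V) : ocons R a (opt R a) = 0 := by
  rw [ocons_ocls]
  exact cls_eq_zero ⟨0, rfl⟩

@[simp] theorem ocons_ocons_self (a : V) (x : OChains R V) : ocons R a (ocons R a x) = 0 := by
  suffices H : ocons R a ∘ₗ ocons R a = 0 from LinearMap.congr_fun H x
  refine chains_ext fun s => ?_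
  change ocons R a (ocons R a (ocls R s.2)) = 0
  rw [ocons_ocls, ocons_ocls]
  exact cls_eq_zero ⟨0, rfl⟩

/-! #### The boundary -/

variable (R) in
/-- The boundary of a sequence, by recursion on the dimension. -/
def odelGen : ∀ n : ℕ, (Fin (n + 1) → V) → OChains R V
  | 0, _ => 0
  -- The recursion misses one face only when the tail is a single vertex; the augmentation term
  -- supplies it exactly then.
  | n + 1, g => ocls R (Fin.tail g) - ocons R (g 0) (odelGen n (Fin.tail g))
      - oaug R (ocls R (Fin.tail g)) • opt R (g 0)

/-- If the repetition involves the first vertex, the first two faces cancel and the rest is a double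
cone at one vertex; otherwise it survives in the tail and the recursion applies. -/
theorem odelGen_degen : ∀ (n : ℕ) (g : Fin (n + 1) → V) (i : Fin n), g i.castSucc = g i.succ →
    odelGen R n g = 0
  | 1, g, i, h => by
    obtain rfl := Subsingleton.elim i 0
    rw [odelGen, odelGen, map_zero, oaug_ocls, if_pos rfl, one_smul, sub_zero, ocls_zero]
    change opt R (g 1) - opt R (g 0) = 0
    rw [show g 0 = g 1 from h, sub_self]
  | n + 2, g, i, h => by
    rw [odelGen, oaug_ocls, if_neg (Nat.succ_ne_zero _), zero_smul, sub_zero]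
    induction i using Fin.cases with
    | zero =>
      have h' : Fin.tail g 0 = g 0 := h.symm
      rw [odelGen, map_sub, map_sub, map_smul, h', ocons_ocons_self, ocons_opt_self, smul_zero,
        sub_zero, sub_zero, ocls_succ (Fin.tail g), h', sub_self]
    | succ i =>
      have h' : Fin.tail g i.castSucc = Fin.tail g i.succ := h
      rw [odelGen_degen (n + 1) (Fin.tail g) i h', map_zero, sub_zero]
      exact cls_eq_zero ⟨i, h'⟩

variable (R) in
/-- The boundary of ordered chains. -/
def odel : OChains R V →ₗ[R] OChains R V :=
  liftChains (fun s => odelGen R s.1 s.2) fun s ⟨i, hi⟩ => odelGen_degen s.1 s.2 i hi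

@[simp] theorem odel_opt (a : V) : odel R (opt R a) = 0 := liftChains_cls _ _ _

@[simp] theorem odel_ocons (a : V) (x : OChains R V) :
    odel R (ocons R a x) = x - ocons R a (odel R x) - oaug R x • opt R a := by
  suffices H : odel R ∘ₗ ocons R a = LinearMap.id - ocons R a ∘ₗ odel R
      - (oaug R).smulRight (opt R a) from LinearMap.congr_fun H x
  refine chains_ext fun s => ?_
  change odel R (ocons R a (ocls R s.2)) = ocls R s.2 - ocons R a (odel R (ocls R s.2))
    - oaug R (ocls R s.2) • opt R a
  rw [ocons_ocls]
  refine (liftChains_cls _ _ _).trans ?_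
  rw [odelGen, Fin.tail_cons,
    show odel R (ocls R s.2) = odelGen R s.1 s.2 from liftChains_cls _ _ _]
  rfl

theorem odel_ocls : ∀ {n : ℕ} (g : Fin (n + 2) → V),
    odel R (ocls R g) = ∑ i : Fin (n + 2), (-1 : R) ^ (i : ℕ) • ocls R (g ∘ i.succAbove) := by
  intro n
  induction n with
  | zero =>
    intro g
    rw [ocls_succ, ocls_zero, odel_ocons, odel_opt, oaug_opt, Fin.sum_univ_two, ocls_zero,
      ocls_zero]
    simp [Fin.tail, sub_eq_add_neg]
  | succ n ih =>
    intro g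
    rw [ocls_succ, odel_ocons, ih, oaug_ocls, if_neg (Nat.succ_ne_zero _), zero_smul, sub_zero,
      map_sum]
    conv_rhs => rw [Fin.sum_univ_succ]
    rw [sub_eq_add_neg, ← Finset.sum_neg_distrib]
    congr 1
    · simp only [Fin.val_zero, pow_zero, one_smul, Fin.succAbove_zero]
      rfl
    · refine Finset.sum_congr rfl fun i _ => ?_
      rw [map_smul, ocons_ocls, Fin.val_succ, pow_succ, mul_neg_one, neg_smul]
      congr 4
      funext j
      refine Fin.cases ?_ (fun j => ?_) j <;> simp [Fin.tail]

@[simp] theorem oaug_odel (x : OChains R V) : oaug R (odel R x) = 0 := by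
  suffices H : oaug R ∘ₗ odel R = 0 from LinearMap.congr_fun H x
  exact ochains_ext (by simp) (by simp)

@[simp] theorem odel_omap (h : V → W) (x : OChains R V) :
    odel R (omap R h x) = omap R h (odel R x) := by
  induction x using ochains_induction with
  | hz => simp
  | hadd x y hx hy => simp [hx, hy]
  | hsmul r x hx => simp [hx]
  | h0 a => simp only [omap_opt, odel_opt, map_zero]
  | h1 a x hx =>
    simp only [omap_ocons, odel_ocons, map_sub, hx, oaug_omap, map_smul, omap_opt]

theorem odel_odel (x : OChains R V) : odel R (odel R x) = 0 := by
  induction x using ochains_induction with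
  | hz => simp
  | hadd x y hx hy => simp [hx, hy]
  | hsmul r x hx => simp [hx]
  | h0 a => simp only [odel_opt, map_zero]
  | h1 a x hx => simp [hx]

theorem odel_opar (x : OChains R V) : odel R (opar R x) = -opar R (odel R x) := by
  induction x using ochains_induction with
  | hz => simp
  | hadd x y hx hy => simp [hx, hy]; abel
  | hsmul r x hx => simp [hx]
  | h0 a => simp
  | h1 a x hx => simp [hx]

/-- A chain killed by the cone operator is determined by its boundary and its augmentation. -/
theorem eq_of_ocons_eq_zero {a : V} {x y : OChains R V} (hx : ocons R a x = 0)
    (hy : ocons R a y = 0) (hd : odel R x = odel R y) (he : oaug R x = oaug R y) : x = y := by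
  -- This is the boundary formula for a cone, applied to the zero chain `ocons R a z`.
  have h : ∀ z : OChains R V, ocons R a z = 0 → z = ocons R a (odel R z) + oaug R z • opt R a := by
    intro z hz
    have := odel_ocons a z
    rw [hz, map_zero] at this
    rw [sub_sub] at this
    exact sub_eq_zero.1 this.symm
  rw [h x hx, h y hy, hd, he]

/-- The contraction in the form that solves equations: the cone is a primitive. The universal chains
and the fundamental chain of the cube are obtained from it. -/
theorem odel_ocons_of_cycle (a : V) {z : OChains R V} (hd : odel R z = 0) (he : oaug R z = 0) :
    odel R (ocons R a z) = z := by
  rw [odel_ocons, hd, he, map_zero, zero_smul, sub_zero, sub_zero]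

/-! #### The shuffle product -/

variable (R) in
/-- The shuffle product of two sequences, by recursion on the dimensions. -/
def prodGen : ∀ p q : ℕ, (Fin (p + 1) → V) → (Fin (q + 1) → W) → OChains R (V × W)
  | 0, 0, g, h => opt R (g 0, h 0)
  | 0, q + 1, g, h => ocons R (g 0, h 0) (prodGen 0 q g (Fin.tail h))
  | p + 1, 0, g, h => ocons R (g 0, h 0) (prodGen p 0 (Fin.tail g) h)
  | p + 1, q + 1, g, h => ocons R (g 0, h 0)
      (prodGen p (q + 1) (Fin.tail g) h + (-1 : R) ^ (p + 1) • prodGen (p + 1) q g (Fin.tail h))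
termination_by p q => p + q

/-- Every branch of the recursion starts with the pair of initial vertices, so a further cone at
that pair repeats a vertex. -/
theorem ocons_prodGen (p q : ℕ) (g : Fin (p + 1) → V) (h : Fin (q + 1) → W) :
    ocons R (g 0, h 0) (prodGen R p q g h) = 0 := by
  cases p <;> cases q <;> rw [prodGen]
  · exact ocons_opt_self _
  all_goals exact ocons_ocons_self _ _

/-- The branch that keeps `g` vanishes by induction. The branch that shortens `g` does so as well,
unless the repetition is at the start; then it is a cone over a chain that already begins with the
same pair. -/
theorem prodGen_degen_left : ∀ (p q : ℕ) (g : Fin (p + 1) → V) (h : Fin (q + 1) → W) (i : Fin p),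
    g i.castSucc = g i.succ → prodGen R p q g h = 0
  | p + 1, 0, g, h, i, hi => by
    rw [prodGen]
    induction i using Fin.cases with
    | zero =>
      rw [show g 0 = Fin.tail g 0 from hi]
      exact ocons_prodGen _ _ _ _
    | succ i => rw [prodGen_degen_left p 0 (Fin.tail g) h i hi, map_zero]
  | p + 1, q + 1, g, h, i, hi => by
    rw [prodGen, prodGen_degen_left (p + 1) q g (Fin.tail h) i hi, smul_zero, add_zero]
    induction i using Fin.cases with
    | zero =>
      rw [show g 0 = Fin.tail g 0 from hi]
      exact ocons_prodGen _ _ _ _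
    | succ i => rw [prodGen_degen_left p (q + 1) (Fin.tail g) h i hi, map_zero]
termination_by p q => p + q

theorem prodGen_degen_right : ∀ (p q : ℕ) (g : Fin (p + 1) → V) (h : Fin (q + 1) → W) (i : Fin q),
    h i.castSucc = h i.succ → prodGen R p q g h = 0
  | 0, q + 1, g, h, i, hi => by
    rw [prodGen]
    induction i using Fin.cases with
    | zero =>
      rw [show h 0 = Fin.tail h 0 from hi]
      exact ocons_prodGen _ _ _ _
    | succ i => rw [prodGen_degen_right 0 q g (Fin.tail h) i hi, map_zero]
  | p + 1, q + 1, g, h, i, hi => by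
    rw [prodGen, prodGen_degen_right p (q + 1) (Fin.tail g) h i hi, zero_add, map_smul]
    refine smul_eq_zero_of_right _ ?_
    induction i using Fin.cases with
    | zero =>
      rw [show h 0 = Fin.tail h 0 from hi]
      exact ocons_prodGen _ _ _ _
    | succ i => rw [prodGen_degen_right (p + 1) q g (Fin.tail h) i hi, map_zero]
termination_by p q => p + q

variable (R) in
/-- The shuffle product of ordered chains. -/
def oprod : OChains R V →ₗ[R] OChains R W →ₗ[R] OChains R (V × W) :=
  liftChains
    (fun s => liftChains (fun t => prodGen R s.1 t.1 s.2 t.2)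
      fun t ⟨i, hi⟩ => prodGen_degen_right s.1 t.1 s.2 t.2 i hi)
    (fun s ⟨i, hi⟩ => chains_ext fun t => by
      rw [liftChains_cls, prodGen_degen_left s.1 t.1 s.2 t.2 i hi, LinearMap.zero_apply])

theorem oprod_ocls {p q : ℕ} (g : Fin (p + 1) → V) (h : Fin (q + 1) → W) :
    oprod R (ocls R g) (ocls R h) = prodGen R p q g h := by
  rw [oprod, liftChains_cls, liftChains_cls]

@[simp] theorem oprod_opt_opt (a : V) (b : W) : oprod R (opt R a) (opt R b) = opt R (a, b) := by
  rw [oprod_ocls, prodGen]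

@[simp] theorem oprod_opt_ocons (a : V) (b : W) (y : OChains R W) :
    oprod R (opt R a) (ocons R b y) = ocons R (a, b) (oprod R (opt R a) y) := by
  suffices H : oprod R (opt R a) ∘ₗ ocons R b = ocons R (a, b) ∘ₗ oprod R (opt R a) from
    LinearMap.congr_fun H y
  refine chains_ext fun s => ?_
  change oprod R (opt R a) (ocons R b (ocls R s.2)) = ocons R (a, b) (oprod R (opt R a) (ocls R s.2))
  rw [ocons_ocls, oprod_ocls, oprod_ocls, prodGen]
  simp [Fin.tail_cons]

@[simp] theorem oprod_ocons_opt (a : V) (b : W) (x : OChains R V) :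
    oprod R (ocons R a x) (opt R b) = ocons R (a, b) (oprod R x (opt R b)) := by
  suffices H : (oprod R).flip (opt R b) ∘ₗ ocons R a = ocons R (a, b) ∘ₗ (oprod R).flip (opt R b) from
    LinearMap.congr_fun H x
  refine chains_ext fun s => ?_
  change oprod R (ocons R a (ocls R s.2)) (opt R b) = ocons R (a, b) (oprod R (ocls R s.2) (opt R b))
  rw [ocons_ocls, oprod_ocls, oprod_ocls, prodGen]
  simp [Fin.tail_cons]

/-- The recursion with its sign (-1)^{p+1} absorbed into `opar` and a minus, so that it holds for
chains of mixed degree. -/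
theorem oprod_ocons_ocons (a : V) (b : W) (x : OChains R V) (y : OChains R W) :
    oprod R (ocons R a x) (ocons R b y) =
      ocons R (a, b) (oprod R x (ocons R b y) - oprod R (ocons R a (opar R x)) y) := by
  suffices H : (oprod R).compl₁₂ (ocons R a) (ocons R b) =
      ((oprod R).compl₂ (ocons R b) - (oprod R).comp (ocons R a ∘ₗ opar R)).compr₂
        (ocons R (a, b)) from LinearMap.congr_fun₂ H x y
  refine chains_ext fun s => chains_ext fun t => ?_
  change oprod R (ocons R a (ocls R s.2)) (ocons R b (ocls R t.2)) =
    ocons R (a, b) (oprod R (ocls R s.2) (ocons R b (ocls R t.2)) -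
      oprod R (ocons R a (opar R (ocls R s.2))) (ocls R t.2))
  rw [opar_ocls, map_smul, ocons_ocls, ocons_ocls, map_smul, LinearMap.smul_apply, oprod_ocls,
    oprod_ocls, oprod_ocls, prodGen]
  simp only [Fin.tail_cons, Fin.cons_zero, pow_succ, mul_neg_one, neg_smul, sub_eq_add_neg]

/-- A bilinear identity may be proved by induction on the dimensions. -/
theorem ochains_ext₂ {M : Type*} [AddCommGroup M] [Module R M]
    {f f' : OChains R V →ₗ[R] OChains R W →ₗ[R] M}
    (h00 : ∀ a b, f (opt R a) (opt R b) = f' (opt R a) (opt R b))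
    (h01 : ∀ a b y, f (opt R a) y = f' (opt R a) y →
      f (opt R a) (ocons R b y) = f' (opt R a) (ocons R b y))
    (h10 : ∀ a b x, f x (opt R b) = f' x (opt R b) →
      f (ocons R a x) (opt R b) = f' (ocons R a x) (opt R b))
    (h11 : ∀ a b x y, (∀ y, f x y = f' x y) →
      (f (ocons R a (opar R x)) y = f' (ocons R a (opar R x)) y) →
      f (ocons R a x) (ocons R b y) = f' (ocons R a x) (ocons R b y)) : f = f' := by
  refine LinearMap.ext fun x => ?_
  refine ochains_induction_ocls (p := fun x => f x = f' x) (by simp) (by simp +contextual)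
    (by simp +contextual) (fun n => ?_) x
  induction n with
  | zero =>
    intro g
    refine LinearMap.ext fun y => ?_
    rw [ocls_zero]
    induction y using ochains_induction with
    | hz => simp
    | hadd y y' hy hy' => simp [hy, hy']
    | hsmul r y hy => simp [hy]
    | h0 b => exact h00 _ b
    | h1 b y hy => exact h01 _ b y hy
  | succ n ih =>
    intro g
    refine LinearMap.ext fun y => ?_
    induction y using ochains_induction with
    | hz => simp
    | hadd y y' hy hy' => simp [hy, hy']
    | hsmul r y hy => simp [hy]
    | h0 b =>
      rw [ocls_succ]
      exact h10 _ b _ (by rw [ih])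
    | h1 b y hy =>
      rw [ocls_succ] at hy ⊢
      refine h11 _ b _ y (by simp [ih]) ?_
      -- On a sequence `opar` is only a sign, so the hypothesis for the shorter second argument also
      -- covers the term with `opar`.
      rw [opar_ocls, map_smul, map_smul, map_smul, LinearMap.smul_apply, LinearMap.smul_apply, hy]

@[simp] theorem opar_oprod (x : OChains R V) (y : OChains R W) :
    opar R (oprod R x y) = oprod R (opar R x) (opar R y) := by
  suffices H : (oprod R).compr₂ (opar R) = (oprod R (V := V) (W := W)).compl₁₂ (opar R) (opar R) from
    LinearMap.congr_fun₂ H x y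
  refine ochains_ext₂ ?_ ?_ ?_ ?_
  · simp
  · intro a b y h
    simp only [LinearMap.compr₂_apply, LinearMap.compl₁₂_apply, opar_opt] at h
    simp [h]
  · intro a b x h
    simp only [LinearMap.compr₂_apply, LinearMap.compl₁₂_apply, opar_opt] at h
    simp [h]
  · intro a b x y h1 h2
    simp only [LinearMap.compr₂_apply, LinearMap.compl₁₂_apply, opar_ocons, map_neg, opar_opar,
      LinearMap.neg_apply] at h1 h2 ⊢
    simp [oprod_ocons_ocons, h1, h2]

theorem omap_oprod (h : V → V') (k : W → W') (x : OChains R V) (y : OChains R W) :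
    omap R (Prod.map h k) (oprod R x y) = oprod R (omap R h x) (omap R k y) := by
  suffices H : (oprod R).compr₂ (omap R (Prod.map h k)) =
      (oprod R (V := V') (W := W')).compl₁₂ (omap R h) (omap R k) from LinearMap.congr_fun₂ H x y
  refine ochains_ext₂ ?_ ?_ ?_ ?_
  · simp
  · intro a b y h
    simp only [LinearMap.compr₂_apply, LinearMap.compl₁₂_apply, omap_opt] at h
    simp [h]
  · intro a b x h
    simp only [LinearMap.compr₂_apply, LinearMap.compl₁₂_apply, omap_opt] at h
    simp [h]
  · intro a b x y h1 h2
    simp only [LinearMap.compr₂_apply, LinearMap.compl₁₂_apply, omap_ocons, ← opar_omap] at h1 h2 ⊢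
    simp [oprod_ocons_ocons, h1, h2]

@[simp] theorem oaug_oprod (x : OChains R V) (y : OChains R W) :
    oaug R (oprod R x y) = oaug R x * oaug R y := by
  suffices H : (oprod R).compr₂ (oaug R) =
      (LinearMap.mul R R).compl₁₂ (oaug R (V := V)) (oaug R (V := W)) from
    LinearMap.congr_fun₂ H x y
  refine ochains_ext₂ ?_ ?_ ?_ ?_
  · simp
  · intro a b y h
    simp
  · intro a b x h
    simp
  · intro a b x y h1 h2
    simp [oprod_ocons_ocons]

/-- The Leibniz rule. -/
theorem odel_oprod (x : OChains R V) (y : OChains R W) :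
    odel R (oprod R x y) = oprod R (odel R x) y + oprod R (opar R x) (odel R y) := by
  suffices H : (oprod R).compr₂ (odel R) =
      (oprod R (V := V) (W := W)).comp (odel R) + (oprod R).compl₁₂ (opar R) (odel R) from
    LinearMap.congr_fun₂ H x y
  refine ochains_ext₂ ?_ ?_ ?_ ?_
  · simp
  · intro a b y h
    simp only [LinearMap.compr₂_apply, LinearMap.compl₁₂_apply, LinearMap.comp_apply,
      LinearMap.add_apply, opar_opt] at h
    simp [h]
  · intro a b x h
    simp only [LinearMap.compr₂_apply, LinearMap.compl₁₂_apply, LinearMap.comp_apply,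
      LinearMap.add_apply] at h
    simp [h]
  · intro a b x y h1 h2
    simp only [LinearMap.compr₂_apply, LinearMap.compl₁₂_apply, LinearMap.comp_apply,
      LinearMap.add_apply, opar_ocons, opar_opar, map_neg, LinearMap.neg_apply] at h1 h2 ⊢
    -- Both products under the cone are covered by the induction; what follows only expands and
    -- cancels.
    rw [oprod_ocons_ocons, odel_ocons, map_sub (odel R), h1, h2]
    simp only [odel_ocons, map_sub, map_add, map_neg, map_smul, LinearMap.sub_apply, oaug_oprod,
      oaug_ocons, LinearMap.smul_apply, LinearMap.neg_apply, oprod_ocons_ocons, oprod_opt_ocons,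
      oprod_ocons_opt, odel_opar, opar_opar, mul_zero, zero_mul, sub_zero, zero_smul,
      oaug_opar]
    abel_nf

/-! #### Degrees -/

variable (R V) in
/-- The ordered chains of degree `d`. -/
def ocDeg (d : ℕ) : Submodule R (OChains R V) :=
  Submodule.span R (Set.range fun g : Fin (d + 1) → V => ocls R g)

theorem ocls_mem {d : ℕ} (g : Fin (d + 1) → V) : ocls R g ∈ ocDeg R V d :=
  Submodule.subset_span ⟨g, rfl⟩

theorem map_mem_of_ocls {M : Type*} [AddCommGroup M] [Module R M] {f : OChains R V →ₗ[R] M}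
    {S : Submodule R M} {d : ℕ} (h : ∀ g : Fin (d + 1) → V, f (ocls R g) ∈ S) {x : OChains R V}
    (hx : x ∈ ocDeg R V d) : f x ∈ S := by
  have : ocDeg R V d ≤ S.comap f := Submodule.span_le.2 (by rintro _ ⟨g, rfl⟩; exact h g)
  exact this hx

theorem ocons_mem (a : V) {d : ℕ} {x : OChains R V} (hx : x ∈ ocDeg R V d) :
    ocons R a x ∈ ocDeg R V (d + 1) :=
  map_mem_of_ocls (fun g => by rw [ocons_ocls]; exact ocls_mem _) hx

theorem omap_mem (h : V → W) {d : ℕ} {x : OChains R V} (hx : x ∈ ocDeg R V d) :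
    omap R h x ∈ ocDeg R W d :=
  map_mem_of_ocls (fun g => by rw [omap_ocls]; exact ocls_mem _) hx

theorem odel_mem {d : ℕ} {x : OChains R V} (hx : x ∈ ocDeg R V (d + 1)) :
    odel R x ∈ ocDeg R V d :=
  map_mem_of_ocls (fun g => by
    rw [odel_ocls]
    exact Submodule.sum_mem _ fun i _ => Submodule.smul_mem _ _ (ocls_mem _)) hx

theorem odel_eq_zero {x : OChains R V} (hx : x ∈ ocDeg R V 0) : odel R x = 0 :=
  map_mem_of_ocls (S := ⊥) (fun g => by rw [ocls_zero, odel_opt]; exact Submodule.zero_mem _) hx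

theorem opar_of_mem {d : ℕ} {x : OChains R V} (hx : x ∈ ocDeg R V d) :
    opar R x = (-1 : R) ^ d • x := by
  have := map_mem_of_ocls (f := opar R - (-1 : R) ^ d • LinearMap.id) (S := ⊥)
    (fun g => by simp [opar_ocls]) hx
  simpa [sub_eq_zero] using this

theorem prodGen_mem : ∀ (p q : ℕ) (g : Fin (p + 1) → V) (h : Fin (q + 1) → W),
    prodGen R p q g h ∈ ocDeg R (V × W) (p + q)
  | 0, 0, g, h => by rw [prodGen]; exact ocls_mem _
  | 0, q + 1, g, h => by rw [prodGen]; exact ocons_mem _ (prodGen_mem 0 q _ _)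
  | p + 1, 0, g, h => by rw [prodGen]; exact ocons_mem _ (prodGen_mem p 0 _ _)
  | p + 1, q + 1, g, h => by
    rw [prodGen]
    refine ocons_mem (d := p + 1 + q) _ (add_mem ?_ (Submodule.smul_mem _ _ ?_))
    · rw [add_right_comm]; exact prodGen_mem p (q + 1) _ _
    · exact prodGen_mem (p + 1) q _ _
termination_by p q => p + q

theorem oprod_mem {p q : ℕ} {x : OChains R V} {y : OChains R W} (hx : x ∈ ocDeg R V p)
    (hy : y ∈ ocDeg R W q) : oprod R x y ∈ ocDeg R (V × W) (p + q) := by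
  refine map_mem_of_ocls (f := oprod R x) (fun h => ?_) hy
  refine map_mem_of_ocls (f := (oprod R).flip (ocls R h)) (fun g => ?_) hx
  rw [LinearMap.flip_apply, oprod_ocls]
  exact prodGen_mem _ _ _ _

/-- The shuffle of the two middle factors of a fourfold product. -/
def swapMid (s : (V × W) × (V' × W')) : (V × V') × (W × W') := ((s.1.1, s.2.1), (s.1.2, s.2.2))

theorem eq_of_ocls {M : Type*} [AddCommGroup M] [Module R M] (f f' : OChains R V →ₗ[R] M)
    {d : ℕ} (h : ∀ g : Fin (d + 1) → V, f (ocls R g) = f' (ocls R g)) {x : OChains R V}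
    (hx : x ∈ ocDeg R V d) : f x = f' x := by
  have := map_mem_of_ocls (f := f - f') (S := ⊥) (fun g => by simp [h]) hx
  simpa [sub_eq_zero] using this

/-- A chain killed by the cone at `a` is a cone at `a` plus a multiple of the vertex `a`; the
product of two such chains is again of this form at the pair. -/
theorem ocons_oprod {a : V} {b : W} {x : OChains R V} {y : OChains R W} (hx : ocons R a x = 0)
    (hy : ocons R b y = 0) : ocons R (a, b) (oprod R x y) = 0 := by
  have hx' : x = ocons R a (odel R x) + oaug R x • opt R a :=
    eq_of_ocons_eq_zero hx (by simp) (by simp [odel_odel]) (by simp)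
  have hy' : y = ocons R b (odel R y) + oaug R y • opt R b :=
    eq_of_ocons_eq_zero hy (by simp) (by simp [odel_odel]) (by simp)
  rw [hx', hy']
  simp [oprod_ocons_ocons]

theorem ocons_ocls_self {n : ℕ} (g : Fin (n + 1) → V) : ocons R (g 0) (ocls R g) = 0 := by
  cases n with
  | zero => rw [ocls_zero, ocons_opt_self]
  | succ n => rw [ocls_succ, ocons_ocons_self]

theorem odel_mem_or {d : ℕ} {x : OChains R V} (hx : x ∈ ocDeg R V d) :
    odel R x = 0 ∨ ∃ e, d = e + 1 ∧ odel R x ∈ ocDeg R V e := by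
  cases d with
  | zero => exact .inl (odel_eq_zero hx)
  | succ e => exact .inr ⟨e, rfl, odel_mem hx⟩

theorem oaug_of_mem {d : ℕ} {x : OChains R V} (hx : x ∈ ocDeg R V (d + 1)) : oaug R x = 0 :=
  eq_of_ocls (oaug R) 0 (fun g => by rw [oaug_ocls, if_neg (Nat.succ_ne_zero _)]; rfl) hx

/-- The interchange law for shuffle products. -/
theorem omap_swapMid_oprod {p q r s : ℕ} {x : OChains R V} {y : OChains R W} {z : OChains R V'}
    {w : OChains R W'} (hx : x ∈ ocDeg R V p) (hy : y ∈ ocDeg R W q) (hz : z ∈ ocDeg R V' r)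
    (hw : w ∈ ocDeg R W' s) : omap R swapMid (oprod R (oprod R x y) (oprod R z w)) =
      (-1 : R) ^ (q * r) • oprod R (oprod R x z) (oprod R y w) := by
  induction hN : p + q + r + s using Nat.strong_induction_on generalizing p q r s x y z w with
  | _ N ih =>
  -- By linearity in each slot the arguments become sequences, which are killed by the cones at
  -- their own first vertices. This is what uniqueness in a cone requires of both sides; their
  -- boundaries agree by induction on the total degree.
  refine eq_of_ocls (omap R swapMid ∘ₗ (oprod R).flip (oprod R z w) ∘ₗ (oprod R).flip y)
    ((-1 : R) ^ (q * r) • ((oprod R).flip (oprod R y w) ∘ₗ (oprod R).flip z)) (fun g₁ => ?_) hx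
  refine eq_of_ocls (omap R swapMid ∘ₗ (oprod R).flip (oprod R z w) ∘ₗ oprod R (ocls R g₁))
    ((-1 : R) ^ (q * r) • (oprod R (oprod R (ocls R g₁) z) ∘ₗ (oprod R).flip w)) (fun g₂ => ?_) hy
  refine eq_of_ocls (omap R swapMid ∘ₗ oprod R (oprod R (ocls R g₁) (ocls R g₂)) ∘ₗ
      (oprod R).flip w)
    ((-1 : R) ^ (q * r) • ((oprod R).flip (oprod R (ocls R g₂) w) ∘ₗ oprod R (ocls R g₁)))
    (fun g₃ => ?_) hz
  refine eq_of_ocls (omap R swapMid ∘ₗ oprod R (oprod R (ocls R g₁) (ocls R g₂)) ∘ₗ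
      oprod R (ocls R g₃))
    ((-1 : R) ^ (q * r) • (oprod R (oprod R (ocls R g₁) (ocls R g₃)) ∘ₗ oprod R (ocls R g₂)))
    (fun g₄ => ?_) hw
  have m₁ := ocls_mem (R := R) g₁
  have m₂ := ocls_mem (R := R) g₂
  have m₃ := ocls_mem (R := R) g₃
  have m₄ := ocls_mem (R := R) g₄
  have c₁ := ocons_ocls_self (R := R) g₁
  have c₂ := ocons_ocls_self (R := R) g₂
  have c₃ := ocons_ocls_self (R := R) g₃
  have c₄ := ocons_ocls_self (R := R) g₄
  simp only [LinearMap.comp_apply, LinearMap.smul_apply]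
  generalize ocls R g₁ = x, ocls R g₂ = y, ocls R g₃ = z, ocls R g₄ = w at *
  have h1 : omap R swapMid (oprod R (oprod R (odel R x) y) (oprod R z w)) =
      (-1 : R) ^ (q * r) • oprod R (oprod R (odel R x) z) (oprod R y w) := by
    obtain h | ⟨e, rfl, h⟩ := odel_mem_or m₁
    · simp [h]
    · exact ih _ (by omega) h m₂ m₃ m₄ rfl
  -- Lowering the degree of `y` by one changes the interchange sign by (-1)^r; for `z` below the
  -- change is (-1)^q.
  have h2 : omap R swapMid (oprod R (oprod R x (odel R y)) (oprod R z w)) =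
      (-1 : R) ^ r • (-1 : R) ^ (q * r) • oprod R (oprod R x z) (oprod R (odel R y) w) := by
    obtain h | ⟨e, rfl, h⟩ := odel_mem_or m₂
    · simp [h]
    · rw [ih _ (by omega) m₁ h m₃ m₄ rfl, smul_smul, ← pow_add, add_mul, one_mul, add_comm,
        add_assoc, ← two_mul, pow_add, pow_mul _ 2, neg_one_sq, one_pow, mul_one]
  have h3 : (-1 : R) ^ q • omap R swapMid (oprod R (oprod R x y) (oprod R (odel R z) w)) =
      (-1 : R) ^ (q * r) • oprod R (oprod R x (odel R z)) (oprod R y w) := by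
    obtain h | ⟨e, rfl, h⟩ := odel_mem_or m₃
    · simp [h]
    · rw [ih _ (by omega) m₁ m₂ h m₄ rfl, smul_smul, ← pow_add, mul_add, mul_one, add_comm]
  have h4 : omap R swapMid (oprod R (oprod R x y) (oprod R z (odel R w))) =
      (-1 : R) ^ (q * r) • oprod R (oprod R x z) (oprod R y (odel R w)) := by
    obtain h | ⟨e, rfl, h⟩ := odel_mem_or m₄
    · simp [h]
    · exact ih _ (by omega) m₁ m₂ m₃ h rfl
  refine eq_of_ocons_eq_zero (a := swapMid ((g₁ 0, g₂ 0), (g₃ 0, g₄ 0))) ?_ ?_ ?_ ?_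
  · rw [← omap_ocons, ocons_oprod (ocons_oprod c₁ c₂) (ocons_oprod c₃ c₄), map_zero]
  · rw [map_smul, swapMid, ocons_oprod (ocons_oprod c₁ c₃) (ocons_oprod c₂ c₄), smul_zero]
  · simp only [odel_omap, odel_oprod, map_smul, map_add, LinearMap.add_apply, opar_oprod,
      opar_of_mem m₁, opar_of_mem m₂, opar_of_mem m₃, LinearMap.smul_apply, h1, h2, h4]
    linear_combination (norm := module) ((-1 : R) ^ p) • h3
  · simp only [oaug_omap, oaug_oprod, map_smul, smul_eq_mul]
    -- The augmentation kills `y` unless q = 0, and then the sign is 1.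
    cases q with
    | zero => ring
    | succ q => rw [oaug_of_mem m₂]; ring

end Ordered
end Chen

namespace Chen

/-! ### Alternating double sums, and the cube as an ordered chain -/

section Universal

variable (R : Type v) [CommRing R]

/-- Double alternating sums of simplicial or cubical type vanish. -/
theorem sum_sum_alternating_eq_zero {M : Type*} [AddCommGroup M] [Module R M] (n : ℕ)
    (a : ℕ → ℕ → M) (h : ∀ i j, i ≤ j → j < n → a i j = a (j + 1) i) :
    ∑ i ∈ Finset.range (n + 1), (-1 : R) ^ i • ∑ j ∈ Finset.range n, (-1 : R) ^ j • a i j = 0 := by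
  simp only [Finset.smul_sum, smul_smul, ← pow_add]
  rw [← Finset.sum_product']
  -- The hypothesis matches (i, j) for i ≤ j with (j + 1, i), and the two signs are opposite.
  refine Finset.sum_involution
    (fun x _ => if x.1 ≤ x.2 then (x.2 + 1, x.1) else (x.2, x.1 - 1)) ?_ ?_ ?_ ?_
  · rintro ⟨i, j⟩ hij
    simp only [Finset.mem_product, Finset.mem_range] at hij
    dsimp only
    split_ifs with hle
    · rw [h i j hle hij.2, show j + 1 + i = i + j + 1 by omega, pow_succ, mul_neg_one, neg_smul]
      dsimp only
      exact add_neg_cancel _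
    · obtain ⟨i, rfl⟩ : ∃ k, i = k + 1 := ⟨i - 1, by omega⟩
      rw [Nat.add_sub_cancel, h j i (by omega) (by omega),
        show i + 1 + j = j + i + 1 by omega, pow_succ, mul_neg_one, neg_smul]
      exact neg_add_cancel _
  · rintro ⟨i, j⟩ hij _ he
    dsimp only at he
    split_ifs at he <;> simp only [Prod.mk.injEq] at he <;> omega
  · rintro ⟨i, j⟩ hij
    simp only [Finset.mem_product, Finset.mem_range] at hij ⊢
    split_ifs <;> dsimp only <;> omega
  · rintro ⟨i, j⟩ hij
    dsimp only
    by_cases hle : i ≤ j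
    · simp [hle, show ¬ j + 1 ≤ i by omega]
    · simp only [hle, if_false]
      rw [if_pos (by omega)]
      exact Prod.ext (by dsimp only; omega) rfl

/-! #### The fundamental chain of the cube -/

/-- The insertion of the value `e` at the position `i` of a sequence. -/
def insAt (i e : ℕ) (w : ℕ → ℕ) : ℕ → ℕ := fun j => if j < i then w j else if j = i then e else w (j - 1)

theorem insAt_insAt {i j : ℕ} (h : i ≤ j) (e e' : ℕ) :
    insAt i e ∘ insAt j e' = insAt (j + 1) e' ∘ insAt i e := by
  funext w k
  simp only [insAt, Function.comp]
  split_ifs <;> first | rfl | omega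

theorem insAt_zero (i : ℕ) : insAt i 0 0 = 0 := by
  funext k
  simp [insAt]

/-- The signed sum of the faces of a chain in the cube. -/
def cubeFaces (k : ℕ) : OChains R (ℕ → ℕ) →ₗ[R] OChains R (ℕ → ℕ) :=
  ∑ i ∈ Finset.range k, (-1 : R) ^ i • (omap R (insAt i 1) - omap R (insAt i 0))

theorem cubeFaces_apply (k : ℕ) (x : OChains R (ℕ → ℕ)) : cubeFaces R k x =
    ∑ i ∈ Finset.range k, (-1 : R) ^ i • (omap R (insAt i 1) x - omap R (insAt i 0) x) := by
  simp [cubeFaces, LinearMap.sum_apply]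

theorem cubeFaces_cubeFaces (k : ℕ) (x : OChains R (ℕ → ℕ)) :
    cubeFaces R (k + 1) (cubeFaces R k x) = 0 := by
  have := sum_sum_alternating_eq_zero R k (fun i j =>
    (omap R (insAt i 1) - omap R (insAt i 0)) (omap R (insAt j 1) x - omap R (insAt j 0) x)) (by
      intro i j h _
      simp only [map_sub, LinearMap.sub_apply, omap_omap, insAt_insAt h]
      abel)
  rw [cubeFaces_apply, ← this]
  refine Finset.sum_congr rfl fun i _ => ?_
  rw [← LinearMap.sub_apply, cubeFaces_apply, map_sum]
  simp only [map_smul]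

/-- The fundamental chain of the `k`-cube, as an ordered chain on sequences of which only the first
`k` members matter. -/
def cubeChain : ℕ → OChains R (ℕ → ℕ)
  | 0 => opt R 0
  -- Only the faces opposite to the origin enter: the others already begin at the origin.
  | k + 1 => ocons R 0
      (∑ i ∈ Finset.range (k + 1), (-1 : R) ^ i • omap R (insAt i 1) (cubeChain k))

theorem ocons_cubeChain (k : ℕ) : ocons R 0 (cubeChain R k) = 0 := by
  cases k <;> rw [cubeChain]
  · exact ocons_opt_self _
  · exact ocons_ocons_self _ _

theorem oaug_cubeChain (k : ℕ) : oaug R (cubeChain R k) = if k = 0 then 1 else 0 := by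
  cases k <;> rw [cubeChain] <;> simp

theorem cubeChain_mem : ∀ k : ℕ, cubeChain R k ∈ ocDeg R (ℕ → ℕ) k
  | 0 => ocls_mem _
  | k + 1 => by
    rw [cubeChain]
    exact ocons_mem _ (Submodule.sum_mem _ fun i _ => Submodule.smul_mem _ _
      (omap_mem _ (cubeChain_mem k)))

/-- The faces through the origin are killed by the cone and can be added freely. The cone is then
taken over the full alternating sum of faces, which is a cycle. -/
theorem cubeChain_succ (k : ℕ) :
    cubeChain R (k + 1) = ocons R 0 (cubeFaces R (k + 1) (cubeChain R k)) := by
  rw [cubeChain, cubeFaces_apply, map_sum, map_sum]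
  refine Finset.sum_congr rfl fun i _ => ?_
  have : ocons R 0 (omap R (insAt i 0) (cubeChain R k)) = 0 := by
    have := omap_ocons (R := R) (insAt i 0) 0 (cubeChain R k)
    rw [ocons_cubeChain, map_zero, insAt_zero] at this
    exact this.symm
  rw [map_smul, map_smul, map_sub, this, sub_zero]

/-- The alternating sum of faces is a cycle, by induction and `cubeFaces_cubeFaces`, and has
augmentation zero; hence the boundary of the cone over it is the sum itself. -/
theorem odel_cubeChain_succ (k : ℕ) :
    odel R (cubeChain R (k + 1)) = cubeFaces R (k + 1) (cubeChain R k) := by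
  have hcomm : ∀ (k : ℕ) (x : OChains R (ℕ → ℕ)),
      odel R (cubeFaces R k x) = cubeFaces R k (odel R x) := fun k x => by
    simp only [cubeFaces_apply, map_sum, map_smul, map_sub, odel_omap]
  rw [cubeChain_succ]
  refine odel_ocons_of_cycle _ ?_ ?_
  · rw [hcomm]
    cases k with
    | zero => rw [cubeChain, odel_opt, map_zero]
    | succ k => rw [odel_cubeChain_succ k, cubeFaces_cubeFaces]
  · rw [cubeFaces_apply, map_sum]
    refine Finset.sum_eq_zero fun i _ => ?_
    rw [map_smul, map_sub, oaug_omap, oaug_omap, sub_self, smul_zero]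

/-- For k = 0 the truncated k - 1 is harmless, because the sum of faces is empty. -/
theorem odel_cubeChain (k : ℕ) : odel R (cubeChain R k) = cubeFaces R k (cubeChain R (k - 1)) := by
  cases k with
  | zero => simp [cubeChain, cubeFaces]
  | succ k => exact odel_cubeChain_succ R k

/-- The fundamental chain becomes degenerate when one coordinate is forgotten. -/
theorem omap_update_cubeChain (k i : ℕ) (hi : i < k) :
    omap R (fun w => Function.update w i 0) (cubeChain R k) = 0 := by
  have hz : Function.update (0 : ℕ → ℕ) i 0 = 0 := Function.update_eq_self i (0 : ℕ → ℕ)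
  refine eq_of_ocons_eq_zero (a := 0) ?_ (map_zero _) ?_ ?_
  · have := omap_ocons (R := R) (fun w => Function.update w i 0) 0 (cubeChain R k)
    rw [ocons_cubeChain, map_zero, hz] at this
    exact this.symm
  · rw [odel_omap, odel_cubeChain, map_zero, cubeFaces_apply, map_sum]
    refine Finset.sum_eq_zero fun j hj => ?_
    rw [Finset.mem_range] at hj
    rw [map_smul, map_sub, omap_omap, omap_omap]
    refine smul_eq_zero_of_right _ ?_
    -- The two faces in the forgotten direction become equal and cancel; every other face vanishes
    -- by induction, with one coordinate less.
    obtain h | rfl | h := lt_trichotomy i j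
    · have key : ∀ e, (fun w => Function.update w i 0) ∘ insAt j e =
          insAt j e ∘ fun w => Function.update w i 0 := fun e => by
        funext w l
        simp only [insAt, Function.comp, Function.update_apply]
        split_ifs <;> first | rfl | omega
      rw [key, key, ← omap_omap, ← omap_omap, omap_update_cubeChain (k - 1) i (by omega)]
      simp
    · have key : ∀ e, (fun w => Function.update w i 0) ∘ insAt i e = insAt i 0 := fun e => by
        funext w l
        simp only [insAt, Function.comp, Function.update_apply]
        split_ifs <;> first | rfl | omega
      rw [key, key, sub_self]
    · have key : ∀ e, (fun w => Function.update w i 0) ∘ insAt j e =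
          insAt j e ∘ fun w => Function.update w (i - 1) 0 := fun e => by
        funext w l
        simp only [insAt, Function.comp, Function.update_apply]
        split_ifs <;> first | rfl | omega
      rw [key, key, ← omap_omap, ← omap_omap, omap_update_cubeChain (k - 1) (i - 1) (by omega)]
      simp
  · rw [oaug_omap, oaug_cubeChain, if_neg (by omega), map_zero]
termination_by k

/-- The concatenation of the first `k` members of a sequence with another sequence. -/
def joinAt (k : ℕ) (s : (ℕ → ℕ) × (ℕ → ℕ)) : ℕ → ℕ := fun j => if j < k then s.1 j else s.2 (j - k)

/-- Uniqueness in the cone at the origin: the Leibniz rule splits the boundary into the faces in the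
first k and in the last l directions, and the induction identifies each of them. -/
theorem omap_joinAt_cubeChain (k l : ℕ) :
    omap R (joinAt k) (oprod R (cubeChain R k) (cubeChain R l)) = cubeChain R (k + l) := by
  have hz : joinAt k (0, 0) = 0 := by
    funext j
    simp [joinAt]
  refine eq_of_ocons_eq_zero (a := 0) ?_ (ocons_cubeChain R _) ?_ ?_
  · have := omap_ocons (R := R) (joinAt k) (0, 0) (oprod R (cubeChain R k) (cubeChain R l))
    rw [ocons_oprod (ocons_cubeChain R _) (ocons_cubeChain R _), map_zero, hz] at this
    exact this.symm
  · rw [odel_omap, odel_oprod, odel_cubeChain, odel_cubeChain, odel_cubeChain,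
      opar_of_mem (cubeChain_mem R k), cubeFaces_apply, cubeFaces_apply, cubeFaces_apply,
      Finset.sum_range_add]
    rw [map_sum, map_sum, LinearMap.sum_apply, map_add, map_sum, map_sum]
    congr 1
    · refine Finset.sum_congr rfl fun i hi' => ?_
      have hi := Finset.mem_range.1 hi'
      have key : ∀ e, joinAt k ∘ Prod.map (insAt i e) id = insAt i e ∘ joinAt (k - 1) := fun e => by
        funext s l
        simp only [insAt, Function.comp, joinAt, Prod.map, id]
        split_ifs <;> first | rfl | omega | exact congrArg s.2 (by omega)
      have key' : ∀ e (y : OChains R (ℕ → ℕ)),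
          omap R (joinAt k) (oprod R (omap R (insAt i e) (cubeChain R (k - 1))) y) =
          omap R (insAt i e) (omap R (joinAt (k - 1)) (oprod R (cubeChain R (k - 1)) y)) :=
        fun e y => by
          have := omap_oprod (insAt i e) id (cubeChain R (k - 1)) y
          rw [omap_id] at this
          rw [← this, omap_omap, omap_omap, key]
      simp only [map_smul, map_sub, LinearMap.smul_apply, LinearMap.sub_apply, key']
      rw [omap_joinAt_cubeChain (k - 1) l, show k - 1 + l = k + l - 1 by omega]
    · refine Finset.sum_congr rfl fun i hi' => ?_
      have hi := Finset.mem_range.1 hi'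
      have key : ∀ e, joinAt k ∘ Prod.map id (insAt i e) = insAt (k + i) e ∘ joinAt k := fun e => by
        funext s l
        simp only [insAt, Function.comp, joinAt, Prod.map, id]
        split_ifs <;> first | rfl | omega | exact congrArg s.2 (by omega)
      have key' : ∀ e (x : OChains R (ℕ → ℕ)),
          omap R (joinAt k) (oprod R x (omap R (insAt i e) (cubeChain R (l - 1)))) =
          omap R (insAt (k + i) e) (omap R (joinAt k) (oprod R x (cubeChain R (l - 1)))) :=
        fun e x => by
          have := omap_oprod id (insAt i e) x (cubeChain R (l - 1))
          rw [omap_id] at this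
          rw [← this, omap_omap, omap_omap, key]
      simp only [map_smul, map_sub, LinearMap.smul_apply, key']
      rw [omap_joinAt_cubeChain k (l - 1), show k + (l - 1) = k + l - 1 by omega, pow_add, mul_smul,
        smul_sub]
      simp only [smul_sub, smul_smul, mul_comm]
  · rw [oaug_omap, oaug_oprod, oaug_cubeChain, oaug_cubeChain, oaug_cubeChain]
    split_ifs <;> first | omega | simp
termination_by k + l

end Universal

end Chen

namespace Chen

section Universal

variable (R : Type v) [CommRing R]

/-! #### Families of ordered chains -/

/-- The coface map on vertices that omits the value `i`. -/
def faceAt (i : ℕ) (v : ℕ → ℕ) : ℕ → ℕ := fun j => if v j < i then v j else v j + 1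

/-- The duplication of the member number `p` of a sequence. -/
def dupAt (p : ℕ) (v : ℕ → ℕ) : ℕ → ℕ := fun i => v (if i ≤ p then i else i - 1)

/-- The concatenation of the first `a` members of a sequence with another sequence shifted by `p`. -/
def catAt (a p : ℕ) (s : (ℕ → ℕ) × (ℕ → ℕ)) : ℕ → ℕ :=
  fun i => if i < a then s.1 i else p + s.2 (i - a)

/-- The truncation of the values of a sequence at `m`. -/
def clampAt (m : ℕ) (v : ℕ → ℕ) : ℕ → ℕ := fun i => min (v i) m

/-- The alternating sum of the coface maps. -/
def coface (m : ℕ) : OChains R (ℕ → ℕ) →ₗ[R] OChains R (ℕ → ℕ) :=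
  ∑ i ∈ Finset.range (m + 2), (-1 : R) ^ i • omap R (faceAt i)

theorem coface_apply (m : ℕ) (x : OChains R (ℕ → ℕ)) :
    coface R m x = ∑ i ∈ Finset.range (m + 2), (-1 : R) ^ i • omap R (faceAt i) x := by
  simp [coface, LinearMap.sum_apply]

/-- Families of ordered chains, one for each number of evaluation points. -/
abbrev Fam (R : Type v) [CommRing R] := ℕ → OChains R (ℕ → ℕ)

/-- The boundary of a family. -/
def fdel : Fam R →ₗ[R] Fam R := LinearMap.pi fun m => odel R ∘ₗ LinearMap.proj m

/-- The alternating sum of the coface maps of a family. -/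
def fcoface : Fam R →ₗ[R] Fam R := LinearMap.pi fun m =>
  match m with
  | 0 => 0
  | m + 1 => coface R m ∘ₗ LinearMap.proj m

/-- The duplication of the member number `p`. -/
def fdup (p : ℕ) : Fam R →ₗ[R] Fam R := LinearMap.pi fun m => omap R (dupAt p) ∘ₗ LinearMap.proj m

/-- The product of two chains on sequences, where the first one has `a` members bounded by `p`. -/
def omul (a p : ℕ) : OChains R (ℕ → ℕ) →ₗ[R] OChains R (ℕ → ℕ) →ₗ[R] OChains R (ℕ → ℕ) :=
  (oprod R).compr₂ (omap R (catAt a p))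

/-- The product of families; `s` is the degree of the second factor. -/
def fmul (a s : ℕ) : Fam R →ₗ[R] Fam R →ₗ[R] Fam R :=
  LinearMap.mk₂ R
    (fun e e' m => ∑ x ∈ Finset.HasAntidiagonal.antidiagonal m, (-1 : R) ^ (x.1 * s) • omul R a x.1 (e x.1) (e' x.2))
    (fun e e₁ e' => by
      funext m
      simp [Finset.sum_add_distrib])
    (fun r e e' => by
      funext m
      simp [Finset.smul_sum, smul_comm r])
    (fun e e' e₁ => by
      funext m
      simp [Finset.sum_add_distrib])
    (fun r e e' => by
      funext m
      simp [Finset.smul_sum, smul_comm r])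

variable {R}

theorem fdel_apply (e : Fam R) (m : ℕ) : fdel R e m = odel R (e m) := rfl

theorem fcoface_zero (e : Fam R) : fcoface R e 0 = 0 := rfl

theorem fcoface_succ (e : Fam R) (m : ℕ) : fcoface R e (m + 1) = coface R m (e m) := rfl

theorem fdup_apply (p : ℕ) (e : Fam R) (m : ℕ) : fdup R p e m = omap R (dupAt p) (e m) := rfl

theorem omul_apply (a p : ℕ) (x y : OChains R (ℕ → ℕ)) :
    omul R a p x y = omap R (catAt a p) (oprod R x y) := rfl

theorem fmul_apply (a s : ℕ) (e e' : Fam R) (m : ℕ) : fmul R a s e e' m =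
    ∑ x ∈ Finset.HasAntidiagonal.antidiagonal m, (-1 : R) ^ (x.1 * s) • omul R a x.1 (e x.1) (e' x.2) := rfl

theorem odel_coface (m : ℕ) (x : OChains R (ℕ → ℕ)) :
    odel R (coface R m x) = coface R m (odel R x) := by
  simp only [coface_apply, map_sum, map_smul, odel_omap]

theorem coface_coface (m : ℕ) (x : OChains R (ℕ → ℕ)) :
    coface R (m + 1) (coface R m x) = 0 := by
  have := sum_sum_alternating_eq_zero R (m + 2)
    (fun i j => omap R (faceAt i) (omap R (faceAt j) x)) (by
      intro i j h _
      rw [omap_omap, omap_omap]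
      congr 1
      congr 1
      funext v k
      simp only [faceAt, Function.comp]
      split_ifs <;> first | rfl | omega)
  rw [coface_apply, ← this]
  refine Finset.sum_congr rfl fun i _ => ?_
  rw [coface_apply, map_sum]
  simp only [map_smul]

theorem fdel_fdup (p : ℕ) (e : Fam R) : fdel R (fdup R p e) = fdup R p (fdel R e) :=
  funext fun _ => odel_omap _ _

theorem fcoface_fdup (p : ℕ) (e : Fam R) : fcoface R (fdup R p e) = fdup R p (fcoface R e) := by
  funext m
  cases m with
  | zero => exact (map_zero (omap R (dupAt p))).symm
  | succ m =>
    rw [fcoface_succ, fdup_apply, fdup_apply, fcoface_succ, coface_apply, coface_apply, map_sum]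
    refine Finset.sum_congr rfl fun i _ => ?_
    rw [map_smul, omap_omap, omap_omap]
    rfl

/-- Duplications satisfy dup_i dup_j = dup_{j+1} dup_i for i ≤ j. This is the part of the
self-consistency of the A_∞ equation that reflects associativity of concatenation. -/
theorem sum_fdup_fdup (k : ℕ) (e : Fam R) :
    ∑ p ∈ Finset.range (k + 1), (-1 : R) ^ p • ∑ q ∈ Finset.range k, (-1 : R) ^ q •
      fdup R p (fdup R q e) = 0 := by
  refine sum_sum_alternating_eq_zero R k _ fun i j h _ => ?_
  funext m
  rw [fdup_apply, fdup_apply, fdup_apply, fdup_apply, omap_omap, omap_omap]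
  congr 1
  congr 1
  funext v k
  simp only [dupAt, Function.comp]
  refine congrArg v ?_
  split_ifs <;> omega

/-- The doubled member belongs to the first factor, which becomes one longer; `fdup_fmul_of_le`
treats the members of the second factor. -/
theorem fdup_fmul_of_lt {p a : ℕ} (h : p < a) (s : ℕ) (e e' : Fam R) :
    fdup R p (fmul R a s e e') = fmul R (a + 1) s (fdup R p e) e' := by
  funext m
  rw [fdup_apply, fmul_apply, fmul_apply, map_sum]
  refine Finset.sum_congr rfl fun x _ => ?_
  have := omap_oprod (dupAt p) id (e x.1) (e' x.2)
  rw [omap_id] at this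
  rw [map_smul, omul_apply, omul_apply, fdup_apply, ← this, omap_omap, omap_omap]
  congr 3
  funext v k
  simp only [dupAt, catAt, Function.comp, Prod.map, id]
  split_ifs <;> first | rfl | omega | exact congrArg (fun l => x.1 + v.2 l) (by omega)

theorem fdup_fmul_of_le {p a : ℕ} (s : ℕ) (e e' : Fam R) :
    fdup R (a + p) (fmul R a s e e') = fmul R a s e (fdup R p e') := by
  funext m
  rw [fdup_apply, fmul_apply, fmul_apply, map_sum]
  refine Finset.sum_congr rfl fun x _ => ?_
  have := omap_oprod id (dupAt p) (e x.1) (e' x.2)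
  rw [omap_id] at this
  rw [map_smul, omul_apply, omul_apply, fdup_apply, ← this, omap_omap, omap_omap]
  congr 3
  funext v k
  simp only [dupAt, catAt, Function.comp, Prod.map, id]
  split_ifs <;> first | rfl | omega | exact congrArg (fun l => x.1 + v.2 l) (by omega)

/-- Only the parity of `s` matters, since it occurs in a sign alone. -/
theorem fmul_add_two (a s : ℕ) (e e' : Fam R) : fmul R a (s + 2) e e' = fmul R a s e e' := by
  funext m
  rw [fmul_apply, fmul_apply]
  refine Finset.sum_congr rfl fun x _ => ?_
  rw [mul_add, pow_add, mul_comm x.1 2, pow_mul _ 2, neg_one_sq, one_pow, mul_one]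

/-- In the Leibniz rule ∂ passes a factor of degree k + p. The part (-1)^p of the sign is absorbed
by replacing `s` by `s + 1`, which leaves (-1)^k in front. -/
theorem fdel_fmul {a s k : ℕ} {e : Fam R} (he : ∀ m, e m ∈ ocDeg R _ (k + m)) (e' : Fam R) :
    fdel R (fmul R a s e e') =
      fmul R a s (fdel R e) e' + (-1 : R) ^ k • fmul R a (s + 1) e (fdel R e') := by
  funext m
  rw [Pi.add_apply, Pi.smul_apply, fdel_apply, fmul_apply, fmul_apply, fmul_apply, map_sum,
    Finset.smul_sum, ← Finset.sum_add_distrib]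
  refine Finset.sum_congr rfl fun x _ => ?_
  rw [map_smul, omul_apply, odel_omap, odel_oprod, opar_of_mem (he _), map_add, smul_add, map_smul,
    LinearMap.smul_apply, map_smul, omul_apply, omul_apply, fdel_apply, fdel_apply]
  module

/-- Associativity of the shuffle product is the interchange law with a one-point chain in the second
slot; that chain has degree 0, so the sign is trivial. -/
theorem omul_assoc {a b p q : ℕ} {k l r : ℕ} {x y z : OChains R (ℕ → ℕ)}
    (hx : x ∈ ocDeg R _ k) (hy : y ∈ ocDeg R _ l) (hz : z ∈ ocDeg R _ r) :
    omul R (a + b) (p + q) (omul R a p x y) z = omul R a p x (omul R b q y z) := by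
  have key : oprod R (oprod R x y) z = omap R (fun s : (ℕ → ℕ) × (ℕ → ℕ) × (ℕ → ℕ) =>
      ((s.1, s.2.1), s.2.2)) (oprod R x (oprod R y z)) := by
    have h1 := omap_swapMid_oprod hx (ocls_mem (R := R) (V := Unit) fun _ : Fin 1 => ()) hy hz
    have hl : ∀ {V W : Type} (u : V) (t : OChains R W), oprod R (opt R u) t = omap R (fun w => (u, w)) t := by
      intro V W u t
      induction t using ochains_induction with
      | hz => simp
      | hadd x y hx hy => simp [hx, hy]
      | hsmul r x hx => simp [hx]
      | h0 a => simp
      | h1 a x hx => simp [hx]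
    have hr : ∀ {V W : Type} (u : W) (t : OChains R V), oprod R t (opt R u) = omap R (fun w => (w, u)) t := by
      intro V W u t
      induction t using ochains_induction with
      | hz => simp
      | hadd x y hx hy => simp [hx, hy]
      | hsmul r x hx => simp [hx]
      | h0 a => simp
      | h1 a x hx => simp [hx]
    have h2 := omap_oprod (R := R) (fun w : ℕ → ℕ => (w, ())) id x (oprod R y z)
    have h3 := omap_oprod (R := R) id (fun w : ℕ → ℕ => ((), w)) (oprod R x y) z
    rw [omap_id] at h2 h3
    rw [hl, hr, ← h2, ← h3, zero_mul, pow_zero, one_smul, omap_omap] at h1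
    have h4 := congrArg (omap R (fun s : ((ℕ → ℕ) × (ℕ → ℕ)) × Unit × (ℕ → ℕ) => (s.1, s.2.2))) h1
    rw [omap_omap, omap_omap] at h4
    refine (h4.trans ?_).symm
    exact omap_id _
  have h2 := omap_oprod (R := R) (catAt a p) id (oprod R x y) z
  have h3 := omap_oprod (R := R) id (catAt b q) x (oprod R y z)
  rw [omap_id] at h2 h3
  rw [omul_apply, omul_apply, omul_apply, omul_apply, ← h2, ← h3, key, omap_omap, omap_omap,
    omap_omap]
  congr 2
  funext v k
  simp only [catAt, Function.comp, Prod.map, id]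
  split_ifs <;> first | rfl | omega | skip
  rw [Nat.sub_add_eq, add_assoc]

theorem fmul_assoc {a b s t k l r : ℕ} {e e' e'' : Fam R} (he : ∀ m, e m ∈ ocDeg R _ (k + m))
    (he' : ∀ m, e' m ∈ ocDeg R _ (l + m)) (he'' : ∀ m, e'' m ∈ ocDeg R _ (r + m)) :
    fmul R (a + b) s (fmul R a t e e') e'' = fmul R a (s + t) e (fmul R b s e' e'') := by
  funext m
  simp only [fmul_apply, map_sum, LinearMap.sum_apply, Finset.smul_sum]
  rw [Finset.sum_sigma', Finset.sum_sigma']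
  refine Finset.sum_nbij' (fun x => ⟨(x.2.1, x.2.2 + x.1.2), (x.2.2, x.1.2)⟩)
    (fun x => ⟨(x.1.1 + x.2.1, x.2.2), (x.1.1, x.2.1)⟩) ?_ ?_ ?_ ?_ ?_
  · rintro ⟨⟨i, j⟩, ⟨p, q⟩⟩ h
    simp only [Finset.mem_sigma, Finset.HasAntidiagonal.mem_antidiagonal] at h ⊢
    exact ⟨by omega, trivial⟩
  · rintro ⟨⟨i, j⟩, ⟨p, q⟩⟩ h
    simp only [Finset.mem_sigma, Finset.HasAntidiagonal.mem_antidiagonal] at h ⊢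
    exact ⟨by omega, trivial⟩
  · rintro ⟨⟨_, _⟩, ⟨_, _⟩⟩ h
    simp only [Finset.mem_sigma, Finset.HasAntidiagonal.mem_antidiagonal] at h
    obtain ⟨rfl, rfl⟩ := h
    rfl
  · rintro ⟨⟨_, _⟩, ⟨_, _⟩⟩ h
    simp only [Finset.mem_sigma, Finset.HasAntidiagonal.mem_antidiagonal] at h
    obtain ⟨rfl, rfl⟩ := h
    rfl
  · rintro ⟨⟨_, _⟩, ⟨p, q⟩⟩ h
    simp only [Finset.mem_sigma, Finset.HasAntidiagonal.mem_antidiagonal] at h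
    obtain ⟨rfl, rfl⟩ := h
    simp only [map_smul, LinearMap.smul_apply, smul_smul, ← pow_add]
    rw [omul_assoc (he _) (he' _) (he'' _)]
    congr 2
    ring

theorem omap_faceAt_of_clamp {p : ℕ} {x : OChains R (ℕ → ℕ)} (hx : omap R (clampAt p) x = x) :
    omap R (faceAt (p + 1)) x = x := by
  conv_lhs => rw [← hx]
  rw [omap_omap]
  conv_rhs => rw [← hx]
  congr 2
  funext v k
  simp only [faceAt, clampAt, Function.comp]
  exact if_pos (by omega)

/-- The cofaces 0, …, p act on the first factor and the remaining ones on the second. The right side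
has two further terms, the last coface of `x` (which fixes the clamped chain `x`) and the zeroth
coface of `y`; they give the same chain with opposite signs. -/
theorem coface_omul {a p q : ℕ} {x : OChains R (ℕ → ℕ)} (hx : omap R (clampAt p) x = x)
    (y : OChains R (ℕ → ℕ)) : coface R (p + q) (omul R a p x y) =
      omul R a (p + 1) (coface R p x) y + (-1 : R) ^ p • omul R a p x (coface R q y) := by
  have h1 : ∀ i ≤ p, omap R (faceAt i) (omul R a p x y) =
      omul R a (p + 1) (omap R (faceAt i) x) y := by
    intro i hi
    have := omap_oprod (R := R) (faceAt i) id x y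
    rw [omap_id] at this
    rw [omul_apply, omul_apply, ← this, omap_omap, omap_omap]
    congr 2
    funext v k
    simp only [faceAt, catAt, Function.comp, Prod.map, id]
    split_ifs <;> first | rfl | omega
  have h2 : ∀ i, omap R (faceAt (p + 1 + i)) (omul R a p x y) =
      omul R a p x (omap R (faceAt (i + 1)) y) := by
    intro i
    have := omap_oprod (R := R) id (faceAt (i + 1)) x y
    rw [omap_id] at this
    have h' := omap_oprod (R := R) (clampAt p) id x y
    rw [omap_id, hx] at h'
    rw [omul_apply, omul_apply, ← this, omap_omap, omap_omap, ← h', omap_omap, omap_omap]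
    congr 2
    funext v k
    simp only [faceAt, catAt, clampAt, Function.comp, Prod.map, id]
    split_ifs <;> first | rfl | omega
  have h3 : omul R a (p + 1) x y = omul R a p x (omap R (faceAt 0) y) := by
    have := omap_oprod (R := R) id (faceAt 0) x y
    rw [omap_id] at this
    rw [omul_apply, omul_apply, ← this, omap_omap]
    congr 2
    funext v k
    simp only [faceAt, catAt, Function.comp, Prod.map, id]
    split_ifs <;> first | rfl | omega
  rw [coface_apply, coface_apply, coface_apply, show p + q + 2 = p + 1 + (q + 1) by omega,
    Finset.sum_range_add, Finset.sum_range_succ (n := p + 1), Finset.sum_range_succ' (n := q + 1),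
    map_add, map_add, map_smul, map_smul, omap_faceAt_of_clamp hx, LinearMap.add_apply,
    LinearMap.smul_apply, h3, map_sum, map_sum, LinearMap.sum_apply]
  have e1 : ∑ i ∈ Finset.range (p + 1), (-1 : R) ^ i • omap R (faceAt i) (omul R a p x y) =
      ∑ i ∈ Finset.range (p + 1), omul R a (p + 1) ((-1 : R) ^ i • omap R (faceAt i) x) y := by
    refine Finset.sum_congr rfl fun i hi => ?_
    rw [h1 i (by simpa [Nat.lt_succ_iff] using hi), map_smul, LinearMap.smul_apply]
  have e2 : ∑ i ∈ Finset.range (q + 1), (-1 : R) ^ (p + 1 + i) •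
        omap R (faceAt (p + 1 + i)) (omul R a p x y) = (-1 : R) ^ p •
      ∑ i ∈ Finset.range (q + 1), omul R a p x ((-1 : R) ^ (i + 1) • omap R (faceAt (i + 1)) y) := by
    rw [Finset.smul_sum]
    refine Finset.sum_congr rfl fun i hi => ?_
    rw [h2, map_smul, smul_smul, ← pow_add, show p + 1 + i = p + (i + 1) by omega]
  rw [e1, e2, pow_zero, one_smul, smul_add, pow_succ, mul_neg_one, neg_smul]
  abel

theorem fcoface_fmul {a s : ℕ} {e : Fam R} (he : ∀ m, omap R (clampAt m) (e m) = e m)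
    (e' : Fam R) : fcoface R (fmul R a s e e') =
      (-1 : R) ^ s • fmul R a s (fcoface R e) e' + fmul R a (s + 1) e (fcoface R e') := by
  funext m
  rw [Pi.add_apply, Pi.smul_apply]
  cases m with
  | zero => simp [fcoface_zero, fmul_apply]
  | succ m =>
    rw [fcoface_succ, fmul_apply, fmul_apply, fmul_apply, Finset.Nat.sum_antidiagonal_succ,
      Finset.Nat.sum_antidiagonal_succ', map_sum]
    simp only [fcoface_zero, fcoface_succ, map_zero, LinearMap.zero_apply, smul_zero, zero_add]
    rw [Finset.smul_sum, ← Finset.sum_add_distrib]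
    refine Finset.sum_congr rfl fun x hx => ?_
    rw [Finset.HasAntidiagonal.mem_antidiagonal] at hx
    rw [map_smul, ← hx, coface_omul (he _), smul_add, smul_smul, smul_smul, ← pow_add, ← pow_add]
    congr 2
    rw [add_mul, one_mul, add_comm s, add_assoc, ← two_mul, pow_add, pow_mul _ 2, neg_one_sq,
      one_pow, mul_one]

end Universal

end Chen

namespace Chen

/-! ### The universal chains and their defining equation -/

section Universal

variable (R : Type v) [CommRing R]

/-- The solution of `∂ e = b - s δ e` by means of the cone operator. -/
def solve (s : R) (b : Fam R) : Fam R
  | 0 => ocons R 0 (b 0)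
  | m + 1 => ocons R 0 (b (m + 1) - s • coface R m (solve s b m))

/-- The universal chains that define the components of the `A_∞`-functor. The member number `m` of
`universalChain R n` is a chain of degree `n + m` on sequences of which the first `n + 1` members
matter, with values at most `m`. -/
def universalChain : ℕ → Fam R
  -- The fundamental simplex of Δ^m, its vertex `l` written as a constant sequence; the sign is the
  -- one in It_X.
  | 0 => fun m => (-1 : R) ^ m • ocls R fun (l : Fin (m + 1)) _ => (l : ℕ)
  -- The equation to be solved measures how far the preceding components fail to respect
  -- composition.
  | n + 1 => solve R ((-1) ^ (n + 1))
      (∑ p ∈ Finset.range (n + 1), (-1 : R) ^ p • fdup R p (universalChain n)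
        - ∑ i : Fin (n + 1), (-1 : R) ^ (i : ℕ) •
            fmul R (i + 1) (n - i) (universalChain i) (universalChain (n - i)))
termination_by n => n
decreasing_by all_goals omega

/-- The part of the boundary of the universal chains that comes from the composition. -/
def universalRhs : ℕ → Fam R
  | 0 => 0
  | n + 1 => ∑ p ∈ Finset.range (n + 1), (-1 : R) ^ p • fdup R p (universalChain R n)
      - ∑ x ∈ Finset.HasAntidiagonal.antidiagonal n, (-1 : R) ^ x.1 •
          fmul R (x.1 + 1) x.2 (universalChain R x.1) (universalChain R x.2)

theorem universalChain_succ (n : ℕ) : universalChain R (n + 1) =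
    solve R ((-1) ^ (n + 1)) (universalRhs R (n + 1)) := by
  rw [universalChain, universalRhs, Finset.Nat.sum_antidiagonal_eq_sum_range_succ_mk,
    Finset.sum_range, Finset.sum_range]

variable {R}

theorem solve_mem {s : R} {b : Fam R} {k : ℕ} (hb : ∀ m, b m ∈ ocDeg R (ℕ → ℕ) (k + m)) :
    ∀ m, solve R s b m ∈ ocDeg R (ℕ → ℕ) (k + 1 + m)
  | 0 => ocons_mem _ (hb 0)
  | m + 1 => by
    refine ocons_mem (d := k + 1 + m) _ (sub_mem ?_ (Submodule.smul_mem _ _ ?_))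
    · have := hb (m + 1)
      rwa [← add_assoc, add_right_comm] at this
    · rw [coface_apply]
      exact Submodule.sum_mem _ fun i _ => Submodule.smul_mem _ _ (omap_mem _ (solve_mem hb m))

theorem omul_mem {a p k l : ℕ} {x y : OChains R (ℕ → ℕ)} (hx : x ∈ ocDeg R (ℕ → ℕ) k)
    (hy : y ∈ ocDeg R (ℕ → ℕ) l) : omul R a p x y ∈ ocDeg R (ℕ → ℕ) (k + l) :=
  omap_mem _ (oprod_mem hx hy)

theorem universalChain_mem (n : ℕ) : ∀ m, universalChain R n m ∈ ocDeg R (ℕ → ℕ) (n + m) := by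
  induction n using Nat.strong_induction_on with
  | _ n ih =>
  cases n with
  | zero =>
    intro m
    rw [universalChain, zero_add]
    exact Submodule.smul_mem _ _ (ocls_mem _)
  | succ n =>
    rw [universalChain_succ]
    refine solve_mem fun m => ?_
    rw [universalRhs, Pi.sub_apply, Finset.sum_apply, Finset.sum_apply]
    refine sub_mem (Submodule.sum_mem _ fun p _ => ?_) (Submodule.sum_mem _ fun x hx => ?_)
    · rw [Pi.smul_apply]
      exact Submodule.smul_mem _ _ (omap_mem _ (ih n (by omega) m))
    · rw [Pi.smul_apply, fmul_apply]
      refine Submodule.smul_mem _ _ (Submodule.sum_mem _ fun y hy => Submodule.smul_mem _ _ ?_)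
      rw [Finset.HasAntidiagonal.mem_antidiagonal] at hx hy
      have := omul_mem (a := x.1 + 1) (p := y.1) (ih x.1 (by omega) y.1) (ih x.2 (by omega) y.2)
      rwa [show x.1 + y.1 + (x.2 + y.2) = n + m by omega] at this

/-- The elements of a family involve only sequences of numbers that are at most `m`. -/
def IsClamped (e : Fam R) : Prop := ∀ m, omap R (clampAt m) (e m) = e m

theorem clampAt_zero (m : ℕ) : clampAt m 0 = 0 := funext fun _ => Nat.zero_min m

theorem omap_clampAt_coface {m : ℕ} {x : OChains R (ℕ → ℕ)} (hx : omap R (clampAt m) x = x) :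
    omap R (clampAt (m + 1)) (coface R m x) = coface R m x := by
  rw [coface_apply, map_sum]
  refine Finset.sum_congr rfl fun i hi => ?_
  rw [map_smul, ← hx]
  simp only [omap_omap]
  congr 3
  funext v k
  rw [Finset.mem_range] at hi
  have hv : clampAt m v k ≤ m := min_le_right _ _
  change min (faceAt i (clampAt m v) k) (m + 1) = faceAt i (clampAt m v) k
  simp only [faceAt]
  split_ifs <;> omega

theorem isClamped_solve {s : R} {b : Fam R} (hb : IsClamped b) : IsClamped (solve R s b)
  | 0 => by rw [solve, omap_ocons, clampAt_zero, hb]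
  | m + 1 => by
    rw [solve, omap_ocons, clampAt_zero, map_sub, map_smul, hb,
      omap_clampAt_coface (isClamped_solve hb m)]

theorem isClamped_fmul {a s : ℕ} {e e' : Fam R} (he : IsClamped e) (he' : IsClamped e') :
    IsClamped (fmul R a s e e') := by
  intro m
  rw [fmul_apply, map_sum]
  refine Finset.sum_congr rfl fun x hx => ?_
  rw [Finset.HasAntidiagonal.mem_antidiagonal] at hx
  have := omap_oprod (clampAt x.1) (clampAt x.2) (e x.1) (e' x.2)
  rw [he, he'] at this
  rw [map_smul, omul_apply, ← this]
  simp only [omap_omap]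
  congr 3
  funext v k
  simp only [clampAt, catAt, Function.comp, Prod.map]
  split_ifs <;> omega

/-- The bound on the values is what lets `coface_omul` separate the cofaces of the two factors, and
what makes the outer cofaces evaluate paths at their ends. -/
theorem isClamped_universalChain (n : ℕ) : IsClamped (universalChain R n) := by
  induction n using Nat.strong_induction_on with
  | _ n ih =>
  cases n with
  | zero =>
    intro m
    rw [universalChain, map_smul, omap_ocls]
    congr 3
    funext l k
    exact min_eq_left (Nat.lt_succ_iff.1 l.2)
  | succ n =>
    rw [universalChain_succ]
    refine isClamped_solve fun m => ?_
    rw [universalRhs, Pi.sub_apply, Finset.sum_apply, Finset.sum_apply, map_sub, map_sum, map_sum]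
    congr 1
    · refine Finset.sum_congr rfl fun p _ => ?_
      rw [Pi.smul_apply, map_smul, fdup_apply, omap_omap]
      conv_rhs => rw [← ih n (by omega) m, omap_omap]
      rfl
    · refine Finset.sum_congr rfl fun x hx => ?_
      rw [Finset.HasAntidiagonal.mem_antidiagonal] at hx
      rw [Pi.smul_apply, map_smul,
        isClamped_fmul (ih x.1 (by omega)) (ih x.2 (by omega)) m]

theorem oaug_solve (s : R) (b : Fam R) (m : ℕ) : oaug R (solve R s b m) = 0 := by
  cases m <;> exact oaug_ocons _ _

theorem oaug_universalChain (n m : ℕ) :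
    oaug R (universalChain R n m) = if n = 0 ∧ m = 0 then 1 else 0 := by
  cases n with
  | zero =>
    rw [universalChain, map_smul, oaug_ocls]
    by_cases hm : m = 0 <;> simp [hm]
  | succ n => rw [universalChain_succ, oaug_solve, if_neg (by omega)]

/-- The chain under the cone at level m + 1 is a cycle: by `hb` and the equation at level m its
boundary reduces to a multiple of δδ, which vanishes. -/
theorem fdel_solve {s : R} {b : Fam R} (hb : fdel R b = s • fcoface R b) (ha : ∀ m, oaug R (b m) = 0) :
    fdel R (solve R s b) = b - s • fcoface R (solve R s b) := by
  funext m
  rw [Pi.sub_apply, Pi.smul_apply, fdel_apply]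
  induction m with
  | zero =>
    have h0 : odel R (b 0) = 0 := by
      have := congrFun hb 0
      rwa [Pi.smul_apply, fcoface_zero, smul_zero] at this
    rw [solve, odel_ocons_of_cycle _ h0 (ha 0), fcoface_zero, smul_zero, sub_zero]
  | succ m ih =>
    rw [solve, fcoface_succ]
    refine odel_ocons_of_cycle _ ?_ ?_
    · have h1 : odel R (b (m + 1)) = s • coface R m (b m) := congrFun hb (m + 1)
      have h2 : coface R m (fcoface R (solve R s b) m) = 0 := by
        cases m with
        | zero => rw [fcoface_zero, map_zero]
        | succ m => rw [fcoface_succ, coface_coface]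
      rw [map_sub, h1, map_smul, odel_coface, ih, map_sub, map_smul, h2, smul_zero, sub_zero, sub_self]
    · rw [map_sub, ha, map_smul, coface_apply, map_sum]
      simp [oaug_solve]

/-- All terms have positive degree except in one case, where the duplicated vertex and the product
of vertices both have augmentation 1 and cancel. -/
theorem oaug_universalRhs (n m : ℕ) : oaug R (universalRhs R n m) = 0 := by
  cases n with
  | zero => exact map_zero _
  | succ n =>
    rw [universalRhs, Pi.sub_apply, Finset.sum_apply, Finset.sum_apply, map_sub, map_sum, map_sum]
    simp only [Pi.smul_apply, map_smul, fdup_apply, fmul_apply, map_sum, omul_apply, oaug_omap,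
      oaug_oprod, oaug_universalChain]
    by_cases h : n = 0 ∧ m = 0
    · obtain ⟨rfl, rfl⟩ := h
      simp
    · rw [Finset.sum_eq_zero, Finset.sum_eq_zero, sub_zero]
      · intro x hx
        refine smul_eq_zero_of_right _ (Finset.sum_eq_zero fun y hy => ?_)
        rw [Finset.HasAntidiagonal.mem_antidiagonal] at hx hy
        split_ifs <;> first | omega | simp
      · intro p _
        rw [if_neg h, smul_zero]

/-- The right hand side of the equation for the universal chains is compatible with itself. -/
theorem universalRhs_cycle (n : ℕ) :
    ∑ p ∈ Finset.range (n + 1), (-1 : R) ^ p • fdup R p (universalRhs R n)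
        - ∑ x ∈ Finset.HasAntidiagonal.antidiagonal n, (-1 : R) ^ x.1 •
          (fmul R (x.1 + 1) x.2 (universalRhs R x.1) (universalChain R x.2)
        + (-1 : R) ^ x.1 • fmul R (x.1 + 1) (x.2 + 1) (universalChain R x.1) (universalRhs R x.2))
        = 0 := by
  cases n with
  | zero => simp [universalRhs]
  | succ k =>
    simp only [smul_add, Finset.sum_add_distrib]
    rw [Finset.Nat.sum_antidiagonal_succ, Finset.Nat.sum_antidiagonal_succ']
    -- The outermost terms of the antidiagonal sums drop out because `universalRhs R 0` is zero.
    simp only [universalRhs, map_zero, LinearMap.zero_apply, smul_zero, zero_add, fmul_add_two]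
    set c := universalChain R
    have hd : ∀ p, fdup R p (∑ q ∈ Finset.range (k + 1), (-1 : R) ^ q • fdup R q (c k)
        - ∑ x ∈ Finset.HasAntidiagonal.antidiagonal k, (-1 : R) ^ x.1 •
          fmul R (x.1 + 1) x.2 (c x.1) (c x.2)) =
        ∑ q ∈ Finset.range (k + 1), (-1 : R) ^ q • fdup R p (fdup R q (c k))
        - ∑ x ∈ Finset.HasAntidiagonal.antidiagonal k, (-1 : R) ^ x.1 •
          fdup R p (fmul R (x.1 + 1) x.2 (c x.1) (c x.2)) := fun p => by
      simp only [map_sub, map_sum, map_smul]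
    simp only [hd, smul_sub, Finset.sum_sub_distrib]
    rw [sum_fdup_fdup]
    simp only [map_sub, LinearMap.sub_apply, smul_sub, Finset.sum_sub_distrib]
    -- Duplication in a product happens in one of the factors: the k + 2 positions split into x.1 +
    -- 1 and x.2 + 1. These terms cancel against the duplications inside the factors.
    have h1 : ∑ p ∈ Finset.range (k + 1 + 1), (-1 : R) ^ p •
          ∑ x ∈ Finset.HasAntidiagonal.antidiagonal k, (-1 : R) ^ x.1 •
            fdup R p (fmul R (x.1 + 1) x.2 (c x.1) (c x.2)) =
        -∑ x ∈ Finset.HasAntidiagonal.antidiagonal k, (-1 : R) ^ (x.1 + 1) •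
          fmul R (x.1 + 1 + 1) x.2 (∑ p ∈ Finset.range (x.1 + 1), (-1 : R) ^ p • fdup R p (c x.1))
            (c x.2)
        - ∑ x ∈ Finset.HasAntidiagonal.antidiagonal k, (-1 : R) ^ x.1 • (-1 : R) ^ x.1 •
          fmul R (x.1 + 1) x.2 (c x.1)
            (∑ p ∈ Finset.range (x.2 + 1), (-1 : R) ^ p • fdup R p (c x.2)) := by
      simp only [Finset.smul_sum (r := (-1 : R) ^ _)]
      rw [Finset.sum_comm, ← Finset.sum_neg_distrib, ← Finset.sum_sub_distrib]
      refine Finset.sum_congr rfl fun x hx => ?_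
      rw [Finset.HasAntidiagonal.mem_antidiagonal] at hx
      rw [show k + 1 + 1 = x.1 + 1 + (x.2 + 1) by omega, Finset.sum_range_add, map_sum, map_sum,
        LinearMap.sum_apply, Finset.smul_sum, Finset.smul_sum, Finset.smul_sum,
        ← Finset.sum_neg_distrib, sub_eq_add_neg, ← Finset.sum_neg_distrib]
      congr 1
      · refine Finset.sum_congr rfl fun p hp => ?_
        rw [fdup_fmul_of_lt (Finset.mem_range.1 hp), map_smul, LinearMap.smul_apply]
        module
      · refine Finset.sum_congr rfl fun p hp => ?_
        rw [fdup_fmul_of_le, map_smul]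
        module
    -- The two ways of bracketing a triple product agree by `fmul_assoc` and enter with opposite
    -- signs.
    have h2 : ∑ x ∈ Finset.HasAntidiagonal.antidiagonal k, (-1 : R) ^ (x.1 + 1) •
          fmul R (x.1 + 1 + 1) x.2 (∑ y ∈ Finset.HasAntidiagonal.antidiagonal x.1, (-1 : R) ^ y.1 •
            fmul R (y.1 + 1) y.2 (c y.1) (c y.2)) (c x.2) =
        -∑ x ∈ Finset.HasAntidiagonal.antidiagonal k, (-1 : R) ^ x.1 • (-1 : R) ^ x.1 •
          fmul R (x.1 + 1) x.2 (c x.1) (∑ y ∈ Finset.HasAntidiagonal.antidiagonal x.2,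
            (-1 : R) ^ y.1 • fmul R (y.1 + 1) y.2 (c y.1) (c y.2)) := by
      simp only [map_sum, LinearMap.sum_apply, Finset.smul_sum, ← Finset.sum_neg_distrib]
      rw [Finset.sum_sigma', Finset.sum_sigma']
      refine Finset.sum_nbij' (fun x => ⟨(x.2.1, x.2.2 + x.1.2), (x.2.2, x.1.2)⟩)
        (fun x => ⟨(x.1.1 + x.2.1, x.2.2), (x.1.1, x.2.1)⟩) ?_ ?_ ?_ ?_ ?_
      · rintro ⟨⟨i, j⟩, ⟨p, q⟩⟩ h
        simp only [Finset.mem_sigma, Finset.HasAntidiagonal.mem_antidiagonal] at h ⊢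
        exact ⟨by omega, trivial⟩
      · rintro ⟨⟨i, j⟩, ⟨p, q⟩⟩ h
        simp only [Finset.mem_sigma, Finset.HasAntidiagonal.mem_antidiagonal] at h ⊢
        exact ⟨by omega, trivial⟩
      · rintro ⟨⟨_, _⟩, ⟨_, _⟩⟩ h
        simp only [Finset.mem_sigma, Finset.HasAntidiagonal.mem_antidiagonal] at h
        obtain ⟨rfl, rfl⟩ := h
        rfl
      · rintro ⟨⟨_, _⟩, ⟨_, _⟩⟩ h
        simp only [Finset.mem_sigma, Finset.HasAntidiagonal.mem_antidiagonal] at h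
        obtain ⟨rfl, rfl⟩ := h
        rfl
      · rintro ⟨⟨_, z⟩, ⟨x, y⟩⟩ h
        simp only [Finset.mem_sigma, Finset.HasAntidiagonal.mem_antidiagonal] at h
        obtain ⟨rfl, rfl⟩ := h
        simp only [map_smul, LinearMap.smul_apply]
        rw [show x + y + 1 + 1 = (x + 1) + (y + 1) by omega,
          fmul_assoc (universalChain_mem x) (universalChain_mem y) (universalChain_mem z), add_comm z]
        module
    rw [h1, h2]
    abel

/-- The boundary of the universal chains. -/
theorem fdel_universalChain (n : ℕ) : fdel R (universalChain R n) =
    universalRhs R n - (-1 : R) ^ n • fcoface R (universalChain R n) := by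
  induction n using Nat.strong_induction_on with
  | _ n ih =>
  match n, ih with
  | 0, _ =>
    -- For the fundamental simplices this is the simplicial boundary formula; the minus is the ratio
    -- of the signs (-1)^{m+1} and (-1)^m.
    funext m
    rw [universalRhs, pow_zero, one_smul, Pi.sub_apply, Pi.zero_apply, zero_sub, fdel_apply]
    cases m with
    | zero => rw [fcoface_zero, odel_eq_zero (universalChain_mem 0 0), neg_zero]
    | succ m =>
      rw [fcoface_succ, universalChain, map_smul, odel_ocls, map_smul, coface_apply, pow_succ,
        mul_neg_one, neg_smul, Finset.sum_range]
      simp only [omap_ocls]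
      congr 3
      funext i
      refine congrArg (fun g : Fin (m + 1) → ℕ → ℕ => (-1 : R) ^ (i : ℕ) • ocls R g) ?_
      funext l k
      rw [Function.comp, val_succAbove]
      rfl
  | n + 1, ih =>
    rw [universalChain_succ]
    refine fdel_solve ?_ (oaug_universalRhs _)
    -- The Leibniz rules for ∂ and for δ have matching signs, so the induction hypotheses for the
    -- factors combine to the same kind of equation for the product.
    have hR : ∀ x : ℕ × ℕ, x ∈ Finset.HasAntidiagonal.antidiagonal n →
        fdel R (fmul R (x.1 + 1) x.2 (universalChain R x.1) (universalChain R x.2)) =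
        fmul R (x.1 + 1) x.2 (universalRhs R x.1) (universalChain R x.2)
        + (-1 : R) ^ x.1 • fmul R (x.1 + 1) (x.2 + 1) (universalChain R x.1) (universalRhs R x.2)
        - (-1 : R) ^ n • fcoface R
          (fmul R (x.1 + 1) x.2 (universalChain R x.1) (universalChain R x.2)) := by
      intro x hx
      rw [Finset.HasAntidiagonal.mem_antidiagonal] at hx
      rw [fdel_fmul (universalChain_mem x.1), fcoface_fmul (isClamped_universalChain x.1),
        ih x.1 (by omega), ih x.2 (by omega), ← hx]
      simp only [map_sub, map_smul, LinearMap.sub_apply, LinearMap.smul_apply, smul_sub, smul_add,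
        smul_smul, pow_add]
      have : (-1 : R) ^ x.2 * (-1) ^ x.2 = 1 := by rw [← mul_pow]; simp
      rw [mul_assoc, this, mul_one]
      abel
    have hD : ∀ p, fdel R (fdup R p (universalChain R n)) = fdup R p (universalRhs R n)
        - (-1 : R) ^ n • fcoface R (fdup R p (universalChain R n)) := by
      intro p
      rw [fdel_fdup, ih n (by omega), map_sub, map_smul, fcoface_fdup]
    have hZ : ∑ p ∈ Finset.range (n + 1), (-1 : R) ^ p • fdup R p (universalRhs R n)
        - ∑ x ∈ Finset.HasAntidiagonal.antidiagonal n, (-1 : R) ^ x.1 •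
          (fmul R (x.1 + 1) x.2 (universalRhs R x.1) (universalChain R x.2)
        + (-1 : R) ^ x.1 • fmul R (x.1 + 1) (x.2 + 1) (universalChain R x.1) (universalRhs R x.2))
        = 0 := universalRhs_cycle n
    have e1 : fdel R (∑ p ∈ Finset.range (n + 1), (-1 : R) ^ p • fdup R p (universalChain R n)) =
        ∑ p ∈ Finset.range (n + 1), (-1 : R) ^ p • fdup R p (universalRhs R n) - (-1 : R) ^ n •
        fcoface R (∑ p ∈ Finset.range (n + 1), (-1 : R) ^ p • fdup R p (universalChain R n)) := by
      rw [map_sum, map_sum, Finset.smul_sum, ← Finset.sum_sub_distrib]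
      refine Finset.sum_congr rfl fun p _ => ?_
      rw [map_smul, map_smul, hD, smul_sub, smul_comm]
    have e2 : fdel R (∑ x ∈ Finset.HasAntidiagonal.antidiagonal n, (-1 : R) ^ x.1 •
          fmul R (x.1 + 1) x.2 (universalChain R x.1) (universalChain R x.2)) =
        ∑ x ∈ Finset.HasAntidiagonal.antidiagonal n, (-1 : R) ^ x.1 •
          (fmul R (x.1 + 1) x.2 (universalRhs R x.1) (universalChain R x.2)
        + (-1 : R) ^ x.1 • fmul R (x.1 + 1) (x.2 + 1) (universalChain R x.1) (universalRhs R x.2))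
        - (-1 : R) ^ n • fcoface R (∑ x ∈ Finset.HasAntidiagonal.antidiagonal n, (-1 : R) ^ x.1 •
          fmul R (x.1 + 1) x.2 (universalChain R x.1) (universalChain R x.2)) := by
      rw [map_sum, map_sum, Finset.smul_sum, ← Finset.sum_sub_distrib]
      refine Finset.sum_congr rfl fun x hx => ?_
      rw [map_smul, map_smul, hR x hx, smul_sub, smul_comm ((-1 : R) ^ n)]
    -- What remains is ∂b = -(-1)^n δb, the hypothesis of `fdel_solve` with s = (-1)^{n+1}.
    rw [universalRhs, map_sub, e1, e2, sub_sub_sub_comm, hZ, zero_sub, ← smul_sub, ← map_sub,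
      pow_succ, mul_neg_one, neg_smul]

end Universal

end Chen

namespace Chen

/-! ### Cup products -/

section Cup

variable {R : Type v} [CommRing R] {V W : Type*} {A : Type*} [Ring A] [Algebra R A]

/-- The cup product on sequences, by recursion on the dimension. -/
def cupGen (h : OChains R V →ₗ[R] A) : ∀ n : ℕ, (Fin (n + 1) → V) → (OChains R V →ₗ[R] A) → A
  | 0, g, f => f (opt R (g 0)) * h (opt R (g 0))
  -- The first summand cuts at the first vertex; for the later cuts this vertex is moved into the
  -- argument of `f`.
  | n + 1, g, f => f (opt R (g 0)) * h (ocls R g) + cupGen h n (Fin.tail g) (f ∘ₗ ocons R (g 0))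

theorem cupGen_zero (h : OChains R V →ₗ[R] A) : ∀ (n : ℕ) (g : Fin (n + 1) → V), cupGen h n g 0 = 0
  | 0, g => by simp [cupGen]
  | n + 1, g => by rw [cupGen, LinearMap.zero_comp, cupGen_zero]; simp

theorem cupGen_degen (h : OChains R V →ₗ[R] A) : ∀ (n : ℕ) (g : Fin (n + 1) → V)
    (f : OChains R V →ₗ[R] A) (i : Fin n), g i.castSucc = g i.succ → cupGen h n g f = 0
  | n + 1, g, f, i, hi => by
    have h0 : ocls R g = 0 := cls_eq_zero ⟨i, hi⟩
    rw [cupGen, h0, map_zero, mul_zero, zero_add]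
    induction i using Fin.cases with
    | zero =>
      have e : Fin.tail g 0 = g 0 := hi.symm
      cases n with
      | zero =>
        rw [cupGen, e, LinearMap.comp_apply, ocons_opt_self, map_zero, zero_mul]
      | succ n =>
        have : (f ∘ₗ ocons R (g 0)) ∘ₗ ocons R (g 0) = 0 := by
          ext x : 1
          simp
        rw [cupGen, e, LinearMap.comp_apply, ocons_opt_self, map_zero, zero_mul, zero_add, this,
          cupGen_zero]
    | succ i => exact cupGen_degen h n (Fin.tail g) _ i hi

/-- The cup product of two cochains. -/
def cup (f h : OChains R V →ₗ[R] A) : OChains R V →ₗ[R] A :=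
  liftChains (fun s => cupGen h s.1 s.2 f) fun s ⟨i, hi⟩ => cupGen_degen h s.1 s.2 f i hi

@[simp] theorem cup_opt (f h : OChains R V →ₗ[R] A) (a : V) :
    cup f h (opt R a) = f (opt R a) * h (opt R a) := liftChains_cls _ _ _

@[simp] theorem cup_ocons (f h : OChains R V →ₗ[R] A) (a : V) (x : OChains R V) :
    cup f h (ocons R a x) = f (opt R a) * h (ocons R a x) + cup (f ∘ₗ ocons R a) h x := by
  suffices H : cup f h ∘ₗ ocons R a = LinearMap.mulLeft R (f (opt R a)) ∘ₗ h ∘ₗ ocons R a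
      + cup (f ∘ₗ ocons R a) h from LinearMap.congr_fun H x
  refine chains_ext fun s => ?_
  change cup f h (ocons R a (ocls R s.2)) = f (opt R a) * h (ocons R a (ocls R s.2))
    + cup (f ∘ₗ ocons R a) h (ocls R s.2)
  rw [ocons_ocls]
  refine (liftChains_cls _ _ _).trans ?_
  rw [cupGen, Fin.tail_cons]
  rw [cup, liftChains_cls]
  rfl

/-- Two cochains given by the values on vertices and on cones are compared by induction, where the
identity is proved for a whole family. -/
theorem cochain_ext_family {ι M : Type*} [AddCommGroup M] [Module R M] {F F' : ι → OChains R V →ₗ[R] M}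
    (h0 : ∀ i a, F i (opt R a) = F' i (opt R a))
    (h1 : ∀ i a x, (∀ i, F i x = F' i x) → F i (ocons R a x) = F' i (ocons R a x)) (i : ι) :
    F i = F' i := by
  refine LinearMap.ext fun x => ?_
  induction x using ochains_induction generalizing i with
  | hz => simp
  | hadd x y hx hy => rw [map_add, map_add, hx, hy]
  | hsmul r x hx => rw [map_smul, map_smul, hx]
  | h0 a => exact h0 i a
  | h1 a x hx => exact h1 i a x fun i => hx i

theorem cup_sub_left (f f' h : OChains R V →ₗ[R] A) : cup (f - f') h = cup f h - cup f' h := by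
  refine cochain_ext_family (F := fun p : (OChains R V →ₗ[R] A) × (OChains R V →ₗ[R] A) =>
    cup (p.1 - p.2) h) (F' := fun p => cup p.1 h - cup p.2 h) ?_ ?_ (f, f')
  · intro p a
    simp [sub_mul]
  · intro p a x ih
    have := ih (p.1 ∘ₗ ocons R a, p.2 ∘ₗ ocons R a)
    simp only [LinearMap.sub_apply] at this
    simp only [cup_ocons, LinearMap.sub_apply, LinearMap.sub_comp, this, sub_mul]
    abel

theorem cup_zero_left (h : OChains R V →ₗ[R] A) : cup 0 h = 0 := by
  have := cup_sub_left 0 0 h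
  simpa using this

theorem cup_neg_left (f h : OChains R V →ₗ[R] A) : cup (-f) h = -cup f h := by
  rw [← zero_sub, cup_sub_left, cup_zero_left, zero_sub]

theorem cup_add_left (f f' h : OChains R V →ₗ[R] A) : cup (f + f') h = cup f h + cup f' h := by
  rw [← sub_neg_eq_add, cup_sub_left, cup_neg_left, sub_neg_eq_add]

theorem cup_mulLeft (α : A) (f h : OChains R V →ₗ[R] A) :
    cup (LinearMap.mulLeft R α ∘ₗ f) h = LinearMap.mulLeft R α ∘ₗ cup f h := by
  refine cochain_ext_family (F := fun f => cup (LinearMap.mulLeft R α ∘ₗ f) h)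
    (F' := fun f => LinearMap.mulLeft R α ∘ₗ cup f h) ?_ ?_ f
  · intro f a
    simp [mul_assoc]
  · intro f a x ih
    have := ih (f ∘ₗ ocons R a)
    simp only [LinearMap.comp_apply, LinearMap.mulLeft_apply] at this
    simp only [cup_ocons, LinearMap.comp_apply, LinearMap.mulLeft_apply, LinearMap.comp_assoc, this,
      mul_add, mul_assoc]

variable (V) in
/-- The cochain that is constant on vertices. -/
def ocst (α : A) : OChains R V →ₗ[R] A := (oaug R).smulRight α

@[simp] theorem ocst_apply (α : A) (x : OChains R V) : ocst V α x = oaug R x • α := rfl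

theorem ocst_comp_ocons (α : A) (a : V) : ocst V α ∘ₗ ocons R a = 0 := by
  ext x : 1
  simp

/-- A constant cochain lives on vertices, so only the cut at the first vertex survives (on the other
side, at the last vertex). This accounts for the outer cofaces. -/
theorem cup_ocst_left (α : A) (h : OChains R V →ₗ[R] A) :
    cup (ocst V α) h = LinearMap.mulLeft R α ∘ₗ h := by
  refine ochains_ext ?_ ?_
  · simp
  · intro a x
    rw [cup_ocons, ocst_comp_ocons, cup_zero_left]
    simp

theorem cup_ocst_right (f : OChains R V →ₗ[R] A) (β : A) :
    cup f (ocst V β) = LinearMap.mulRight R β ∘ₗ f := by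
  refine cochain_ext_family (F := fun f => cup f (ocst V β))
    (F' := fun f => LinearMap.mulRight R β ∘ₗ f) ?_ ?_ f
  · simp
  · intro f a x ih
    simp [ih]

/-- Strict associativity is what lets an inner coface split a single factor of an iterated cup
product. -/
theorem cup_assoc (f g h : OChains R V →ₗ[R] A) : cup (cup f g) h = cup f (cup g h) := by
  refine cochain_ext_family (F := fun f => cup (cup f g) h)
    (F' := fun f => cup f (cup g h)) ?_ ?_ f
  · simp [mul_assoc]
  · intro f a x ih
    have e : cup f g ∘ₗ ocons R a =
        LinearMap.mulLeft R (f (opt R a)) ∘ₗ (g ∘ₗ ocons R a) + cup (f ∘ₗ ocons R a) g := by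
      ext x : 1
      simp
    simp only [cup_ocons, e, cup_opt, cup_add_left, cup_mulLeft, LinearMap.add_apply, ih,
      LinearMap.comp_apply, LinearMap.mulLeft_apply, mul_add, mul_assoc, add_assoc]

theorem cup_omap (f h : OChains R W →ₗ[R] A) (k : V → W) :
    cup f h ∘ₗ omap R k = cup (f ∘ₗ omap R k) (h ∘ₗ omap R k) := by
  refine cochain_ext_family (F := fun f => cup f h ∘ₗ omap R k)
    (F' := fun f => cup (f ∘ₗ omap R k) (h ∘ₗ omap R k)) ?_ ?_ f
  · simp
  · intro f a x ih
    have e : (f ∘ₗ omap R k) ∘ₗ ocons R a = (f ∘ₗ ocons R (k a)) ∘ₗ omap R k := by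
      ext x : 1
      simp
    have := ih (f ∘ₗ ocons R (k a))
    simp only [LinearMap.comp_apply] at this
    simp only [cup_ocons, LinearMap.comp_apply, omap_ocons, omap_opt, e, this]

/-- The Leibniz rule, with the sign of the first piece carried by `opar`, so that the cochains need
not be homogeneous. -/
theorem cup_odel (f g : OChains R V →ₗ[R] A) :
    cup f g ∘ₗ odel R = cup (f ∘ₗ odel R) g + cup (f ∘ₗ opar R) (g ∘ₗ odel R) := by
  refine cochain_ext_family (F := fun f => cup f g ∘ₗ odel R)
    (F' := fun f => cup (f ∘ₗ odel R) g + cup (f ∘ₗ opar R) (g ∘ₗ odel R)) ?_ ?_ f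
  · simp
  · intro f a x ih
    have e1 : (f ∘ₗ odel R) ∘ₗ ocons R a =
        f - (f ∘ₗ ocons R a) ∘ₗ odel R - ocst V (f (opt R a)) := by
      ext x : 1
      simp
    have e2 : (f ∘ₗ opar R) ∘ₗ ocons R a = -((f ∘ₗ ocons R a) ∘ₗ opar R) := by
      ext x : 1
      simp
    have := ih (f ∘ₗ ocons R a)
    simp only [LinearMap.comp_apply, LinearMap.add_apply] at this
    simp only [LinearMap.comp_apply, LinearMap.add_apply, cup_ocons, e1, e2, cup_sub_left,
      cup_neg_left, LinearMap.sub_apply, LinearMap.neg_apply, cup_ocst_left, LinearMap.mulLeft_apply,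
      odel_ocons, odel_opt, map_zero, zero_mul, map_sub, map_smul, this, opar_opt, cup_opt, mul_sub,
      mul_smul_comm]
    abel

/-- A skew derivation is applied to a cup product. -/
theorem skew_cup {P B : A →ₗ[R] A} (hB : ∀ a b, B (a * b) = B a * b + P a * B b)
    (f g : OChains R V →ₗ[R] A) : B ∘ₗ cup f g = cup (B ∘ₗ f) g + cup (P ∘ₗ f) (B ∘ₗ g) := by
  refine cochain_ext_family (F := fun f => B ∘ₗ cup f g)
    (F' := fun f => cup (B ∘ₗ f) g + cup (P ∘ₗ f) (B ∘ₗ g)) ?_ ?_ f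
  · simp [hB]
  · intro f a x ih
    have := ih (f ∘ₗ ocons R a)
    simp only [LinearMap.comp_apply, LinearMap.add_apply, ← LinearMap.comp_assoc] at this
    simp only [LinearMap.comp_apply, LinearMap.add_apply, cup_ocons, map_add, hB, this]
    abel

/-- A step of a shuffle in the first direction repeats a vertex of the second factor. Normalization
therefore leaves only the part of `x` in degree 0. -/
theorem omap_snd_oprod (x : OChains R V) (y : OChains R W) :
    omap R Prod.snd (oprod R x y) = oaug R x • y := by
  suffices H : (oprod R).compr₂ (omap R Prod.snd) =
      LinearMap.mk₂ R (fun (x : OChains R V) (y : OChains R W) => oaug R x • y)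
        (by intros; rw [map_add, add_smul]) (by intros; rw [map_smul, smul_assoc])
        (by intros; rw [smul_add]) (by intros; rw [smul_comm]) from LinearMap.congr_fun₂ H x y
  refine ochains_ext₂ ?_ ?_ ?_ ?_
  · simp
  · intro a b y h
    simp only [LinearMap.compr₂_apply, LinearMap.mk₂_apply, oprod_opt_ocons, omap_ocons, oaug_opt,
      one_smul] at h ⊢
    rw [h]
  · intro a b x h
    simp only [LinearMap.compr₂_apply, LinearMap.mk₂_apply, oprod_ocons_opt, omap_ocons, oaug_ocons,
      zero_smul] at h ⊢
    rw [h, map_smul, ocons_opt_self, smul_zero]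
  · intro a b x y h h'
    simp only [LinearMap.compr₂_apply, LinearMap.mk₂_apply, oprod_ocons_ocons, omap_ocons, oaug_ocons,
      zero_smul, map_sub] at h h' ⊢
    rw [h, h', map_zero, map_smul, ocons_ocons_self, smul_zero, sub_zero]

/-- The cup product of cochains pulled back from the two factors of a product. -/
theorem cup_oprod (f : OChains R V →ₗ[R] A) (g : OChains R W →ₗ[R] A) (x : OChains R V)
    (y : OChains R W) :
    cup (f ∘ₗ omap R Prod.fst) (g ∘ₗ omap R Prod.snd) (oprod R x y) = f x * g y := by
  -- The identity says that Alexander–Whitney undoes Eilenberg–Zilber. The cochain `f` is quantified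
  -- inside the values of the bilinear maps because the recursion replaces it by `f ∘ₗ ocons R a`.
  suffices H : LinearMap.mk₂ R (fun (x : OChains R V) (y : OChains R W) (f : OChains R V →ₗ[R] A) =>
      cup (f ∘ₗ omap R Prod.fst) (g ∘ₗ omap R Prod.snd) (oprod R x y))
        (by intros; funext f; simp) (by intros; funext f; simp) (by intros; funext f; simp)
        (by intros; funext f; simp) =
      LinearMap.mk₂ R (fun (x : OChains R V) (y : OChains R W) (f : OChains R V →ₗ[R] A) => f x * g y)
        (by intros; funext f; simp [add_mul]) (by intros; funext f; simp)
        (by intros; funext f; simp [mul_add]) (by intros; funext f; simp) from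
    congrFun (LinearMap.congr_fun₂ H x y) f
  have e : ∀ (f : OChains R V →ₗ[R] A) (a : V) (b : W),
      (f ∘ₗ omap R Prod.fst) ∘ₗ ocons R (a, b) = (f ∘ₗ ocons R a) ∘ₗ omap R Prod.fst := by
    intro f a b
    ext x : 1
    simp
  refine ochains_ext₂ ?_ ?_ ?_ ?_
  · intro a b
    funext f
    simp
  · intro a b y h
    funext f
    have := congrFun h (f ∘ₗ ocons R a)
    simp only [LinearMap.mk₂_apply] at this
    simp [e, this, omap_snd_oprod]
  · intro a b x h
    funext f
    have := congrFun h (f ∘ₗ ocons R a)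
    simp only [LinearMap.mk₂_apply] at this
    simp [e, this, omap_snd_oprod]
  · intro a b x y h h'
    funext f
    have h1 := congrFun (h (ocons R b y)) (f ∘ₗ ocons R a)
    have h2 := congrFun h' (f ∘ₗ ocons R a)
    simp only [LinearMap.mk₂_apply] at h1 h2
    simp only [LinearMap.mk₂_apply, oprod_ocons_ocons, cup_ocons, e, map_sub, h1, h2]
    simp [omap_snd_oprod]

end Cup

/-! ### Iterated cup products and sums over cuts -/

section CupProd

variable {R : Type v} [CommRing R] {V W : Type*} {A : Type*} [Ring A] [Algebra R A]

/-- The cup product of the first `n` members of a sequence of cochains. -/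
def cupProd : ℕ → (ℕ → OChains R V →ₗ[R] A) → (OChains R V →ₗ[R] A)
  | 0, _ => ocst V 1
  | n + 1, φ => cup (φ 0) (cupProd n fun j => φ (j + 1))

theorem cupProd_congr : ∀ (n : ℕ) {φ ψ : ℕ → OChains R V →ₗ[R] A}, (∀ j < n, φ j = ψ j) →
    cupProd n φ = cupProd n ψ
  | 0, _, _, _ => rfl
  | n + 1, φ, ψ, h => by
    rw [cupProd, cupProd, h 0 (by omega), cupProd_congr n fun j hj => h (j + 1) (by omega)]

theorem cupProd_one (φ : ℕ → OChains R V →ₗ[R] A) : cupProd 1 φ = φ 0 := by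
  rw [cupProd, cupProd, cup_ocst_right]
  ext x : 1
  simp

theorem cupProd_two (φ : ℕ → OChains R V →ₗ[R] A) : cupProd 2 φ = cup (φ 0) (φ 1) := by
  rw [cupProd, cupProd_one]

theorem cupProd_omap : ∀ (n : ℕ) (φ : ℕ → OChains R W →ₗ[R] A) (k : V → W),
    cupProd n φ ∘ₗ omap R k = cupProd n fun j => φ j ∘ₗ omap R k
  | 0, φ, k => by
    ext x : 1
    simp [cupProd]
  | n + 1, φ, k => by rw [cupProd, cupProd, cup_omap, cupProd_omap n]

theorem cupProd_add : ∀ (p q : ℕ) (φ : ℕ → OChains R V →ₗ[R] A),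
    cupProd (p + q) φ = cup (cupProd p φ) (cupProd q fun j => φ (p + j))
  | 0, q, φ => by
    rw [cupProd, cup_ocst_left]
    ext x : 1
    simp
  | p + 1, q, φ => by
    rw [Nat.add_right_comm, cupProd, cupProd_add p q, cupProd, cup_assoc]
    congr! 4 with j
    rw [Nat.add_right_comm]

/-- A factor of the form `cup (φ i) (φ (i + 1))` may be split. -/
theorem cupProd_succ_of_cup : ∀ (n i : ℕ) (_ : i < n) (φ ψ : ℕ → OChains R V →ₗ[R] A),
    (∀ j < i, ψ j = φ j) → ψ i = cup (φ i) (φ (i + 1)) → (∀ j, i < j → ψ j = φ (j + 1)) →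
    cupProd n ψ = cupProd (n + 1) φ
  | n + 1, 0, _, φ, ψ, _, h1, h2 => by
    rw [cupProd, cupProd, cupProd, h1, cup_assoc]
    congr 2
    exact cupProd_congr n fun j _ => h2 (j + 1) (by omega)
  | n + 1, i + 1, h, φ, ψ, h0, h1, h2 => by
    rw [cupProd, cupProd, h0 0 (by omega), cupProd_succ_of_cup n i (by omega)
      (fun j => φ (j + 1)) (fun j => ψ (j + 1)) (fun j hj => h0 _ (by omega)) h1
      fun j hj => h2 _ (by omega)]

/-- The Leibniz rule for `B` on values and the one for ∂ on arguments match term by term. Applied to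
the tensor algebra, this makes Alexander–Whitney a chain map. -/
theorem skew_cupProd {P B : A →ₗ[R] A} (hB : ∀ a b, B (a * b) = B a * b + P a * B b)
    (hB1 : B 1 = 0) : ∀ (n : ℕ) (φ : ℕ → OChains R V →ₗ[R] A),
    (∀ j, P ∘ₗ φ j = φ j ∘ₗ opar R) → (∀ j, B ∘ₗ φ j = φ j ∘ₗ odel R) →
    B ∘ₗ cupProd n φ = cupProd n φ ∘ₗ odel R
  | 0, φ, _, _ => by
    ext x : 1
    simp [cupProd, hB1]
  | n + 1, φ, h1, h2 => by
    rw [cupProd, skew_cup hB, h1, h2, skew_cupProd hB hB1 n _ (fun j => h1 _) fun j => h2 _, cup_odel]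

/-- The part of a sequence from the member number `a` on, of length `d + 1`. -/
def oblock (R : Type v) [CommRing R] (v : ℕ → V) (a d : ℕ) : OChains R V :=
  ocls R fun l : Fin (d + 1) => v (a + l)

theorem oblock_succ (v : ℕ → V) (a d : ℕ) :
    oblock R v a (d + 1) = ocons R (v a) (oblock R v (a + 1) d) := by
  rw [oblock, ocls_succ]
  congr 2
  funext l
  simp only [Fin.tail, Fin.val_succ]
  congr 1
  omega

theorem oblock_zero (v : ℕ → V) (a : ℕ) : oblock R v a 0 = opt R (v a) := ocls_zero _

/-- Unrolls the recursion into the classical sum over the vertex at which the sequence is cut. -/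
theorem cup_oblock (f h : OChains R V →ₗ[R] A) (v : ℕ → V) (a d : ℕ) :
    cup f h (oblock R v a d) =
      ∑ t ∈ Finset.range (d + 1), f (oblock R v a t) * h (oblock R v (a + t) (d - t)) := by
  induction d generalizing a f with
  | zero => simp [oblock_zero]
  | succ d ih =>
    rw [oblock_succ, cup_ocons, ih, Finset.sum_range_succ' _ (d + 1), add_comm (f _ * _)]
    congr 1
    · refine Finset.sum_congr rfl fun t _ => ?_
      rw [LinearMap.comp_apply, ← oblock_succ, Nat.add_sub_add_right, Nat.add_right_comm,
        Nat.add_assoc a t 1]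
    · simp [oblock_zero, oblock_succ]

/-- Iterates the cut formula. The sum runs over all maps `p`, with a zero factor wherever `p`
decreases, so that splitting off the first cut is a sum over a product type. -/
theorem cupProd_oblock (v : ℕ → V) (k : ℕ) : ∀ (n : ℕ) (φ : ℕ → OChains R V →ₗ[R] A)
    (a : Fin (k + 1)), cupProd n φ (oblock R v a (k - a)) =
      ∑ p : Fin (n + 1) → Fin (k + 1), if p 0 = a ∧ p (Fin.last n) = Fin.last k then
        (List.ofFn fun j : Fin n => if p j.castSucc ≤ p j.succ then
          φ j (oblock R v (p j.castSucc) (p j.succ - p j.castSucc)) else 0).prod else 0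
  | 0, φ, a => by
    rw [Fintype.sum_eq_single fun _ => a]
    · simp only [cupProd, ocst_apply, oblock, oaug_ocls, List.ofFn_zero, List.prod_nil, true_and,
        ite_smul, one_smul, zero_smul, Fin.ext_iff, Fin.val_last]
      exact if_congr (by omega) rfl rfl
    · intro p hp
      refine if_neg fun h => hp (funext fun i => ?_)
      rw [Fin.fin_one_eq_zero i, h.1]
  | n + 1, φ, a => by
    have h1 : cupProd (n + 1) φ (oblock R v a (k - a)) = ∑ b : Fin (k + 1),
        (if a ≤ b then φ 0 (oblock R v a (b - a)) else 0) *
          cupProd n (fun j => φ (j + 1)) (oblock R v b (k - b)) := by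
      rw [cupProd, cup_oblock, ← Nat.sub_add_comm (by omega : (a : ℕ) ≤ k)]
      refine Eq.trans ?_ (Finset.sum_range (n := k + 1) fun b : ℕ =>
        (if (a : ℕ) ≤ b then φ 0 (oblock R v a (b - a)) else 0) *
          cupProd n (fun j => φ (j + 1)) (oblock R v b (k - b)))
      simp only [ite_mul, zero_mul]
      rw [← Finset.sum_filter, show (Finset.range (k + 1)).filter (fun b => (a : ℕ) ≤ b) =
        Finset.Ico (a : ℕ) (k + 1) by ext b; simp [and_comm], Finset.sum_Ico_eq_sum_range]
      refine Finset.sum_congr rfl fun t _ => ?_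
      rw [Nat.add_sub_cancel_left, Nat.sub_sub]
    rw [h1]
    symm
    rw [← (Fin.consEquiv fun _ => Fin (k + 1)).sum_comp, Fintype.sum_prod_type,
      Fintype.sum_eq_single a]
    · simp only [cupProd_oblock v k n, Finset.mul_sum]
      rw [Finset.sum_comm]
      refine Finset.sum_congr rfl fun p _ => ?_
      rw [Fintype.sum_eq_single (p 0)]
      · by_cases hp : a ≤ p 0 <;>
          simp [Fin.consEquiv, ← Fin.succ_last, Fin.cons_succ, List.ofFn_succ, hp]
      · intro b hb
        exact mul_eq_zero_of_right _ (if_neg fun h => hb h.1.symm)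
    · intro b hb
      refine Finset.sum_eq_zero fun p _ => ?_
      rw [if_neg]
      exact fun h => hb h.1

end CupProd

end Chen

namespace Chen

/-! ### Tensor powers inside the tensor algebra -/

section TensorAlgebra

variable {R : Type v} [CommRing R] {E : Type w} [AddCommGroup E] [Module R E]

theorem tensor_ext {M : Type*} [AddCommGroup M] [Module R M] {n : ℕ} {f f' : ⨂[R]^n E →ₗ[R] M}
    (h : ∀ c, f (PiTensorProduct.tprod R c) = f' (PiTensorProduct.tprod R c)) : f = f' :=
  PiTensorProduct.ext (MultilinearMap.ext h)

variable (R) in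
/-- The inclusion of `E^{⊗ n}` into the tensor algebra. -/
abbrev toTAlg {n : ℕ} : ⨂[R]^n E →ₗ[R] TensorAlgebra R E := TensorPower.toTensorAlgebra

variable (R) in
/-- The inclusion of `E^{⊗ n}` into the direct sum of the tensor powers. -/
abbrev tinc (n : ℕ) : ⨂[R]^n E →ₗ[R] ⨁ n : ℕ, ⨂[R]^n E := DirectSum.lof R ℕ (fun n => ⨂[R]^n E) n

variable (R) in
/-- The projection of the direct sum of the tensor powers to `E^{⊗ n}`. -/
abbrev tproj (n : ℕ) : (⨁ n : ℕ, ⨂[R]^n E) →ₗ[R] ⨂[R]^n E :=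
  DirectSum.component R ℕ (fun n => ⨂[R]^n E) n

variable (R) in
/-- The inclusion of `E` into the direct sum of the tensor powers. -/
abbrev tinc₁ : E →ₗ[R] ⨁ n : ℕ, ⨂[R]^n E :=
  (TensorAlgebra.toDirectSum (R := R) (M := E)).toLinearMap ∘ₗ TensorAlgebra.ι R

theorem toTAlg_tprod {n : ℕ} (c : Fin n → E) : toTAlg R (PiTensorProduct.tprod R c) =
    (List.ofFn fun i => TensorAlgebra.ι R (c i)).prod := by
  rw [toTAlg, TensorPower.toTensorAlgebra_tprod, TensorAlgebra.tprod_apply]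

theorem toDirectSum_toTAlg {n : ℕ} (z : ⨂[R]^n E) :
    TensorAlgebra.toDirectSum (toTAlg R z) = tinc R n z := by
  suffices H : TensorAlgebra.toDirectSum.toLinearMap ∘ₗ toTAlg R = tinc R (E := E) n from
    LinearMap.congr_fun H z
  refine tensor_ext fun c => ?_
  rw [LinearMap.comp_apply, AlgHom.toLinearMap_apply, TensorPower.toTensorAlgebra_tprod, TensorAlgebra.toDirectSum_tensorPower_tprod]
  rfl

theorem toDirectSum_injective : Function.Injective (TensorAlgebra.toDirectSum (R := R) (M := E)) :=
  Function.LeftInverse.injective (g := TensorAlgebra.ofDirectSum) TensorAlgebra.ofDirectSum_toDirectSum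

/-- Identities in tensor powers can be checked in the tensor algebra, where concatenation is
multiplication and the exponents p + q and n need not be matched by casts. -/
theorem toTAlg_injective {n : ℕ} : Function.Injective (toTAlg R (E := E) (n := n)) := by
  intro z z' h
  have := congrArg (tproj R n) (congrArg TensorAlgebra.toDirectSum h)
  rwa [toDirectSum_toTAlg, toDirectSum_toTAlg, DirectSum.component.lof_self,
    DirectSum.component.lof_self] at this

theorem toTAlg_proj {n k : ℕ} (h : k = n) (z : ⨂[R]^k E) {y : ⨁ n : ℕ, ⨂[R]^n E}
    (hy : y = tinc R k z) : TensorAlgebra.toDirectSum (toTAlg R (tproj R n y)) = y := by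
  subst h
  rw [toDirectSum_toTAlg, hy, DirectSum.component.lof_self]

theorem tinc_mul {p q : ℕ} (z : ⨂[R]^p E) (w : ⨂[R]^q E) : tinc R p z * tinc R q w =
    tinc R (p + q) (GradedMonoid.GMul.mul (A := fun n : ℕ => ⨂[R]^n E) z w) := by
  simp only [tinc, DirectSum.lof_eq_of]
  exact DirectSum.of_mul_of (A := fun n : ℕ => ⨂[R]^n E) z w

theorem toTAlg_proj_mul {p q n : ℕ} (h : p + q = n) (z : ⨂[R]^p E) (w : ⨂[R]^q E) :
    toTAlg R (tproj R n (tinc R p z * tinc R q w)) = toTAlg R z * toTAlg R w := by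
  refine toDirectSum_injective ?_
  rw [toTAlg_proj h _ (tinc_mul z w)]
  exact (congrArg₂ (· * ·) (toDirectSum_toTAlg z) (toDirectSum_toTAlg w)).symm.trans
    (map_mul TensorAlgebra.toDirectSum _ _).symm

theorem tinc₁_eq_toDirectSum (c : E) :
    tinc₁ R c = TensorAlgebra.toDirectSum (TensorAlgebra.ι R c) := rfl

theorem toTAlg_one (c : E) :
    toTAlg R (PiTensorProduct.tprod R fun _ : Fin 1 => c) = TensorAlgebra.ι R c := by
  rw [toTAlg_tprod]
  simp

theorem tinc₁_eq_inc (c : E) :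
    tinc₁ R c = tinc R 1 (PiTensorProduct.tprod R fun _ : Fin 1 => c) := by
  rw [tinc₁_eq_toDirectSum, ← toTAlg_one, toDirectSum_toTAlg]

theorem toTAlg_headCoface {n : ℕ} (c : E) (z : ⨂[R]^n E) :
    toTAlg R (tproj R (n + 1) (tinc₁ R c * tinc R n z)) = TensorAlgebra.ι R c * toTAlg R z := by
  rw [tinc₁_eq_inc, toTAlg_proj_mul (Nat.add_comm _ _), toTAlg_one]

theorem toTAlg_tailCoface {n : ℕ} (c : E) (z : ⨂[R]^n E) :
    toTAlg R (tproj R (n + 1) (tinc R n z * tinc₁ R c)) = toTAlg R z * TensorAlgebra.ι R c := by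
  rw [tinc₁_eq_inc, toTAlg_proj_mul rfl, toTAlg_one]

/-- The linear map `c_1 ⊗ ⋯ ⊗ c_n ↦ g_1 c_1 ⋯ g_n c_n`. -/
def tlift {A : Type*} [Ring A] [Algebra R A] (n : ℕ) (g : ℕ → E →ₗ[R] A) :
    ⨂[R]^n E →ₗ[R] A :=
  PiTensorProduct.lift ((MultilinearMap.mkPiAlgebraFin R n A).compLinearMap fun j => g j)

theorem tlift_tprod {A : Type*} [Ring A] [Algebra R A] {n : ℕ} (g : ℕ → E →ₗ[R] A)
    (c : Fin n → E) :
    tlift n g (PiTensorProduct.tprod R c) = (List.ofFn fun j => g j (c j)).prod := by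
  rw [tlift, PiTensorProduct.lift.tprod]
  simp

theorem toTAlg_eq_tlift {n : ℕ} (z : ⨂[R]^n E) :
    toTAlg R z = tlift n (fun _ => TensorAlgebra.ι R) z := by
  suffices H : toTAlg R = tlift n fun _ => TensorAlgebra.ι R (M := E) from
    LinearMap.congr_fun H z
  refine tensor_ext fun c => ?_
  rw [toTAlg_tprod, tlift_tprod]

theorem toTAlg_map {E' : Type*} [AddCommGroup E'] [Module R E'] (f : E →ₗ[R] E') {n : ℕ}
    (z : ⨂[R]^n E) : toTAlg R (PiTensorProduct.map (fun _ => f) z : ⨂[R]^n E') =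
      tlift n (fun _ => TensorAlgebra.ι R ∘ₗ f) z := by
  suffices H : toTAlg R ∘ₗ (PiTensorProduct.map (fun _ => f) : ⨂[R]^n E →ₗ[R] ⨂[R]^n E') =
      tlift n fun _ => TensorAlgebra.ι R ∘ₗ f from LinearMap.congr_fun H z
  refine tensor_ext fun c => ?_
  rw [LinearMap.comp_apply, PiTensorProduct.map_tprod, toTAlg_tprod, tlift_tprod]
  rfl

/-- Records only that a product of homogeneous elements is homogeneous of the expected degree; this
suffices to show that a projection loses nothing. -/
theorem exists_inc_prod : ∀ (n : ℕ) (f : Fin n → ℕ) (y : Fin n → ⨁ n : ℕ, ⨂[R]^n E),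
    (∀ j, ∃ z, y j = tinc R (f j) z) → ∃ z, (List.ofFn y).prod = tinc R (∑ j, f j) z
  | 0, f, y, _ => by
    refine ⟨GradedMonoid.GOne.one (A := fun n : ℕ => ⨂[R]^n E), ?_⟩
    rw [List.ofFn_zero, List.prod_nil]
    exact DirectSum.one_def _
  | n + 1, f, y, h => by
    obtain ⟨z, hz⟩ := h 0
    obtain ⟨w, hw⟩ := exists_inc_prod n (fun j => f j.succ) (fun j => y j.succ) fun j => h j.succ
    rw [List.ofFn_succ, List.prod_cons, hw, hz, Fin.sum_univ_succ]
    exact ⟨_, tinc_mul z w⟩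

/-- The map that applies `D` to the factor number `i`. -/
def splitFactor (D : E →ₗ[R] ⨂[R]^2 E) (n : ℕ) (i : Fin n) : ⨂[R]^n E →ₗ[R] ⨂[R]^(n + 1) E :=
  tproj R (n + 1) ∘ₗ PiTensorProduct.lift
    ((MultilinearMap.mkPiAlgebraFin R n (⨁ n : ℕ, ⨂[R]^n E)).compLinearMap fun j =>
      if j = i then tinc R 2 ∘ₗ D else tinc₁ R)

theorem splitFactor_tprod (D : E →ₗ[R] ⨂[R]^2 E) {n : ℕ} (i : Fin n) (c : Fin n → E) :
    splitFactor D n i (PiTensorProduct.tprod R c) = tproj R (n + 1) (List.ofFn fun j =>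
      (if j = i then tinc R 2 ∘ₗ D else tinc₁ R) (c j)).prod := by
  rw [splitFactor, LinearMap.comp_apply, PiTensorProduct.lift.tprod]
  rfl

/-- One factor has degree 2 and the others degree 1, so the product is homogeneous of degree n + 1
and passing through the projection does not change it. -/
theorem toTAlg_splitFactor (D : E →ₗ[R] ⨂[R]^2 E) {n : ℕ} (i : Fin n) (z : ⨂[R]^n E) :
    toTAlg R (splitFactor D n i z) =
      tlift n (fun j => if j = (i : ℕ) then toTAlg R ∘ₗ D else TensorAlgebra.ι R) z := by
  suffices H : toTAlg R ∘ₗ splitFactor D n i =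
      tlift n (fun j => if j = (i : ℕ) then toTAlg R ∘ₗ D else TensorAlgebra.ι R) from
    LinearMap.congr_fun H z
  refine tensor_ext fun c => toDirectSum_injective ?_
  obtain ⟨z, hz⟩ := exists_inc_prod n (fun j => if j = i then 2 else 1) (fun j =>
    (if j = i then tinc R 2 ∘ₗ D else tinc₁ R) (c j)) (by
      intro j
      by_cases h : j = i
      · rw [show (if j = i then 2 else 1) = 2 from if_pos h, if_pos h]
        exact ⟨_, rfl⟩
      · rw [show (if j = i then 2 else 1) = 1 from if_neg h, if_neg h]
        exact ⟨_, tinc₁_eq_inc _⟩)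
  rw [LinearMap.comp_apply, splitFactor_tprod, toTAlg_proj ?_ z hz, tlift_tprod,
    map_list_prod TensorAlgebra.toDirectSum, List.map_ofFn]
  · congr 2
    funext j
    simp only [Fin.ext_iff, Function.comp]
    split_ifs
    · exact (toDirectSum_toTAlg _).symm
    · rfl
  · have : ∀ j, (if j = i then 2 else 1) = 1 + if j = i then 1 else 0 := fun j => by split_ifs <;> rfl
    simp [this, Finset.sum_add_distrib]

/-! #### The differential -/

/-- The algebra endomorphism of the tensor algebra that extends an endomorphism of `E`. -/
def algParity (P : E →ₗ[R] E) : TensorAlgebra R E →ₐ[R] TensorAlgebra R E :=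
  TensorAlgebra.lift R (TensorAlgebra.ι R ∘ₗ P)

/-- The skew derivation that extends `d`, as an entry of an algebra homomorphism to matrices. -/
def algMatrix (P d : E →ₗ[R] E) : TensorAlgebra R E →ₐ[R] Matrix (Fin 2) (Fin 2) (TensorAlgebra R E) :=
  TensorAlgebra.lift R
    -- Triangular matrices of this form multiply by the skew Leibniz rule in the upper right corner.
    { toFun := fun c => !![TensorAlgebra.ι R (P c), TensorAlgebra.ι R (d c); 0, TensorAlgebra.ι R c]
      map_add' := fun c c' => by ext i j; fin_cases i <;> fin_cases j <;> simp
      map_smul' := fun r c => by ext i j; fin_cases i <;> fin_cases j <;> simp }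

/-- The skew derivation of the tensor algebra that extends `d`. -/
def algBoundary (P d : E →ₗ[R] E) : TensorAlgebra R E →ₗ[R] TensorAlgebra R E where
  toFun a := algMatrix P d a 0 1
  map_add' a b := by rw [map_add]; rfl
  map_smul' r a := by rw [map_smul]; rfl

variable (P d : E →ₗ[R] E)

theorem algParity_ι (c : E) : algParity P (TensorAlgebra.ι R c) = TensorAlgebra.ι R (P c) :=
  TensorAlgebra.lift_ι_apply _ _

theorem algMatrix_ι (c : E) : algMatrix P d (TensorAlgebra.ι R c) =
    !![TensorAlgebra.ι R (P c), TensorAlgebra.ι R (d c); 0, TensorAlgebra.ι R c] :=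
  TensorAlgebra.lift_ι_apply _ _

theorem algBoundary_ι (c : E) : algBoundary P d (TensorAlgebra.ι R c) = TensorAlgebra.ι R (d c) :=
  congrFun (congrFun (algMatrix_ι P d c) 0) 1

theorem algMatrix_apply (a : TensorAlgebra R E) :
    algMatrix P d a 0 0 = algParity P a ∧ algMatrix P d a 1 0 = 0 ∧ algMatrix P d a 1 1 = a := by
  induction a using TensorAlgebra.induction with
  | algebraMap r =>
    rw [AlgHom.commutes, AlgHom.commutes]
    exact ⟨Matrix.algebraMap_matrix_apply .. |>.trans (if_pos rfl),
      Matrix.algebraMap_matrix_apply .. |>.trans (if_neg one_ne_zero),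
      Matrix.algebraMap_matrix_apply .. |>.trans (if_pos rfl)⟩
  | ι c => rw [algMatrix_ι, algParity_ι]; exact ⟨rfl, rfl, rfl⟩
  | mul a b ha hb =>
    rw [map_mul, map_mul, Matrix.mul_apply, Matrix.mul_apply, Matrix.mul_apply, Fin.sum_univ_two,
      Fin.sum_univ_two, Fin.sum_univ_two, ha.1, ha.2.1, ha.2.2, hb.1, hb.2.1, hb.2.2]
    simp
  | add a b ha hb =>
    rw [map_add, map_add, Matrix.add_apply, Matrix.add_apply, Matrix.add_apply, ha.1, ha.2.1, ha.2.2,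
      hb.1, hb.2.1, hb.2.2]
    simp

theorem algBoundary_mul (a b : TensorAlgebra R E) :
    algBoundary P d (a * b) = algBoundary P d a * b + algParity P a * algBoundary P d b := by
  change algMatrix P d (a * b) 0 1 = algMatrix P d a 0 1 * b + algParity P a * algMatrix P d b 0 1
  rw [map_mul, Matrix.mul_apply, Fin.sum_univ_two, (algMatrix_apply P d a).1,
    (algMatrix_apply P d b).2.2, add_comm]

theorem algBoundary_one : algBoundary P d 1 = 0 := by
  change algMatrix P d 1 0 1 = 0
  rw [map_one]
  rfl

theorem algBoundary_list_prod : ∀ (n : ℕ) (c : Fin n → E),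
    algBoundary P d (List.ofFn fun i => TensorAlgebra.ι R (c i)).prod =
      ∑ i : Fin n, (List.ofFn fun j => TensorAlgebra.ι R
        ((if j < i then P else if j = i then d else LinearMap.id) (c j))).prod
  | 0, c => by simp [algBoundary_one]
  | n + 1, c => by
    rw [List.ofFn_succ, List.prod_cons, algBoundary_mul, algBoundary_list_prod, algBoundary_ι,
      algParity_ι, Fin.sum_univ_succ, Finset.mul_sum]
    congr 1
    · simp [List.ofFn_succ, Fin.succ_ne_zero]
    · refine Finset.sum_congr rfl fun i _ => ?_
      simp [List.ofFn_succ]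

theorem toTAlg_sum_map {n : ℕ} (z : ⨂[R]^n E) :
    toTAlg R ((∑ i : Fin n, PiTensorProduct.map fun j =>
      if j < i then P else if j = i then d else LinearMap.id : ⨂[R]^n E →ₗ[R] ⨂[R]^n E) z) =
      algBoundary P d (toTAlg R z) := by
  suffices H : toTAlg R ∘ₗ (∑ i : Fin n, PiTensorProduct.map fun j =>
      if j < i then P else if j = i then d else LinearMap.id : ⨂[R]^n E →ₗ[R] ⨂[R]^n E) =
      algBoundary P d ∘ₗ toTAlg R from LinearMap.congr_fun H z
  refine tensor_ext fun c => ?_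
  rw [LinearMap.comp_apply, LinearMap.comp_apply, toTAlg_tprod, algBoundary_list_prod,
    LinearMap.sum_apply, map_sum]
  refine Finset.sum_congr rfl fun i _ => ?_
  rw [PiTensorProduct.map_tprod, toTAlg_tprod]

end TensorAlgebra

/-! ### The cobar operations in the tensor algebra -/

section Chains

variable {R : Type v} [CommRing R] {X : Type u} [TopologicalSpace X]

theorem toTAlg_tensorBoundary {n : ℕ} (z : ⨂[R]^n (SChains R X)) :
    toTAlg R (tensorBoundary R n z) =
      algBoundary (simpParity R) (simpBoundary R) (toTAlg R z) :=
  toTAlg_sum_map (simpParity R) (simpBoundary R) z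

theorem toTAlg_innerCoface {n : ℕ} (i : Fin n) (z : ⨂[R]^n (SChains R X)) :
    toTAlg R (innerCoface R n i z) = tlift n (fun j => if j = (i : ℕ) then
      toTAlg R ∘ₗ simpDiag R else TensorAlgebra.ι R) z :=
  toTAlg_splitFactor (simpDiag R) i z

theorem inc₁_eq_tinc₁ : inc₁ R (X := X) = tinc₁ R := by
  unfold inc₁
  with_reducible rfl

theorem toTAlg_inc₁_mul {n : ℕ} (c : SChains R X) (z : ⨂[R]^n (SChains R X)) :
    toTAlg R (proj R (n + 1) (inc₁ R c * inc R n z)) = TensorAlgebra.ι R c * toTAlg R z := by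
  rw [inc₁_eq_tinc₁]
  exact toTAlg_headCoface c z

theorem toTAlg_mul_inc₁ {n : ℕ} (c : SChains R X) (z : ⨂[R]^n (SChains R X)) :
    toTAlg R (proj R (n + 1) (inc R n z * inc₁ R c)) = toTAlg R z * TensorAlgebra.ι R c := by
  rw [inc₁_eq_tinc₁]
  exact toTAlg_tailCoface c z

theorem cofaceSum_apply (a b : X) (n : ℕ) (z : ⨂[R]^n (SChains R X)) : cofaceSum R a b n z =
    proj R (n + 1) (inc₁ R (pointChain R a) * inc R n z)
      + ∑ i : Fin n, (-1 : R) ^ ((i : ℕ) + 1) • innerCoface R n i z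
      + (-1 : R) ^ (n + 1) • proj R (n + 1) (inc R n z * inc₁ R (pointChain R b)) := by
  rw [cofaceSum, LinearMap.add_apply, LinearMap.add_apply, LinearMap.sum_apply]
  rfl

end Chains

end Chen

namespace Chen

/-! ### Realizations of ordered chains -/

section Realization

variable {V W : Type*} {X : Type u} [TopologicalSpace X] {Y : Type w} [TopologicalSpace Y]

/-- A compatible way to turn sequences of vertices into singular simplices. -/
structure Realization (V : Type*) (X : Type u) [TopologicalSpace X] where
  simp : ∀ d : ℕ, (Fin (d + 1) → V) → Simp d X
  pull_simp : ∀ (d e : ℕ) (θ : Fin (e + 1) → Fin (d + 1)) (g : Fin (d + 1) → V),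
    pull θ (simp d g) = simp e (g ∘ θ)

namespace Realization

/-- The composition with a continuous map. -/
def map (f : C(X, Y)) (ρ : Realization V X) : Realization V Y where
  simp d g := f.comp (ρ.simp d g)
  pull_simp d e θ g := by rw [pull_comp, ρ.pull_simp]

/-- The composition with a map of vertices. -/
def comap (k : W → V) (ρ : Realization V X) : Realization W X where
  simp d g := ρ.simp d (k ∘ g)
  pull_simp d e θ _ := ρ.pull_simp d e θ _

/-- A finite family of realizations as a realization in a power. -/
def pi {n : ℕ} (φ : Fin n → Realization V X) : Realization V (Fin n → X) where
  simp d g := ⟨fun s j => (φ j).simp d g s, by fun_prop⟩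
  pull_simp d e θ g := by
    ext s j
    exact DFunLike.congr_fun ((φ j).pull_simp d e θ g) s

/-- The constant realization. -/
def const (V : Type*) (a : X) : Realization V X where
  simp _ _ := ContinuousMap.const _ a
  pull_simp _ _ _ _ := rfl

variable (R : Type v) [CommRing R]

/-- The chain map induced by a realization. -/
def chain (ρ : Realization V X) : OChains R V →ₗ[R] SChains R X :=
  liftChains (fun s => scls R (ρ.simp s.1 s.2)) (by
    rintro ⟨n, g⟩ ⟨i, hi⟩
    refine cls_eq_zero (isDegenSimp_of_collapse i _ ?_)
    rw [ρ.pull_simp]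
    congr 1
    funext l
    by_cases hl : l = i.succ
    · simp only [collapse, Function.comp, hl, if_true]
      exact hi
    · simp [collapse, hl])

theorem chain_ocls (ρ : Realization V X) {n : ℕ} (g : Fin (n + 1) → V) :
    ρ.chain R (ocls R g) = scls R (ρ.simp n g) := liftChains_cls _ _ _

theorem simpBoundary_chain (ρ : Realization V X) :
    simpBoundary R ∘ₗ ρ.chain R = ρ.chain R ∘ₗ odel R := by
  refine chains_ext ?_
  rintro ⟨_ | n, g⟩
  · change simpBoundary R (ρ.chain R (ocls R g)) = ρ.chain R (odel R (ocls R g))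
    rw [chain_ocls, odel_eq_zero (ocls_mem g), map_zero]
    exact liftChains_cls _ _ _
  · change simpBoundary R (ρ.chain R (ocls R g)) = ρ.chain R (odel R (ocls R g))
    rw [chain_ocls, odel_ocls, map_sum]
    refine (liftChains_cls _ _ _).trans (Finset.sum_congr rfl fun i _ => ?_)
    rw [map_smul, chain_ocls]
    rw [ρ.pull_simp]

theorem simpParity_chain (ρ : Realization V X) :
    simpParity R ∘ₗ ρ.chain R = ρ.chain R ∘ₗ opar R := by
  refine chains_ext fun s => ?_
  change simpParity R (ρ.chain R (ocls R s.2)) = ρ.chain R (opar R (ocls R s.2))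
  rw [chain_ocls, opar_ocls, map_smul, chain_ocls]
  exact liftChains_cls _ _ _

theorem simpMap_chain (f : C(X, Y)) (ρ : Realization V X) :
    simpMap R f ∘ₗ ρ.chain R = (ρ.map f).chain R := by
  refine chains_ext fun s => ?_
  change simpMap R f (ρ.chain R (ocls R s.2)) = (ρ.map f).chain R (ocls R s.2)
  rw [chain_ocls, chain_ocls]
  exact liftChains_cls _ _ _

theorem chain_omap (k : W → V) (ρ : Realization V X) :
    ρ.chain R ∘ₗ omap R k = (ρ.comap k).chain R := by
  refine chains_ext fun s => ?_
  change ρ.chain R (omap R k (ocls R s.2)) = (ρ.comap k).chain R (ocls R s.2)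
  rw [omap_ocls, chain_ocls, chain_ocls]
  rfl

/-- Constant simplices of positive dimension are degenerate. -/
theorem chain_const (a : X) (x : OChains R V) :
    (const V a).chain R x = oaug R x • pointChain R a := by
  suffices H : (const V a).chain R = (oaug R).smulRight (pointChain R a) from LinearMap.congr_fun H x
  refine chains_ext ?_
  rintro ⟨_ | n, g⟩
  · change (const V a).chain R (ocls R g) = oaug R (ocls R g) • pointChain R a
    rw [chain_ocls, oaug_ocls, if_pos rfl, one_smul]
    rfl
  · change (const V a).chain R (ocls R g) = oaug R (ocls R g) • pointChain R a
    rw [chain_ocls, oaug_ocls, if_neg (Nat.succ_ne_zero n), zero_smul]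
    exact cls_eq_zero ⟨n, ContinuousMap.const _ a, 0, rfl⟩

variable {R}

/-- The Alexander–Whitney map is an iterated cup product. -/
theorem tlift_alexanderWhitney {A : Type*} [Ring A] [Algebra R A] (n : ℕ)
    (g : ℕ → SChains R X →ₗ[R] A) (φ : ℕ → Realization V X) (x : OChains R V) :
    tlift n g (alexanderWhitney R n ((pi fun j : Fin n => φ j).chain R x)) =
      cupProd n (fun j => g j ∘ₗ (φ j).chain R) x := by
  suffices H : tlift n g ∘ₗ alexanderWhitney R n ∘ₗ (pi fun j : Fin n => φ j).chain R =
      cupProd n (fun j => g j ∘ₗ (φ j).chain R) from LinearMap.congr_fun H x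
  refine chains_ext ?_
  rintro ⟨k, h⟩
  change tlift n g (alexanderWhitney R n ((pi fun j : Fin n => φ j).chain R (ocls R h))) =
    cupProd n (fun j => g j ∘ₗ (φ j).chain R) (ocls R h)
  rw [chain_ocls]
  -- The sequence is continued by its last vertex so that blocks can be indexed by natural numbers;
  -- the blocks that occur end at k at the latest.
  let v : ℕ → V := fun i => h ⟨min i k, by omega⟩
  have hv : ∀ i (hi : i < k + 1), v i = h ⟨i, hi⟩ := fun i hi => by
    simp only [v]
    congr 2
    omega
  have h0 : ocls R h = oblock R v (0 : Fin (k + 1)) (k - (0 : Fin (k + 1))) := by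
    change ocls R h = ocls R fun l : Fin (k + 1) => v (0 + l)
    congr 2
    funext l
    rw [hv _ (by omega)]
    congr 1
    ext
    simp
  rw [h0, cupProd_oblock]
  have h1 : alexanderWhitney R n (scls R ((pi fun j : Fin n => φ j).simp k h)) =
    alexanderWhitneyGen R n ⟨k, (pi fun j : Fin n => φ j).simp k h⟩ := liftChains_cls _ _ _
  rw [h1, alexanderWhitneyGen, map_sum]
  classical
  -- A map that is not monotone decreases at some step and contributes a zero factor, so the sum
  -- over all maps is the sum over monotone ones.
  have h2 : ∀ p : Fin (n + 1) → Fin (k + 1), (if p 0 = 0 ∧ p (Fin.last n) = Fin.last k then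
      (List.ofFn fun j : Fin n => if p j.castSucc ≤ p j.succ then
        (g j ∘ₗ (φ j).chain R) (oblock R v (p j.castSucc) (p j.succ - p j.castSucc)) else 0).prod
        else 0) = if Monotone p ∧ p 0 = 0 ∧ p (Fin.last n) = Fin.last k then
      (List.ofFn fun j : Fin n => g j (scls R (seg (p j.castSucc) (p j.succ)
        ((coordMap n j).comp ((pi fun j : Fin n => φ j).simp k h))))).prod else 0 := by
    intro p
    by_cases hp : p 0 = 0 ∧ p (Fin.last n) = Fin.last k
    swap
    · rw [if_neg hp, if_neg fun h => hp h.2]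
    rw [if_pos hp]
    by_cases hm : Monotone p
    · rw [if_pos ⟨hm, hp⟩]
      congr 2
      funext j
      rw [if_pos (hm (Fin.castSucc_lt_succ).le), LinearMap.comp_apply, oblock, chain_ocls]
      congr 2
      change (φ j).simp _ _ = pull _ ((φ j).simp k h)
      rw [(φ j).pull_simp]
      congr 1
      funext l
      exact hv _ _
    · rw [if_neg fun h => hm h.1]
      rw [Fin.monotone_iff_le_succ] at hm
      push Not at hm
      obtain ⟨i, hi⟩ := hm
      refine List.prod_eq_zero ?_
      rw [List.mem_ofFn]
      exact ⟨i, if_neg (not_le.2 hi)⟩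
  rw [Finset.sum_congr rfl fun p _ => h2 p, ← Finset.sum_filter,
    Finset.sum_subtype (p := fun p : Fin (n + 1) → Fin (k + 1) =>
      Monotone p ∧ p 0 = 0 ∧ p (Fin.last n) = Fin.last k) _ (by simp)]
  refine Finset.sum_congr rfl fun p _ => ?_
  rw [tlift_tprod]

theorem toTAlg_alexanderWhitney (n : ℕ) (φ : ℕ → Realization V X) (x : OChains R V) :
    toTAlg R (alexanderWhitney R n ((pi fun j : Fin n => φ j).chain R x)) =
      cupProd n (fun j => TensorAlgebra.ι R ∘ₗ (φ j).chain R) x :=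
  (toTAlg_eq_tlift _).trans (tlift_alexanderWhitney n _ φ x)

/-- The boundary of a tensor power is a skew derivation of the tensor algebra, and each realization
intertwines it with ∂; `skew_cupProd` does the rest. -/
theorem tensorBoundary_alexanderWhitney (n : ℕ) (φ : ℕ → Realization V X) (x : OChains R V) :
    tensorBoundary R n (alexanderWhitney R n ((pi fun j : Fin n => φ j).chain R x)) =
      alexanderWhitney R n ((pi fun j : Fin n => φ j).chain R (odel R x)) := by
  apply toTAlg_injective
  rw [toTAlg_tensorBoundary, toTAlg_alexanderWhitney, toTAlg_alexanderWhitney]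
  refine LinearMap.congr_fun (skew_cupProd (R := R) (P := (algParity (simpParity R)).toLinearMap)
    (algBoundary_mul _ _) (algBoundary_one _ _) n _ (fun j => ?_) fun j => ?_) x
  · refine LinearMap.ext fun x => ?_
    exact (algParity_ι _ _).trans (congrArg _ (LinearMap.congr_fun (simpParity_chain R (φ j)) x))
  · refine LinearMap.ext fun x => ?_
    exact (algBoundary_ι _ _ _).trans (congrArg _ (LinearMap.congr_fun (simpBoundary_chain R (φ j)) x))

theorem sum_succ_sub_castSucc : ∀ (n : ℕ) (f : Fin (n + 1) → ℤ),
    ∑ i : Fin n, (f i.succ - f i.castSucc) = f (Fin.last n) - f 0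
  | 0, f => by simp
  | n + 1, f => by
    rw [Fin.sum_univ_castSucc]
    have := sum_succ_sub_castSucc n fun i => f i.castSucc
    simp only [Fin.succ_castSucc, this, Fin.succ_last, Fin.castSucc_zero]
    abel

theorem alexanderWhitney_mem (n : ℕ) (ρ : Realization V (Fin n → X)) {d : ℕ} {x : OChains R V}
    (hx : x ∈ ocDeg R V d) : alexanderWhitney R n (ρ.chain R x) ∈ tensorDeg R (X := X) n d := by
  refine map_mem_of_ocls (f := alexanderWhitney R n ∘ₗ ρ.chain R) (fun g => ?_) hx
  rw [LinearMap.comp_apply, chain_ocls]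
  have h1 : alexanderWhitney R n (scls R (ρ.simp d g)) =
    alexanderWhitneyGen R n ⟨d, ρ.simp d g⟩ := liftChains_cls _ _ _
  rw [h1, alexanderWhitneyGen]
  refine Submodule.sum_mem _ fun p _ => Submodule.subset_span
    ⟨fun i => ⟨(p.1 i.succ : ℕ) - p.1 i.castSucc, _⟩, ?_, rfl⟩
  have h2 : ∀ i : Fin n, (((p.1 i.succ : ℕ) - p.1 i.castSucc : ℕ) : ℤ) =
      ((p.1 i.succ : ℕ) : ℤ) - ((p.1 i.castSucc : ℕ) : ℤ) := fun i =>
    Nat.cast_sub (p.2.1 (Fin.castSucc_lt_succ).le)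
  simp only [h2]
  refine (sum_succ_sub_castSucc n fun i => ((p.1 i : ℕ) : ℤ)).trans ?_
  rw [p.2.2.1, p.2.2.2]
  simp

theorem map_alexanderWhitney (f : C(X, Y)) (n : ℕ) (φ : ℕ → Realization V X) (x : OChains R V) :
    PiTensorProduct.map (fun _ => simpMap R f)
      (alexanderWhitney R n ((pi fun j : Fin n => φ j).chain R x)) =
      alexanderWhitney R n ((pi fun j : Fin n => (φ j).map f).chain R x) := by
  apply toTAlg_injective
  have h : ∀ z : ⨂[R]^n (SChains R X), toTAlg R (PiTensorProduct.map (fun _ => simpMap R f) z) =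
      tlift n (fun _ => TensorAlgebra.ι R ∘ₗ simpMap R f) z := toTAlg_map _
  rw [h, tlift_alexanderWhitney, toTAlg_alexanderWhitney n fun j => (φ j).map f]
  simp only [LinearMap.comp_assoc, simpMap_chain]

/-- AW ∘ EZ = id, in the form of `cup_oprod`, read from right to left: the first p coordinates
depend on the first factor only and the others on the second. -/
theorem alexanderWhitney_mul (p q n : ℕ) (h : p + q = n) (φ : ℕ → Realization V X)
    (ψ : ℕ → Realization W X) (x : OChains R V) (y : OChains R W) :
    proj R n (inc R p (alexanderWhitney R p ((pi fun j : Fin p => φ j).chain R x)) *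
        inc R q (alexanderWhitney R q ((pi fun j : Fin q => ψ j).chain R y))) =
      alexanderWhitney R n ((pi fun j : Fin n => if (j : ℕ) < p then (φ j).comap Prod.fst
        else (ψ (j - p)).comap Prod.snd).chain R (oprod R x y)) := by
  subst h
  apply toTAlg_injective
  refine (toTAlg_proj_mul rfl _ _).trans ?_
  rw [toTAlg_alexanderWhitney, toTAlg_alexanderWhitney,
    toTAlg_alexanderWhitney (p + q) fun j => if j < p then (φ j).comap Prod.fst
        else (ψ (j - p)).comap Prod.snd, ← cup_oprod, cupProd_omap, cupProd_omap, cupProd_add]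
  congr 2
  · refine cupProd_congr _ fun j hj => ?_
    rw [if_pos hj, LinearMap.comp_assoc, chain_omap]
  · refine cupProd_congr _ fun j hj => ?_
    rw [if_neg (by omega), LinearMap.comp_assoc, chain_omap, Nat.add_sub_cancel_left]

theorem toTAlg_simpDiag (ρ : Realization V X) : (toTAlg R ∘ₗ simpDiag R) ∘ₗ ρ.chain R =
    cup (TensorAlgebra.ι R ∘ₗ ρ.chain R) (TensorAlgebra.ι R ∘ₗ ρ.chain R) := by
  refine LinearMap.ext fun x => ?_
  have := toTAlg_alexanderWhitney (R := R) 2 (fun _ => ρ) x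
  rw [cupProd_two] at this
  rw [← this]
  exact congrArg (fun z => toTAlg R (alexanderWhitney R 2 z)) (LinearMap.congr_fun (simpMap_chain R _ ρ) x)

/-- The realizations that correspond to the coface maps. -/
def coface (a b : X) (n : ℕ) (φ : ℕ → Realization V X) (i j : ℕ) : Realization V X :=
  if j < i then if j < n then φ j else const V b else if j = 0 then const V a else φ (j - 1)

theorem ι_comp_const (a : X) : TensorAlgebra.ι R ∘ₗ (const V a).chain R =
    ocst V (TensorAlgebra.ι R (pointChain R a)) := by
  refine LinearMap.ext fun x => ?_
  rw [LinearMap.comp_apply, chain_const, map_smul, ocst_apply]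

/-- The cochain of a constant coordinate is constant, and its cup product on the left is
multiplication by the point; the coface at the other end is symmetric. -/
theorem headCoface_alexanderWhitney (a b : X) (n : ℕ) (φ : ℕ → Realization V X) (x : OChains R V) :
    proj R (n + 1) (inc₁ R (pointChain R a) *
      inc R n (alexanderWhitney R n ((pi fun j : Fin n => φ j).chain R x))) =
      alexanderWhitney R (n + 1) ((pi fun j : Fin (n + 1) => coface a b n φ 0 j).chain R x) := by
  apply toTAlg_injective
  rw [toTAlg_inc₁_mul, toTAlg_alexanderWhitney,
    toTAlg_alexanderWhitney (n + 1) fun j => coface a b n φ 0 j, cupProd]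
  have e : TensorAlgebra.ι R ∘ₗ (coface a b n φ 0 0).chain R =
    ocst V (TensorAlgebra.ι R (pointChain R a)) := ι_comp_const a
  rw [e, cup_ocst_left, LinearMap.comp_apply, LinearMap.mulLeft_apply]
  rfl

theorem tailCoface_alexanderWhitney (a b : X) (n : ℕ) (φ : ℕ → Realization V X) (x : OChains R V) :
    proj R (n + 1) (inc R n (alexanderWhitney R n ((pi fun j : Fin n => φ j).chain R x)) *
      inc₁ R (pointChain R b)) = alexanderWhitney R (n + 1)
        ((pi fun j : Fin (n + 1) => coface a b n φ (n + 1) j).chain R x) := by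
  apply toTAlg_injective
  rw [toTAlg_mul_inc₁, toTAlg_alexanderWhitney,
    toTAlg_alexanderWhitney (n + 1) fun j => coface a b n φ (n + 1) j, cupProd_add, cupProd_one]
  have e : TensorAlgebra.ι R ∘ₗ (coface a b n φ (n + 1) (n + 0)).chain R =
      ocst V (TensorAlgebra.ι R (pointChain R b)) := by
    rw [coface, if_pos (by omega), if_neg (by omega)]
    exact ι_comp_const b
  rw [e, cup_ocst_right, LinearMap.comp_apply, LinearMap.mulRight_apply]
  refine congrArg (· * _) (LinearMap.congr_fun (cupProd_congr _ fun j hj => ?_) x)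
  rw [coface, if_pos (by omega), if_pos hj]

/-- Repeating a coordinate produces the cup square of its cochain, which is the coproduct followed
by multiplication in the tensor algebra. -/
theorem innerCoface_alexanderWhitney (a b : X) {n : ℕ} (φ : ℕ → Realization V X) (x : OChains R V)
    (i : Fin n) : innerCoface R n i
      (alexanderWhitney R n ((pi fun j : Fin n => φ j).chain R x)) = alexanderWhitney R (n + 1)
        ((pi fun j : Fin (n + 1) => coface a b n φ (i + 1) j).chain R x) := by
  apply toTAlg_injective
  rw [toTAlg_innerCoface, tlift_alexanderWhitney,
    toTAlg_alexanderWhitney (n + 1) fun j => coface a b n φ (i + 1) j]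
  refine LinearMap.congr_fun (cupProd_succ_of_cup n i i.isLt _ _ ?_ ?_ ?_) x
  · intro j hj
    rw [if_neg (by omega), coface, if_pos (by omega), if_pos (by omega)]
  · rw [if_pos rfl, toTAlg_simpDiag, coface, coface, if_pos (by omega), if_pos (by omega),
      if_neg (by omega), if_neg (by omega), Nat.add_sub_cancel]
  · intro j hj
    rw [if_neg (by omega), coface, if_neg (by omega), if_neg (by omega), Nat.add_sub_cancel]

theorem cofaceSum_alexanderWhitney (a b : X) (n : ℕ) (φ : ℕ → Realization V X) (x : OChains R V) :
    cofaceSum R a b n (alexanderWhitney R n ((pi fun j : Fin n => φ j).chain R x)) =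
      ∑ i ∈ Finset.range (n + 2), (-1 : R) ^ i •
        alexanderWhitney R (n + 1) ((pi fun j : Fin (n + 1) => coface a b n φ i j).chain R x) := by
  rw [cofaceSum_apply, headCoface_alexanderWhitney a b, tailCoface_alexanderWhitney a b,
    Finset.sum_range_succ, Finset.sum_range_succ', pow_zero, one_smul, Finset.sum_range,
    add_comm (∑ i : Fin n, (-1 : R) ^ ((i : ℕ) + 1) • alexanderWhitney R (n + 1) _)]
  simp only [innerCoface_alexanderWhitney a b]

end Realization

end Realization

end Chen

namespace Chen

/-! ### Cubical chains -/

section CubeChains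

variable {R : Type v} [CommRing R] {X Y Z A B D E F : Type*} [TopologicalSpace X]
  [TopologicalSpace Y] [TopologicalSpace Z] [TopologicalSpace A] [TopologicalSpace B]
  [TopologicalSpace D] [TopologicalSpace E] [TopologicalSpace F]

/-- A property closed under linear combinations may be checked on cubes. -/
theorem cubeChains_induction {p : CubeChains R X → Prop} (hz : p 0)
    (hadd : ∀ x y, p x → p y → p (x + y)) (hsmul : ∀ (r : R) x, p x → p (r • x))
    (hg : ∀ n (c : Cube n X), p (ccls R c)) (x : CubeChains R X) : p x := by
  obtain ⟨x, rfl⟩ := Submodule.mkQ_surjective _ x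
  induction x using Finsupp.induction_linear with
  | zero => rw [map_zero]; exact hz
  | add f g hf hg => rw [map_add]; exact hadd _ _ hf hg
  | single s r =>
    have : Finsupp.single s r = r • Finsupp.single s 1 := by simp
    rw [this, map_smul]
    exact hsmul _ _ (hg _ _)

/-- The value of a cube at the first members of a sequence. -/
def cubeAt {n : ℕ} (c : Cube n X) (y : ℕ → unitInterval) : X := c fun i => y i

theorem cube_ext {n : ℕ} {c c' : Cube n X} (h : ∀ y, cubeAt c y = cubeAt c' y) : c = c' := by
  ext z
  have := h fun i => if h : i < n then z ⟨i, h⟩ else 0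
  simpa [cubeAt] using this

/-- Compares cubes whose dimensions agree only propositionally; values on infinite sequences make a
transport unnecessary. -/
theorem ccls_congr {m n : ℕ} (h : m = n) {c : Cube m X} {c' : Cube n X}
    (H : ∀ y, cubeAt c y = cubeAt c' y) : ccls R c = ccls R c' := by
  subst h
  rw [cube_ext H]

theorem cubeMap_ccls (f : C(X, Y)) {n : ℕ} (c : Cube n X) :
    cubeMap R f (ccls R c) = ccls R (f.comp c : Cube n Y) := liftChains_cls _ _ _

theorem cubeCross_ccls (μ : C(X × Y, Z)) {m n : ℕ} (c : Cube m X) (d : Cube n Y) :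
    cubeCross R μ (ccls R c) (ccls R d) = ccls R (cubeProd μ c d) := by
  rw [cubeCross, liftChains_cls, liftChains_cls]

theorem cubeAt_cubeProd (μ : C(X × Y, Z)) {m n : ℕ} (c : Cube m X) (d : Cube n Y)
    (y : ℕ → unitInterval) :
    cubeAt (cubeProd μ c d) y = μ (cubeAt c y, cubeAt d fun j => y (m + j)) := rfl

theorem cubeMap_cubeMap (f : C(X, Y)) (g : C(Y, Z)) (x : CubeChains R X) :
    cubeMap R g (cubeMap R f x) = cubeMap R (g.comp f) x := by
  induction x using cubeChains_induction with
  | hz => simp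
  | hadd x y hx hy => simp only [map_add, hx, hy]
  | hsmul r x hx => simp only [map_smul, hx]
  | hg n c => rw [cubeMap_ccls, cubeMap_ccls, cubeMap_ccls]; rfl

theorem cubeMap_id (x : CubeChains R X) : cubeMap R (ContinuousMap.id X) x = x := by
  induction x using cubeChains_induction with
  | hz => simp
  | hadd x y hx hy => simp only [map_add, hx, hy]
  | hsmul r x hx => simp only [map_smul, hx]
  | hg n c => rw [cubeMap_ccls]; rfl

/-- A bilinear identity may be checked on cubes. -/
theorem cubeChains_ext₂ {M : Type*} [AddCommGroup M] [Module R M]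
    {f f' : CubeChains R X →ₗ[R] CubeChains R Y →ₗ[R] M}
    (h : ∀ m n (c : Cube m X) (d : Cube n Y), f (ccls R c) (ccls R d) = f' (ccls R c) (ccls R d)) :
    f = f' := chains_ext fun s => chains_ext fun t => h _ _ s.2 t.2

theorem cubeMap_cubeCross (μ : C(X × Y, Z)) (f : C(Z, D)) (x : CubeChains R X) (y : CubeChains R Y) :
    cubeMap R f (cubeCross R μ x y) = cubeCross R (f.comp μ) x y := by
  suffices H : (cubeCross R μ).compr₂ (cubeMap R f) = cubeCross R (f.comp μ) from
    LinearMap.congr_fun₂ H x y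
  refine cubeChains_ext₂ fun m n c d => ?_
  rw [LinearMap.compr₂_apply, cubeCross_ccls, cubeCross_ccls, cubeMap_ccls]
  rfl

theorem cubeCross_cubeMap (μ : C(D × E, Z)) (f : C(X, D)) (g : C(Y, E)) (x : CubeChains R X)
    (y : CubeChains R Y) :
    cubeCross R μ (cubeMap R f x) (cubeMap R g y) = cubeCross R (μ.comp (f.prodMap g)) x y := by
  suffices H : (cubeCross R μ).compl₁₂ (cubeMap R f) (cubeMap R g) =
    cubeCross R (μ.comp (f.prodMap g)) from LinearMap.congr_fun₂ H x y
  refine cubeChains_ext₂ fun m n c d => ?_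
  rw [LinearMap.compl₁₂_apply, cubeCross_ccls, cubeMap_ccls, cubeMap_ccls, cubeCross_ccls]
  rfl

theorem cubeCross_assoc {μ : C(A × B, D)} {μ' : C(D × E, Z)} {ν : C(B × E, F)} {ν' : C(A × F, Z)}
    (h : ∀ a b e, μ' (μ (a, b), e) = ν' (a, ν (b, e))) (x : CubeChains R A) (y : CubeChains R B)
    (z : CubeChains R E) :
    cubeCross R μ' (cubeCross R μ x y) z = cubeCross R ν' x (cubeCross R ν y z) := by
  induction z using cubeChains_induction with
  | hz => simp
  | hadd z z' hz hz' => simp only [map_add, hz, hz']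
  | hsmul r z hz => simp only [map_smul, hz]
  | hg l b =>
    suffices H : (cubeCross R μ).compr₂ ((cubeCross R μ').flip (ccls R b)) =
      (cubeCross R ν').compl₂ ((cubeCross R ν).flip (ccls R b)) from LinearMap.congr_fun₂ H x y
    refine cubeChains_ext₂ fun m n c d => ?_
    rw [LinearMap.compr₂_apply, LinearMap.compl₂_apply, LinearMap.flip_apply, LinearMap.flip_apply,
      cubeCross_ccls, cubeCross_ccls, cubeCross_ccls, cubeCross_ccls]
    refine ccls_congr (Nat.add_assoc _ _ _) fun y => ?_
    simp only [cubeAt_cubeProd, h, Nat.add_assoc]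

theorem cubeCross_point (μ : C(X × Y, Z)) (a : X) (y : CubeChains R Y) :
    cubeCross R μ (ccls R (n := 0) (ContinuousMap.const _ a)) y =
      cubeMap R (μ.comp ⟨fun b => (a, b), by fun_prop⟩) y := by
  induction y using cubeChains_induction with
  | hz => simp
  | hadd z z' hz hz' => simp only [map_add, hz, hz']
  | hsmul r z hz => simp only [map_smul, hz]
  | hg l b =>
    rw [cubeCross_ccls, cubeMap_ccls]
    refine ccls_congr (Nat.zero_add _) fun y => ?_
    simp only [cubeAt_cubeProd, Nat.zero_add]
    rfl

/-! #### Degrees and the boundary -/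

variable (R) in
/-- The sign involution of cubical chains. -/
def cubePar : CubeChains R X →ₗ[R] CubeChains R X :=
  liftChains (fun s => (-1 : R) ^ s.1 • cls R _ s)
    (fun s hs => by rw [cls_eq_zero hs, smul_zero])

theorem cubePar_ccls {n : ℕ} (c : Cube n X) : cubePar R (ccls R c) = (-1 : R) ^ n • ccls R c :=
  liftChains_cls _ _ _

theorem cubePar_cubeMap (f : C(X, Y)) (x : CubeChains R X) :
    cubePar R (cubeMap R f x) = cubeMap R f (cubePar R x) := by
  induction x using cubeChains_induction with
  | hz => simp
  | hadd z z' hz hz' => simp only [map_add, hz, hz']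
  | hsmul r z hz => simp only [map_smul, hz]
  | hg l b => rw [cubePar_ccls, map_smul, cubeMap_ccls, cubePar_ccls]

/-- The sequence with `e` inserted at the place number `i`. -/
def insI (i : ℕ) (e : unitInterval) (y : ℕ → unitInterval) : ℕ → unitInterval :=
  fun j => if j < i then y j else if j = i then e else y (j - 1)

/-- The face of a cube, without a condition on the dimension. -/
def faceSeq {n : ℕ} (c : Cube n X) (i : ℕ) (e : unitInterval) : Cube (n - 1) X :=
  c.comp ⟨fun x j => insI i e (fun l => if h : l < n - 1 then x ⟨l, h⟩ else 0) j, by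
    refine continuous_pi fun j => ?_
    simp only [insI]
    split_ifs <;> fun_prop⟩

theorem cubeAt_faceSeq {n : ℕ} (c : Cube n X) {i : ℕ} (hi : i < n) (e : unitInterval)
    (y : ℕ → unitInterval) : cubeAt (faceSeq c i e) y = cubeAt c (insI i e y) := by
  refine congrArg c (funext fun j => ?_)
  have := j.isLt
  change insI i e (fun l => if h : l < n - 1 then y l else 0) j = insI i e y j
  rcases lt_trichotomy (j : ℕ) i with h | h | h
  · rw [insI, insI, if_pos h, if_pos h]
    exact dif_pos (by omega)
  · rw [insI, insI, if_neg (by omega), if_pos h, if_neg (by omega), if_pos h]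
  · rw [insI, insI, if_neg (by omega), if_neg (by omega), if_neg (by omega), if_neg (by omega)]
    exact dif_pos (by omega)

theorem cubeBoundary_ccls {n : ℕ} (c : Cube n X) : cubeBoundary R (ccls R c) =
    ∑ i ∈ Finset.range n, (-1 : R) ^ i • (ccls R (faceSeq c i 0) - ccls R (faceSeq c i 1)) := by
  refine (liftChains_cls _ _ _).trans ?_
  cases n with
  | zero => rfl
  | succ n =>
    rw [Finset.sum_range]
    refine Finset.sum_congr rfl fun i _ => ?_
    have : ∀ e, cubeFace i e c = faceSeq c i e := by
      intro e
      refine cube_ext fun y => ?_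
      rw [cubeAt_faceSeq c i.isLt]
      refine congrArg c (funext fun j => ?_)
      change Fin.insertNth (α := fun _ => unitInterval) i e (fun l : Fin n => y l) j = insI i e y j
      induction j using Fin.succAboveCases i with
      | x => simp [insI]
      | p j =>
        rw [Fin.insertNth_apply_succAbove, insI, val_succAbove]
        split_ifs <;> first | rfl | omega
    rw [this, this]
    rfl

/-- The faces in the first m directions belong to the first cube. Those in the last n directions
belong to the second and carry the extra sign (-1)^m. -/
theorem cubeBoundary_cubeCross (μ : C(X × Y, Z)) (x : CubeChains R X) (y : CubeChains R Y) :
    cubeBoundary R (cubeCross R μ x y) =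
      cubeCross R μ (cubeBoundary R x) y + cubeCross R μ (cubePar R x) (cubeBoundary R y) := by
  suffices H : (cubeCross R μ).compr₂ (cubeBoundary R) =
      (cubeCross R μ).comp (cubeBoundary R) + (cubeCross R μ).compl₁₂ (cubePar R) (cubeBoundary R) from
    LinearMap.congr_fun₂ H x y
  refine cubeChains_ext₂ fun m n c d => ?_
  rw [LinearMap.compr₂_apply, LinearMap.add_apply, LinearMap.add_apply, LinearMap.comp_apply,
    LinearMap.compl₁₂_apply, cubeCross_ccls, cubeBoundary_ccls, cubeBoundary_ccls, cubeBoundary_ccls,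
    Finset.sum_range_add, cubePar_ccls, map_sum, map_sum, LinearMap.sum_apply]
  refine congrArg₂ (· + ·) (Finset.sum_congr rfl fun i hi => ?_) (Finset.sum_congr rfl fun i hi => ?_)
  · have hi := Finset.mem_range.1 hi
    have : ∀ e, ccls R (faceSeq (cubeProd μ c d) i e) = ccls R (cubeProd μ (faceSeq c i e) d) := by
      refine fun e => ccls_congr (by omega) fun y => ?_
      rw [cubeAt_faceSeq _ (by omega), cubeAt_cubeProd, cubeAt_cubeProd, cubeAt_faceSeq _ hi]
      have e : (fun j => insI i e y (m + j)) = fun j => y (m - 1 + j) := funext fun j => ?_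
      · rw [e]
      rw [insI, if_neg (by omega), if_neg (by omega)]
      congr 1
      omega
    rw [this, this, map_smul, LinearMap.smul_apply, map_sub, LinearMap.sub_apply, cubeCross_ccls,
      cubeCross_ccls]
  · have hi := Finset.mem_range.1 hi
    have : ∀ e, ccls R (faceSeq (cubeProd μ c d) (m + i) e) =
        ccls R (cubeProd μ c (faceSeq d i e)) := by
      refine fun e => ccls_congr (by omega) fun y => ?_
      rw [cubeAt_faceSeq _ (by omega), cubeAt_cubeProd, cubeAt_cubeProd, cubeAt_faceSeq _ hi]
      have e₁ : cubeAt c (insI (m + i) e y) = cubeAt c y :=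
        congrArg c (funext fun j => if_pos (by omega))
      have e₂ : (fun j => insI (m + i) e y (m + j)) = insI i e fun j => y (m + j) :=
        funext fun j => ?_
      · rw [e₁, e₂]
      simp only [insI]
      split_ifs <;> first | rfl | omega | (congr 1; omega)
    rw [this, this, map_smul, map_smul, map_sub, LinearMap.smul_apply, LinearMap.smul_apply,
      cubeCross_ccls, cubeCross_ccls, pow_add, mul_smul, smul_comm, smul_sub]

theorem cubeBoundary_cubeMap (f : C(X, Y)) (x : CubeChains R X) :
    cubeBoundary R (cubeMap R f x) = cubeMap R f (cubeBoundary R x) := by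
  induction x using cubeChains_induction with
  | hz => simp
  | hadd z z' hz hz' => simp only [map_add, hz, hz']
  | hsmul r z hz => simp only [map_smul, hz]
  | hg l b =>
    rw [cubeMap_ccls, cubeBoundary_ccls, cubeBoundary_ccls, map_sum]
    refine Finset.sum_congr rfl fun i _ => ?_
    rw [map_smul, map_sub, cubeMap_ccls, cubeMap_ccls]
    rfl

theorem cubePar_cubeBoundary (x : CubeChains R X) :
    cubePar R (cubeBoundary R x) = -cubeBoundary R (cubePar R x) := by
  induction x using cubeChains_induction with
  | hz => simp
  | hadd z z' hz hz' => simp only [map_add, hz, hz', neg_add]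
  | hsmul r z hz => simp only [map_smul, hz, smul_neg]
  | hg l b =>
    rw [cubePar_ccls, map_smul, cubeBoundary_ccls, map_sum, Finset.smul_sum, ← Finset.sum_neg_distrib]
    refine Finset.sum_congr rfl fun i hi => ?_
    have hi := Finset.mem_range.1 hi
    obtain ⟨l, rfl⟩ : ∃ k, l = k + 1 := ⟨l - 1, by omega⟩
    rw [map_smul, map_sub, cubePar_ccls, cubePar_ccls, pow_succ]
    change _ • ((-1 : R) ^ l • _ - (-1 : R) ^ l • _) = _
    module

theorem negOnePow_smul {M : Type*} [AddCommGroup M] [Module R M] (n : ℕ) (x : M) :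
    (n : ℤ).negOnePow • x = (-1 : R) ^ n • x := by
  induction n with
  | zero => simp
  | succ n ih =>
    rw [Nat.cast_succ, Int.negOnePow_succ, pow_succ, Units.smul_def, Units.val_neg, neg_smul,
      ← Units.smul_def, ih, mul_neg_one, neg_smul]

theorem cubePar_of_mem {k : ℤ} {x : CubeChains R X} (hx : x ∈ cubeDeg R k) :
    cubePar R x = k.negOnePow • x := by
  have : cubeDeg R k ≤ LinearMap.eqLocus (cubePar R (X := X))
      (k.negOnePow • (LinearMap.id : CubeChains R X →ₗ[R] CubeChains R X)) := by
    refine Submodule.span_le.2 ?_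
    rintro _ ⟨n, c, rfl, rfl⟩
    change cubePar R (ccls R c) = (n : ℤ).negOnePow • ccls R c
    rw [cubePar_ccls, negOnePow_smul (R := R)]
  exact this hx

theorem cubeCross_mem (μ : C(X × Y, Z)) {k l : ℤ} {x : CubeChains R X} {y : CubeChains R Y}
    (hx : x ∈ cubeDeg R k) (hy : y ∈ cubeDeg R l) : cubeCross R μ x y ∈ cubeDeg R (k + l) := by
  have h1 : ∀ (m : ℕ) (c : Cube m X), (m : ℤ) = k → cubeCross R μ (ccls R c) y ∈ cubeDeg R (k + l) := by
    intro m c hm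
    have : cubeDeg R l ≤ (cubeDeg R (k + l)).comap (cubeCross R μ (ccls R c)) := by
      refine Submodule.span_le.2 ?_
      rintro _ ⟨n, d, hn, rfl⟩
      refine Submodule.subset_span ⟨m + n, cubeProd μ c d, ?_, cubeCross_ccls μ c d⟩
      rw [Nat.cast_add, hm, hn]
    exact this hy
  have : cubeDeg R k ≤ (cubeDeg R (k + l)).comap ((cubeCross R μ).flip y) := by
    refine Submodule.span_le.2 ?_
    rintro _ ⟨n, d, hn, rfl⟩
    exact h1 n d hn
  exact this hx

theorem cubeMap_mem (f : C(X, Y)) {k : ℤ} {x : CubeChains R X} (hx : x ∈ cubeDeg R k) :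
    cubeMap R f x ∈ cubeDeg R k := by
  have : cubeDeg R k ≤ (cubeDeg R k).comap (cubeMap R f) := by
    refine Submodule.span_le.2 ?_
    rintro _ ⟨n, d, hn, rfl⟩
    exact Submodule.subset_span ⟨n, f.comp d, hn, cubeMap_ccls f d⟩
  exact this hx

end CubeChains

end Chen

namespace Chen

/-! ### Products of several chains of Moore paths -/

section PathSeq

variable {X : Type u} [TopologicalSpace X] {Y : Type u} [TopologicalSpace Y]

/-- Paths with a sequence of lengths. -/
abbrev PathSeq (X : Type u) [TopologicalSpace X] : Type u := C(ℝ≥0, X) × (ℕ → ℝ≥0)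

/-- Paths that start at `a`, with a sequence of lengths. -/
abbrev PathsFrom (a : X) : Type u := {u : PathSeq X // u.1 0 = a}

/-- Paths that start at `a` and arrive at `c` after the sum of the first `N` lengths. -/
abbrev PathsFromTo (N : ℕ) (a c : X) : Type u :=
  {u : PathSeq X // u.1 0 = a ∧ u.1 (∑ i ∈ Finset.range N, u.2 i) = c}

/-- The path that runs along `f` until the time `L` and then along `g`. -/
def glueFun (f g : C(ℝ≥0, X)) (L t : ℝ≥0) : X := if t ≤ L then f t else g (t - L)

theorem glueFun_zero (f g : C(ℝ≥0, X)) (L : ℝ≥0) : glueFun f g L 0 = f 0 := if_pos zero_le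

theorem glueFun_add {f g : C(ℝ≥0, X)} {L : ℝ≥0} (h : f L = g 0) (t : ℝ≥0) :
    glueFun f g L (L + t) = g t := by
  rw [glueFun]
  split_ifs with ht
  · obtain rfl : t = 0 := by simpa using ht
    rw [add_zero, h]
  · rw [add_tsub_cancel_left]

theorem continuous_glueFun {Z : Type*} [TopologicalSpace Z] {f g : Z → C(ℝ≥0, X)} {L : Z → ℝ≥0}
    (hf : Continuous f) (hg : Continuous g) (hL : Continuous L) (h : ∀ z, f z (L z) = g z 0) :
    Continuous fun q : Z × ℝ≥0 => glueFun (f q.1) (g q.1) (L q.1) q.2 := by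
  refine Continuous.if_le ?_ ?_ (by fun_prop) (by fun_prop) ?_
  · fun_prop
  · fun_prop
  · rintro ⟨z, t⟩ ht
    dsimp only at ht ⊢
    rw [ht, tsub_self, h]

/-- The path that runs along `f` until the time `L` and then along `g`. -/
def glue (f g : C(ℝ≥0, X)) (L : ℝ≥0) (h : f L = g 0) : C(ℝ≥0, X) :=
  ⟨glueFun f g L, (continuous_glueFun (Z := Unit) (f := fun _ => f) (g := fun _ => g)
    (L := fun _ => L) continuous_const continuous_const continuous_const fun _ => h).comp
      (by fun_prop : Continuous fun t => ((), t))⟩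

theorem continuous_glue {Z : Type*} [TopologicalSpace Z] {f g : Z → C(ℝ≥0, X)} {L : Z → ℝ≥0}
    (hf : Continuous f) (hg : Continuous g) (hL : Continuous L) (h : ∀ z, f z (L z) = g z 0) :
    Continuous fun z => glue (f z) (g z) (L z) (h z) :=
  ContinuousMap.continuous_of_continuous_uncurry _ (continuous_glueFun hf hg hL h)

/-- The sequence with `T` in front. -/
def seqCons (T : ℝ≥0) (T' : ℕ → ℝ≥0) : ℕ → ℝ≥0
  | 0 => T
  | i + 1 => T' i

/-- The first `n` members of a sequence followed by another sequence. -/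
def seqJoin (n : ℕ) (T T' : ℕ → ℝ≥0) : ℕ → ℝ≥0 := fun r => if r < n then T r else T' (r - n)

/-- The sequence with the members number `p` and `p + 1` replaced by the sum. -/
def seqMerge (p : ℕ) (T : ℕ → ℝ≥0) : ℕ → ℝ≥0 :=
  fun r => if r < p then T r else if r = p then T p + T (p + 1) else T (r + 1)

theorem sum_seqCons (N : ℕ) (T : ℝ≥0) (T' : ℕ → ℝ≥0) :
    ∑ i ∈ Finset.range (N + 1), seqCons T T' i = T + ∑ i ∈ Finset.range N, T' i := by
  rw [Finset.sum_range_succ', add_comm]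
  rfl

/-- Concatenation of a Moore path with a path that has a sequence of lengths. -/
def consPath (a b : X) : C(MoorePath a b × PathsFrom b, PathsFrom a) where
  toFun p := ⟨(glue p.1.1.1 p.2.1.1 p.1.1.2 ((p.1.2.2 _ le_rfl).trans p.2.2.symm),
    seqCons p.1.1.2 p.2.1.2), (glueFun_zero _ _ _).trans p.1.2.1⟩
  continuous_toFun := by
    refine Continuous.subtype_mk (Continuous.prodMk ?_ (continuous_pi fun i => ?_)) _
    · exact continuous_glue (by fun_prop) (by fun_prop) (by fun_prop) _
    · cases i
      · exact (by fun_prop : Continuous fun p : MoorePath a b × PathsFrom b => p.1.1.2)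
      · exact (continuous_apply _).comp (by fun_prop)

/-- Concatenation of a Moore path with a path that has a sequence of lengths and a given end. -/
def consPathTo (N : ℕ) (a b c : X) : C(MoorePath a b × PathsFromTo N b c, PathsFromTo (N + 1) a c) where
  toFun p := ⟨(glue p.1.1.1 p.2.1.1 p.1.1.2 ((p.1.2.2 _ le_rfl).trans p.2.2.1.symm),
    seqCons p.1.1.2 p.2.1.2), (glueFun_zero _ _ _).trans p.1.2.1, by
      dsimp only
      rw [sum_seqCons]
      exact (glueFun_add ((p.1.2.2 _ le_rfl).trans p.2.2.1.symm) _).trans p.2.2.2⟩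
  continuous_toFun := by
    refine Continuous.subtype_mk (Continuous.prodMk ?_ (continuous_pi fun i => ?_)) _
    · exact continuous_glue (by fun_prop) (by fun_prop) (by fun_prop) _
    · cases i
      · exact (by fun_prop : Continuous fun p : MoorePath a b × PathsFromTo N b c => p.1.1.2)
      · exact (continuous_apply _).comp (by fun_prop)

/-- Concatenation of two paths with sequences of lengths. -/
def joinPath (n : ℕ) (a b : X) : C(PathsFromTo n a b × PathsFrom b, PathsFrom a) where
  toFun p := ⟨(glue p.1.1.1 p.2.1.1 (∑ i ∈ Finset.range n, p.1.1.2 i) (p.1.2.2.trans p.2.2.symm),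
    seqJoin n p.1.1.2 p.2.1.2), (glueFun_zero _ _ _).trans p.1.2.1⟩
  continuous_toFun := by
    refine Continuous.subtype_mk (Continuous.prodMk ?_ (continuous_pi fun i => ?_)) _
    · exact continuous_glue (by fun_prop) (by fun_prop) (by fun_prop) _
    · simp only [seqJoin]
      split_ifs
      · exact (continuous_apply _).comp (by fun_prop)
      · exact (continuous_apply _).comp (by fun_prop)

/-- The addition of two adjacent lengths. -/
def mergePath (p : ℕ) (a : X) : C(PathsFrom a, PathsFrom a) where
  toFun u := ⟨(u.1.1, seqMerge p u.1.2), u.2⟩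
  continuous_toFun := by
    refine Continuous.subtype_mk (Continuous.prodMk (by fun_prop) (continuous_pi fun i => ?_)) _
    simp only [seqMerge]
    have h : ∀ i, Continuous fun u : PathsFrom a => u.1.2 i := fun i =>
      (continuous_apply i).comp (by fun_prop)
    have := h p
    have := h (p + 1)
    split_ifs
    · exact h _
    · fun_prop
    · exact h _

/-- The inclusion that forgets the end. -/
def forgetEnd (N : ℕ) (a c : X) : C(PathsFromTo N a c, PathsFrom a) where
  toFun u := ⟨u.1, u.2.1⟩
  continuous_toFun := by fun_prop

/-- The inclusion that forgets the start. -/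
def forgetStart (a : X) : C(PathsFrom a, PathSeq X) where
  toFun u := u.1
  continuous_toFun := by fun_prop

/-- The map induced by a continuous map. -/
def pathsMap (f : C(X, Y)) (N : ℕ) (a c : X) : C(PathsFromTo N a c, PathsFromTo N (f a) (f c)) where
  toFun u := ⟨(f.comp u.1.1, u.1.2), congrArg f u.2.1, congrArg f u.2.2⟩
  continuous_toFun := by
    refine Continuous.subtype_mk (Continuous.prodMk ?_ (by fun_prop)) _
    exact (ContinuousMap.continuous_postcomp f).comp (by fun_prop)

/-- The constant path. -/
def constPath (a : X) : PathsFromTo 0 a a := ⟨(ContinuousMap.const _ a, 0), rfl, rfl⟩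

theorem pathSeq_ext {u v : PathSeq X} (h1 : ∀ t, u.1 t = v.1 t) (h2 : ∀ i, u.2 i = v.2 i) : u = v :=
  Prod.ext (ContinuousMap.ext h1) (funext h2)

theorem glueFun_glue {f g h : C(ℝ≥0, X)} {L L' : ℝ≥0} (e : f L = g 0) (e' : g L' = h 0) (t : ℝ≥0) :
    glueFun (glue f g L e) h (L + L') t = glueFun f (glue g h L' e') L t := by
  change (if t ≤ L + L' then (if t ≤ L then f t else g (t - L)) else h (t - (L + L'))) =
    if t ≤ L then f t else if t - L ≤ L' then g (t - L) else h (t - L - L')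
  by_cases h1 : t ≤ L
  · rw [if_pos h1, if_pos h1, if_pos (h1.trans (le_add_of_nonneg_right zero_le))]
  · rw [if_neg h1, if_neg h1, tsub_tsub]
    exact if_congr (by rw [tsub_le_iff_left]) rfl rfl

/-- Moore concatenation is strictly associative. The underlying paths coincide, and only the record
of lengths differs: two entries are replaced by their sum. -/
theorem consPath_concat (a b c : X) (p : MoorePath a b) (q : MoorePath b c) (u : PathsFrom c) :
    consPath a c (concat a b c (p, q), u) =
      mergePath 0 a (consPath a b (p, consPath b c (q, u))) := by
  refine Subtype.ext (pathSeq_ext (fun t => ?_) fun i => ?_)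
  · exact glueFun_glue ((p.2.2 _ le_rfl).trans q.2.1.symm) ((q.2.2 _ le_rfl).trans u.2.symm) t
  · rcases i with _ | i <;> rfl

theorem mergePath_consPath (p : ℕ) (a b : X) (q : MoorePath a b) (u : PathsFrom b) :
    consPath a b (q, mergePath p b u) = mergePath (p + 1) a (consPath a b (q, u)) := by
  refine Subtype.ext (pathSeq_ext (fun t => rfl) fun i => ?_)
  rcases i with _ | i
  · rfl
  · change seqMerge p u.1.2 i = seqMerge (p + 1) (seqCons q.1.2 u.1.2) (i + 1)
    simp only [seqMerge, Nat.add_lt_add_iff_right, Nat.add_right_cancel_iff]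
    rfl

theorem joinPath_consPathTo (n : ℕ) (a b c : X) (q : MoorePath a b) (u : PathsFromTo n b c)
    (v : PathsFrom c) : joinPath (n + 1) a c (consPathTo n a b c (q, u), v) =
      consPath a b (q, joinPath n b c (u, v)) := by
  refine Subtype.ext (pathSeq_ext (fun t => ?_) fun i => ?_)
  · have e := (q.2.2 _ le_rfl).trans u.2.1.symm
    refine Eq.trans ?_ (glueFun_glue e (u.2.2.trans v.2.symm) t)
    change glueFun _ _ (∑ i ∈ Finset.range (n + 1), seqCons q.1.2 u.1.2 i) t = _
    rw [sum_seqCons]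
    rfl
  · rcases i with _ | i
    · rfl
    · change seqJoin (n + 1) (seqCons q.1.2 u.1.2) v.1.2 (i + 1) = seqJoin n u.1.2 v.1.2 i
      simp only [seqJoin, Nat.add_lt_add_iff_right, Nat.add_sub_add_right]
      rfl

theorem joinPath_constPath (a : X) (v : PathsFrom a) : joinPath 0 a a (constPath a, v) = v := by
  refine Subtype.ext (pathSeq_ext (fun t => ?_) fun i => rfl)
  have := glueFun_add (f := (constPath a).1.1) (g := v.1.1) (L := 0) v.2.symm t
  rwa [zero_add] at this

end PathSeq

/-! ### Products of composable chains: boundary, contraction and splitting -/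

section PathChains

variable (R : Type v) [CommRing R] {X : Type u} [TopologicalSpace X] {Y : Type u}
  [TopologicalSpace Y]

/-- The product of finitely many composable chains of Moore paths. -/
def pathProd : ∀ (n : ℕ) (a : Fin (n + 1) → X),
    MultilinearMap R (fun i : Fin n => CubeChains R (MoorePath (a i.castSucc) (a i.succ)))
      (CubeChains R (PathsFromTo n (a 0) (a (Fin.last n))))
  | 0, a => MultilinearMap.constOfIsEmpty R _ (ccls R (n := 0) (ContinuousMap.const _ (constPath (a 0))))
  | n + 1, a => LinearMap.uncurryLeft
      { toFun := fun y => (cubeCross R (consPathTo n (a 0) (a 1) (a (Fin.last (n + 1)))) y).compMultilinearMap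
          (pathProd n fun i => a i.succ)
        map_add' := fun y y' => by
          exact MultilinearMap.ext fun z => LinearMap.congr_fun
            (LinearMap.map_add (cubeCross R (consPathTo n (a 0) (a 1) (a (Fin.last (n + 1))))) y y') _
        map_smul' := fun r y => by
          exact MultilinearMap.ext fun z => LinearMap.congr_fun
            (LinearMap.map_smul (cubeCross R (consPathTo n (a 0) (a 1) (a (Fin.last (n + 1))))) r y) _ }

/-- The product of the first `n` members of a sequence of composable chains. -/
def pathEv (n : ℕ) (a : ℕ → X) (x : ∀ i, CubeChains R (MoorePath (a i) (a (i + 1)))) :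
    CubeChains R (PathsFromTo n (a 0) (a n)) :=
  pathProd R n (fun i => a i) fun i => x i

theorem pathEv_zero (a : ℕ → X) (x : ∀ i, CubeChains R (MoorePath (a i) (a (i + 1)))) :
    pathEv R 0 a x = ccls R (n := 0) (ContinuousMap.const _ (constPath (a 0))) := rfl

theorem pathEv_succ (n : ℕ) (a : ℕ → X) (x : ∀ i, CubeChains R (MoorePath (a i) (a (i + 1)))) :
    pathEv R (n + 1) a x = cubeCross R (consPathTo n (a 0) (a 1) (a (n + 1))) (x 0)
      (pathEv R n (fun i => a (i + 1)) fun i => x (i + 1)) := rfl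

/-- The product of the first `n` members, as a chain of paths with a free end. -/
def pathFrom (n : ℕ) (a : ℕ → X) (x : ∀ i, CubeChains R (MoorePath (a i) (a (i + 1)))) :
    CubeChains R (PathsFrom (a 0)) :=
  cubeMap R (forgetEnd n (a 0) (a n)) (pathEv R n a x)

theorem pathFrom_succ (n : ℕ) (a : ℕ → X) (x : ∀ i, CubeChains R (MoorePath (a i) (a (i + 1)))) :
    pathFrom R (n + 1) a x = cubeCross R (consPath (a 0) (a 1)) (x 0)
      (pathFrom R n (fun i => a (i + 1)) fun i => x (i + 1)) := by
  rw [pathFrom, pathEv_succ, cubeMap_cubeCross, pathFrom]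
  have := cubeCross_cubeMap (consPath (a 0) (a 1)) (ContinuousMap.id _)
    (forgetEnd n (a 1) (a (n + 1))) (x 0) (pathEv R n (fun i => a (i + 1)) fun i => x (i + 1))
  rw [cubeMap_id] at this
  exact this.symm

theorem pathProd_mem : ∀ (n : ℕ) (a : Fin (n + 1) → X)
    (x : ∀ i : Fin n, CubeChains R (MoorePath (a i.castSucc) (a i.succ))) (k : Fin n → ℤ),
    (∀ i, x i ∈ cubeDeg R (k i)) → pathProd R n a x ∈ cubeDeg R (∑ i, k i)
  | 0, a, x, k, _ => Submodule.subset_span ⟨0, _, by simp, rfl⟩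
  | n + 1, a, x, k, h => by
    rw [Fin.sum_univ_succ]
    have ih := pathProd_mem n (fun i => a i.succ) (fun i => x i.succ) (fun i => k i.succ) fun i =>
      h i.succ
    change cubeCross R (consPathTo n (a 0) (a 1) (a (Fin.last (n + 1)))) (x 0)
      (pathProd R n (fun i => a i.succ) fun i => x i.succ) ∈ _
    exact cubeCross_mem (R := R) (consPathTo n (a 0) (a 1) (a (Fin.last (n + 1)))) (h 0) ih

theorem cubeCross_pathsMap (f : C(X, Y)) (n : ℕ) (a b c : X) (x : CubeChains R (MoorePath a b))
    (z : CubeChains R (PathsFromTo n b c)) :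
    cubeCross R (consPathTo n (f a) (f b) (f c)) (cubeMap R (pathMap f a b) x)
      (cubeMap R (pathsMap f n b c) z) =
      cubeMap R (pathsMap f (n + 1) a c) (cubeCross R (consPathTo n a b c) x z) := by
  rw [cubeMap_cubeCross, cubeCross_cubeMap]
  refine congrArg (fun μ => cubeCross R μ x z)
    (ContinuousMap.ext fun q => Subtype.ext (pathSeq_ext (fun t => ?_) fun i => ?_))
  · exact (apply_ite f (t ≤ q.1.1.2) (q.1.1.1 t) (q.2.1.1 (t - q.1.1.2))).symm
  · cases i <;> rfl

theorem cubeCross_concat (a b c : X) (x : CubeChains R (MoorePath a b))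
    (y : CubeChains R (MoorePath b c)) (z : CubeChains R (PathsFrom c)) :
    cubeCross R (consPath a c) (cubeCross R (concat a b c) x y) z =
      cubeMap R (mergePath 0 a) (cubeCross R (consPath a b) x (cubeCross R (consPath b c) y z)) := by
  rw [cubeMap_cubeCross]
  exact cubeCross_assoc (fun p q u => consPath_concat _ _ _ p q u) x y z

theorem cubeCross_mergePath (p : ℕ) (a b : X) (x : CubeChains R (MoorePath a b))
    (z : CubeChains R (PathsFrom b)) :
    cubeCross R (consPath a b) x (cubeMap R (mergePath p b) z) =
      cubeMap R (mergePath (p + 1) a) (cubeCross R (consPath a b) x z) := by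
  have := cubeCross_cubeMap (consPath a b) (ContinuousMap.id _) (mergePath p b) x z
  rw [cubeMap_id] at this
  rw [cubeMap_cubeCross, this]
  exact congrArg (fun μ => cubeCross R μ x z)
    (ContinuousMap.ext fun q => mergePath_consPath p a b q.1 q.2)

theorem cubeMap_pathProd (f : C(X, Y)) : ∀ (n : ℕ) (a : Fin (n + 1) → X)
    (x : ∀ i : Fin n, CubeChains R (MoorePath (a i.castSucc) (a i.succ))),
    pathProd R n (fun i => f (a i))
      (fun i => cubeMap R (pathMap f (a i.castSucc) (a i.succ)) (x i)) =
      cubeMap R (pathsMap f n (a 0) (a (Fin.last n))) (pathProd R n a x)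
  | 0, a, x => by
    refine Eq.trans ?_ (cubeMap_ccls (R := R) (pathsMap f 0 (a 0) (a 0)) (n := 0) (ContinuousMap.const _ (constPath (a 0)))).symm
    rfl
  | n + 1, a, x => by
    have ih := cubeMap_pathProd f n (fun i => a i.succ) fun i => x i.succ
    change cubeCross R (consPathTo n (f (a 0)) (f (a 1)) (f (a (Fin.last (n + 1)))))
      (cubeMap R (pathMap f (a 0) (a 1)) (x 0)) (pathProd R n (fun i => f (a i.succ)) _) =
      cubeMap R _ (cubeCross R (consPathTo n (a 0) (a 1) (a (Fin.last (n + 1)))) (x 0)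
        (pathProd R n (fun i => a i.succ) fun i => x i.succ))
    refine (congrArg _ ih).trans ?_
    exact cubeCross_pathsMap R f n (a 0) (a 1) (a (Fin.last (n + 1))) (x 0) _

theorem cubeBoundary_pathFrom : ∀ (n : ℕ) (a : ℕ → X)
    (x : ∀ i, CubeChains R (MoorePath (a i) (a (i + 1)))) (k : ℕ → ℤ),
    (∀ i, x i ∈ cubeDeg R (k i)) → cubeBoundary R (pathFrom R n a x) =
      ∑ p ∈ Finset.range n, (∑ j ∈ Finset.range p, k j).negOnePow •
        pathFrom R n a (Function.update x p (cubeBoundary R (x p)))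
  | 0, a, x, k, _ => by
    rw [pathFrom, pathEv_zero, cubeMap_ccls]
    exact liftChains_cls _ _ _
  | n + 1, a, x, k, h => by
    have ih := cubeBoundary_pathFrom n (fun i => a (i + 1)) (fun i => x (i + 1)) (fun i => k (i + 1))
      fun i => h (i + 1)
    have e : ∀ p, pathFrom R (n + 1) a (Function.update x (p + 1) (cubeBoundary R (x (p + 1)))) =
      cubeCross R (consPath (a 0) (a 1)) (x 0) (pathFrom R n (fun i => a (i + 1))
        (Function.update (fun i => x (i + 1)) p (cubeBoundary R (x (p + 1))))) := by
      intro p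
      rw [pathFrom_succ, Function.update_of_ne (Nat.succ_ne_zero p).symm]
      congr 2
      funext i
      by_cases hi : i = p
      · subst hi
        rw [Function.update_self, Function.update_self]
      · rw [Function.update_of_ne hi, Function.update_of_ne (by omega)]
    rw [pathFrom_succ, cubeBoundary_cubeCross, ih, cubePar_of_mem (h 0), Finset.sum_range_succ',
      map_sum, add_comm]
    congr 1
    · refine Finset.sum_congr rfl fun p _ => ?_
      rw [e, Finset.sum_range_succ', Int.negOnePow_add, Units.smul_def, Units.smul_def, Units.smul_def,
        map_zsmul, map_zsmul, LinearMap.smul_apply, Units.val_mul, mul_smul]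
    · rw [Finset.range_zero, Finset.sum_empty, Int.negOnePow_zero, one_smul, pathFrom_succ,
        Function.update_self]
      rfl

/-- Peeling off leading factors reduces to p = 0, which is `consPath_concat`. Leaving the end of the
paths free avoids a transport between the end points of the two sequences of objects. -/
theorem pathFrom_contract : ∀ (p n : ℕ) (_ : p < n) (a : ℕ → X)
    (x : ∀ i, CubeChains R (MoorePath (a i) (a (i + 1)))),
    pathFrom R n (contractObj a p) (contractHom (pathCubes R X) a x p) =
      cubeMap R (mergePath p (a 0)) (pathFrom R (n + 1) a x)
  | 0, n + 1, _, a, x => by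
    refine (pathFrom_succ R n _ _).trans ?_
    exact (cubeCross_concat R (a 0) (a 1) (a 2) (x 0) (x 1) _).trans
      (congrArg (cubeMap R (mergePath 0 (a 0))) ((pathFrom_succ R (n + 1) a x).trans
      (congrArg (cubeCross R (consPath (a 0) (a 1)) (x 0))
        (pathFrom_succ R n (fun i => a (i + 1)) fun i => x (i + 1)))).symm)
  | p + 1, n + 1, h, a, x => by
    have ih := pathFrom_contract p n (by omega) (fun i => a (i + 1)) fun i => x (i + 1)
    refine (pathFrom_succ R n _ _).trans ?_
    exact (congrArg (cubeCross R (consPath (a 0) (a 1)) (x 0)) ih).trans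
      ((cubeCross_mergePath R p (a 0) (a 1) (x 0) _).trans
        (congrArg (cubeMap R (mergePath (p + 1) (a 0))) (pathFrom_succ R (n + 1) a x).symm))

/-- Serves for sequences reindexed by arithmetic identities such as r = 0 + r; an equality in a
sigma type carries objects and morphisms along together. -/
theorem pathFrom_congr (n : ℕ) {a b : ℕ → X} {x : ∀ i, CubeChains R (MoorePath (a i) (a (i + 1)))}
    {z : ∀ i, CubeChains R (MoorePath (b i) (b (i + 1)))}
    (h : ∀ r, (⟨a r, a (r + 1), x r⟩ : Σ s t : X, CubeChains R (MoorePath s t)) =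
      ⟨b r, b (r + 1), z r⟩) (h0 : a 0 = b 0) : h0 ▸ pathFrom R n a x = pathFrom R n b z := by
  obtain rfl : a = b := funext fun r => congrArg Sigma.fst (h r)
  obtain rfl : x = z := funext fun r => by
    have := h r
    simpa using this
  rfl

theorem pathFrom_add : ∀ (i j : ℕ) (a : ℕ → X)
    (x : ∀ i, CubeChains R (MoorePath (a i) (a (i + 1)))), pathFrom R (i + j) a x =
      cubeCross R (joinPath i (a 0) (a i)) (pathEv R i a x)
        (pathFrom R j (fun r => a (i + r)) fun r => x (i + r))
  | 0, j, a, x => by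
    have e : pathFrom R j a x = pathFrom R j (fun r => a (0 + r)) fun r => x (0 + r) :=
      pathFrom_congr R j (fun r => @congrArg ℕ _ r (0 + r) (fun m : ℕ =>
        (⟨a m, a (m + 1), x m⟩ : Σ s t : X, CubeChains R (MoorePath s t))) (Nat.zero_add r).symm) rfl
    rw [pathEv_zero, cubeCross_point, Nat.zero_add, e]
    refine (cubeMap_id _).symm.trans (congrArg (fun f => cubeMap R f _) ?_)
    exact ContinuousMap.ext fun v => (joinPath_constPath _ v).symm
  | i + 1, j, a, x => by
    have ih := pathFrom_add i j (fun r => a (r + 1)) fun r => x (r + 1)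
    have e : pathFrom R j (fun r => a (i + r + 1)) (fun r => x (i + r + 1)) =
        pathFrom R j (fun r => a (i + 1 + r)) fun r => x (i + 1 + r) :=
      pathFrom_congr R j (fun r => @congrArg ℕ _ (i + r + 1) (i + 1 + r) (fun m : ℕ =>
        (⟨a m, a (m + 1), x m⟩ : Σ s t : X, CubeChains R (MoorePath s t)))
          (Nat.add_right_comm i r 1)) rfl
    rw [Nat.add_right_comm, pathFrom_succ, pathEv_succ, ih, ← e]
    exact (cubeCross_assoc (fun p q u => joinPath_consPathTo _ _ _ _ p q u) _ _ _).symm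

end PathChains

end Chen

namespace Chen

/-! ### Chains of paths evaluated on ordered chains -/

section Weights

variable {m n : ℕ}

/-- The sum of the barycentric coordinates that belong to the vertices in `P`. -/
def weight (P : Fin (n + 1) → Prop) [DecidablePred P] (s : stdSimplex ℝ (Fin (n + 1))) :
    unitInterval :=
  ⟨∑ l with P l, s l, Finset.sum_nonneg fun j _ => stdSimplex.zero_le s j,
    (Finset.sum_le_sum_of_subset_of_nonneg (Finset.filter_subset _ _)
      fun j _ _ => stdSimplex.zero_le s j).trans_eq (stdSimplex.sum_eq_one s)⟩

@[fun_prop]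
theorem continuous_weight (P : Fin (n + 1) → Prop) [DecidablePred P] : Continuous (weight P) :=
  Continuous.subtype_mk (continuous_finsetSum _ fun j _ =>
    (continuous_apply j).comp continuous_subtype_val) _

/-- An affine map given on vertices adds barycentric coordinates over fibres. All realizations below
are compatible with pullback for this reason. -/
theorem weight_map (P : Fin (n + 1) → Prop) [DecidablePred P] (θ : Fin (m + 1) → Fin (n + 1))
    (s : stdSimplex ℝ (Fin (m + 1))) :
    weight P (stdSimplex.map θ s) = weight (fun l => P (θ l)) s := by
  classical
  apply Subtype.ext
  simp only [weight, stdSimplex.map_coe, FunOnFinite.linearMap_apply_apply]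
  rw [← Finset.sum_fiberwise_of_maps_to (s := Finset.univ.filter fun l => P (θ l))
    (t := Finset.univ.filter P) (g := θ) (by simp)]
  refine Finset.sum_congr rfl fun y hy => Finset.sum_congr ?_ fun _ _ => rfl
  ext x
  simp only [Finset.mem_filter, Finset.mem_univ, true_and] at hy ⊢
  exact ⟨fun h => ⟨h ▸ hy, h⟩, fun h => h.2⟩

theorem weight_congr {P Q : Fin (n + 1) → Prop} [DecidablePred P] [DecidablePred Q]
    (h : ∀ l, P l ↔ Q l) (s : stdSimplex ℝ (Fin (n + 1))) : weight P s = weight Q s := by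
  apply Subtype.ext
  simp only [weight, h]

theorem weight_of_forall {P : Fin (n + 1) → Prop} [DecidablePred P] (h : ∀ l, P l)
    (s : stdSimplex ℝ (Fin (n + 1))) : weight P s = 1 := by
  apply Subtype.ext
  simp only [weight, h, Finset.filter_true]
  exact stdSimplex.sum_eq_one s

theorem weight_of_forall_not {P : Fin (n + 1) → Prop} [DecidablePred P] (h : ∀ l, ¬ P l)
    (s : stdSimplex ℝ (Fin (n + 1))) : weight P s = 0 := by
  apply Subtype.ext
  simp only [weight, h, Finset.filter_false, Finset.sum_empty]
  rfl

end Weights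

/-! ### Realizing vertex sequences by evaluating cubes of paths -/

section PathRealization

variable {X : Type u} [TopologicalSpace X] {Y : Type u} [TopologicalSpace Y]

theorem Realization.ext {V : Type*} {Z : Type*} [TopologicalSpace Z] {ρ ρ' : Realization V Z}
    (h : ∀ d g, ρ.simp d g = ρ'.simp d g) : ρ = ρ' := by
  obtain ⟨f, _⟩ := ρ
  obtain ⟨f', _⟩ := ρ'
  obtain rfl : f = f' := funext fun d => funext fun g => h d g
  rfl

/-- The point of the cube with the coordinates `∑ s_l`, summed over the `l` with `w_l` equal to `0`
at the given place. -/
def cubePoint {d : ℕ} (w : Fin (d + 1) → ℕ → ℕ) (s : stdSimplex ℝ (Fin (d + 1))) (i : ℕ) :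
    unitInterval := weight (fun l => w l i = 0) s

/-- The evaluation time number `j` that corresponds to a sequence of lengths. -/
def evalTime {d : ℕ} (N j : ℕ) (v : Fin (d + 1) → ℕ → ℕ) (T : ℕ → ℝ≥0)
    (s : stdSimplex ℝ (Fin (d + 1))) : ℝ≥0 :=
  ∑ i ∈ Finset.range N, unitInterval.toNNReal (weight (fun l => v l i ≤ j) s) * T i

/-- The evaluation of a cube of paths at the time number `j`, as a realization of sequences of
vertices in the product of the cube with the space of evaluation times. -/
def pathRealization {K : ℕ} (N : ℕ) (c : Cube K (PathSeq X)) (j : ℕ) :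
    Realization ((ℕ → ℕ) × (ℕ → ℕ)) X where
  simp d g := ⟨fun s => (cubeAt c (cubePoint (fun l => (g l).1) s)).1
      (evalTime N j (fun l => (g l).2) (cubeAt c (cubePoint (fun l => (g l).1) s)).2 s), by
    have h : Continuous fun s => cubeAt c (cubePoint (fun l => (g l).1) s) :=
      c.continuous.comp (continuous_pi fun i => continuous_weight _)
    have h' : Continuous fun s => evalTime N j (fun l => (g l).2)
        (cubeAt c (cubePoint (fun l => (g l).1) s)).2 s := by
      refine continuous_finsetSum _ fun i _ => Continuous.mul (by fun_prop) ?_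
      exact (continuous_apply i).comp (continuous_snd.comp h)
    fun_prop⟩
  pull_simp d e θ g := by
    ext s
    have h1 : cubePoint (fun l => (g l).1) (stdSimplex.map θ s) =
      cubePoint (fun l => ((g ∘ θ) l).1) s := funext fun i => weight_map _ _ _
    have h2 : ∀ T, evalTime N j (fun l => (g l).2) T (stdSimplex.map θ s) =
      evalTime N j (fun l => ((g ∘ θ) l).2) T s := fun T =>
        Finset.sum_congr rfl fun i _ => by rw [weight_map]; rfl
    change (cubeAt c (cubePoint (fun l => (g l).1) (stdSimplex.map θ s))).1
      (evalTime N j (fun l => (g l).2) (cubeAt c (cubePoint (fun l => (g l).1) (stdSimplex.map θ s))).2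
        (stdSimplex.map θ s)) = _
    rw [h1, h2]
    rfl

theorem pathRealization_apply {K : ℕ} (N : ℕ) (c : Cube K (PathSeq X)) (j d : ℕ)
    (g : Fin (d + 1) → (ℕ → ℕ) × (ℕ → ℕ)) (s : stdSimplex ℝ (Fin (d + 1))) :
    (pathRealization N c j).simp d g s = (cubeAt c (cubePoint (fun l => (g l).1) s)).1
      (evalTime N j (fun l => (g l).2) (cubeAt c (cubePoint (fun l => (g l).1) s)).2 s) := rfl

/-- A cube coordinate is the weight of the vertices with entry 0, so a constant entry 1 means the
coordinate 0 and conversely. This reversal agrees with `tCoord`, for which the vertex 0 of Δ^n is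
the point (1, …, 1). -/
theorem pathRealization_faceSeq {K : ℕ} (N : ℕ) (c : Cube K (PathSeq X)) {i : ℕ} (hi : i < K)
    (j : ℕ) {e : unitInterval} {k : ℕ} (h : e = 0 ∧ k = 1 ∨ e = 1 ∧ k = 0) :
    pathRealization N (faceSeq c i e) j =
      (pathRealization N c j).comap (Prod.map (insAt i k) id) := by
  refine Realization.ext fun d g => ContinuousMap.ext fun s => ?_
  change _ = (pathRealization N c j).simp d (Prod.map (insAt i k) id ∘ g) s
  rw [pathRealization_apply, pathRealization_apply, cubeAt_faceSeq _ hi]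
  have : insI i e (cubePoint (fun l => (g l).1) s) =
      cubePoint (fun l => ((Prod.map (insAt i k) id ∘ g) l).1) s := by
    funext r
    simp only [insI, cubePoint, Function.comp, Prod.map, insAt]
    split_ifs
    · rfl
    · rcases h with ⟨rfl, rfl⟩ | ⟨rfl, rfl⟩
      · exact (weight_of_forall_not (fun _ => one_ne_zero) s).symm
      · exact (weight_of_forall (fun _ => rfl) s).symm
    · rfl
  rw [this]
  rfl

theorem pathRealization_of_indep {K : ℕ} (N : ℕ) (c : Cube K (PathSeq X)) (i : Fin K)
    (hi : ∀ x y, (∀ j, j ≠ i → x j = y j) → c x = c y) (j : ℕ) :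
    pathRealization N c j =
      (pathRealization N c j).comap (Prod.map (fun w => Function.update w (i : ℕ) 0) id) := by
  refine Realization.ext fun d g => ContinuousMap.ext fun s => ?_
  change _ = (pathRealization N c j).simp d (Prod.map (fun w => Function.update w (i : ℕ) 0) id ∘ g) s
  rw [pathRealization_apply, pathRealization_apply]
  have : cubeAt c (cubePoint (fun l => (g l).1) s) = cubeAt c (cubePoint (fun l =>
      ((Prod.map (fun w => Function.update w (i : ℕ) 0) id ∘ g) l).1) s) := by
    refine hi _ _ fun r hr => weight_congr (fun l => ?_) s
    change _ ↔ Function.update (g l).1 (i : ℕ) 0 r = 0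
    rw [Function.update_of_ne (fun e => hr (Fin.ext e))]
  rw [this]
  rfl

theorem pathRealization_map {K : ℕ} (N : ℕ) (c : Cube K (PathSeq X)) (f : C(X, Y)) (j : ℕ)
    (c' : Cube K (PathSeq Y)) (h : ∀ x, c' x = (f.comp (c x).1, (c x).2)) :
    pathRealization N c' j = (pathRealization N c j).map f := by
  refine Realization.ext fun d g => ContinuousMap.ext fun s => ?_
  rw [pathRealization_apply, cubeAt, h]
  rfl

theorem evalTime_congr {d N j j' : ℕ} {v v' : Fin (d + 1) → ℕ → ℕ}
    (h : ∀ l i, v l i ≤ j ↔ v' l i ≤ j') (T : ℕ → ℝ≥0) (s : stdSimplex ℝ (Fin (d + 1))) :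
    evalTime N j v T s = evalTime N j' v' T s :=
  Finset.sum_congr rfl fun i _ => by rw [weight_congr fun l => h l i]

/-- A merged length is weighted by `f p`, so both original lengths receive this weight: merging
lengths is dual to doubling the member `p`. -/
theorem sum_seqMerge (p : ℕ) (T f : ℕ → ℝ≥0) : ∀ k : ℕ,
    ∑ r ∈ Finset.range (p + 1 + k), f r * seqMerge p T r =
      ∑ r ∈ Finset.range (p + 1 + k + 1), f (if r ≤ p then r else r - 1) * T r
  | 0 => by
    rw [Nat.add_zero, Finset.sum_range_succ, Finset.sum_range_succ _ (p + 1),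
      Finset.sum_range_succ _ p, add_assoc]
    refine congrArg₂ (· + ·) (Finset.sum_congr rfl fun r hr => ?_) ?_
    · have hr := Finset.mem_range.1 hr
      rw [seqMerge, if_pos hr, if_pos hr.le]
    · rw [seqMerge, if_neg (lt_irrefl p), if_pos rfl, if_pos le_rfl, if_neg (by omega), mul_add]
      rfl
  | k + 1 => by
    rw [← Nat.add_assoc, Finset.sum_range_succ, sum_seqMerge p T f k,
      Finset.sum_range_succ _ (p + 1 + k + 1), seqMerge, if_neg (by omega), if_neg (by omega),
      if_neg (by omega)]
    rfl

theorem sum_seqJoin (n k : ℕ) (T T' f : ℕ → ℝ≥0) :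
    ∑ r ∈ Finset.range (n + k), f r * seqJoin n T T' r =
      ∑ r ∈ Finset.range n, f r * T r + ∑ r ∈ Finset.range k, f (n + r) * T' r := by
  rw [Finset.sum_range_add]
  refine congrArg₂ (· + ·) (Finset.sum_congr rfl fun r hr => ?_) (Finset.sum_congr rfl fun r hr => ?_)
  · rw [seqJoin, if_pos (Finset.mem_range.1 hr)]
  · rw [seqJoin, if_neg (by omega), Nat.add_sub_cancel_left]

theorem pathRealization_merge {K : ℕ} (N p : ℕ) (hp : p < N) (c c' : Cube K (PathSeq X))
    (h : ∀ x, c' x = ((c x).1, seqMerge p (c x).2)) (j : ℕ) :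
    pathRealization N c' j = (pathRealization (N + 1) c j).comap (Prod.map id (dupAt p)) := by
  refine Realization.ext fun d g => ContinuousMap.ext fun s => ?_
  rw [pathRealization_apply, cubeAt, h]
  obtain ⟨k, rfl⟩ : ∃ k, N = p + 1 + k := ⟨N - (p + 1), by omega⟩
  exact congrArg _ (sum_seqMerge p _ _ k)

/-- A coface shifts the index of a moment, leaves it alone, or makes all weights 0 or all weights 1.
In the last two cases the path is evaluated at its start or at its total length; the clamping
ensures that the vertices lie below the last moment. -/
theorem pathRealization_comap_coface {K : ℕ} (N m : ℕ) (c : Cube K (PathSeq X)) (a b : X)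
    (ha : ∀ x, (c x).1 0 = a) (hb : ∀ x, (c x).1 (∑ i ∈ Finset.range N, (c x).2 i) = b)
    {i j : ℕ} (hi : i ≤ m + 1) (hj : j ≤ m) :
    (Realization.coface a b m (pathRealization N c) i j).comap (Prod.map id (clampAt m)) =
      (pathRealization N c j).comap (Prod.map id (faceAt i ∘ clampAt m)) := by
  refine Realization.ext fun d g => ContinuousMap.ext fun s => ?_
  change (Realization.coface a b m (pathRealization N c) i j).simp d _ s =
    (cubeAt c (cubePoint (fun l => (g l).1) s)).1 (evalTime N j
      (fun l => (faceAt i ∘ clampAt m) (g l).2) (cubeAt c (cubePoint (fun l => (g l).1) s)).2 s)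
  rw [Realization.coface]
  split_ifs with h1 h2 h2
  · refine congrArg _ (evalTime_congr (fun l r => ?_) _ s)
    change min _ m ≤ j ↔ (if min _ m < i then min _ m else min _ m + 1) ≤ j
    split_ifs <;> omega
  · refine (hb _).symm.trans (congrArg _ (Finset.sum_congr rfl fun r _ => ?_))
    rw [weight_of_forall]
    · exact (one_mul _).symm
    · intro l
      change (if min _ m < i then min _ m else min _ m + 1) ≤ j
      split_ifs <;> omega
  · refine (ha _).symm.trans (congrArg _ (Finset.sum_eq_zero fun r _ => ?_).symm)
    rw [weight_of_forall_not]
    · exact zero_mul _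
    intro l
    change ¬ (if min _ m < i then min _ m else min _ m + 1) ≤ j
    split_ifs <;> omega
  · refine congrArg _ (evalTime_congr (fun l r => ?_) _ s)
    change min _ m ≤ j - 1 ↔ (if min _ m < i then min _ m else min _ m + 1) ≤ j
    split_ifs <;> omega

/-- The rearrangement of the vertices that belongs to the join of two cubes of paths. -/
def joinVertex (K a p : ℕ) (s : ((ℕ → ℕ) × (ℕ → ℕ)) × ((ℕ → ℕ) × (ℕ → ℕ))) :
    (ℕ → ℕ) × (ℕ → ℕ) := (joinAt K (s.1.1, s.2.1), catAt a p (s.1.2, s.2.2))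

theorem cubeAt_joinPath {K L : ℕ} (n p : ℕ) {a b : X} (c : Cube K (PathsFromTo n a b))
    (c' : Cube L (PathsFrom b)) {d : ℕ} (g : Fin (d + 1) → ((ℕ → ℕ) × (ℕ → ℕ)) × ((ℕ → ℕ) × (ℕ → ℕ)))
    (s : stdSimplex ℝ (Fin (d + 1))) :
    cubeAt (cubeProd (joinPath n a b) c c') (cubePoint (fun l => (joinVertex K n p (g l)).1) s) =
      joinPath n a b (cubeAt c (cubePoint (fun l => (g l).1.1) s),
        cubeAt c' (cubePoint (fun l => (g l).2.1) s)) := by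
  rw [cubeAt_cubeProd]
  refine congrArg (joinPath n a b) (Prod.ext (congrArg c (funext fun i => ?_))
    (congrArg c' (funext fun i => ?_)))
  · refine weight_congr (fun l => ?_) s
    change joinAt K _ i = 0 ↔ _
    rw [joinAt, if_pos i.isLt]
  · refine weight_congr (fun l => ?_) s
    change joinAt K _ (K + i) = 0 ↔ _
    rw [joinAt, if_neg (by omega), Nat.add_sub_cancel_left]

theorem evalTime_join {d : ℕ} (n k p j : ℕ) (v v' : Fin (d + 1) → ℕ → ℕ) (T T' : ℕ → ℝ≥0)
    (s : stdSimplex ℝ (Fin (d + 1))) :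
    evalTime (n + k) j (fun l => catAt n p (v l, v' l)) (seqJoin n T T') s =
      evalTime n j v T s + evalTime k j (fun l i => p + v' l i) T' s := by
  refine (sum_seqJoin n k T T' _).trans (congrArg₂ (· + ·) (Finset.sum_congr rfl fun r hr => ?_)
    (Finset.sum_congr rfl fun r hr => ?_))
  · have hr := Finset.mem_range.1 hr
    refine congrArg (fun w => unitInterval.toNNReal w * _) (weight_congr (fun l => ?_) s)
    change (if r < n then v l r else p + v' l (r - n)) ≤ j ↔ _
    rw [if_pos hr]
  · refine congrArg (fun w => unitInterval.toNNReal w * _) (weight_congr (fun l => ?_) s)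
    change (if n + r < n then v l (n + r) else p + v' l (n + r - n)) ≤ j ↔ _
    rw [if_neg (by omega), Nat.add_sub_cancel_left]

theorem evalTime_le {d : ℕ} (n j : ℕ) (v : Fin (d + 1) → ℕ → ℕ) (T : ℕ → ℝ≥0)
    (s : stdSimplex ℝ (Fin (d + 1))) : evalTime n j v T s ≤ ∑ i ∈ Finset.range n, T i :=
  Finset.sum_le_sum fun _ _ => mul_le_of_le_one_left zero_le 
    (NNReal.coe_le_one.1 (unitInterval.le_one _))

theorem evalTime_eq_sum {d n j : ℕ} {v : Fin (d + 1) → ℕ → ℕ} (h : ∀ l i, v l i ≤ j) (T : ℕ → ℝ≥0)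
    (s : stdSimplex ℝ (Fin (d + 1))) : evalTime n j v T s = ∑ i ∈ Finset.range n, T i :=
  Finset.sum_congr rfl fun i _ => by
    rw [weight_of_forall fun l => h l i]
    exact one_mul _

theorem evalTime_eq_zero {d n j : ℕ} {v : Fin (d + 1) → ℕ → ℕ} (h : ∀ l i, j < v l i) (T : ℕ → ℝ≥0)
    (s : stdSimplex ℝ (Fin (d + 1))) : evalTime n j v T s = 0 :=
  Finset.sum_eq_zero fun i _ => by
    rw [weight_of_forall_not fun l => not_le.2 (h l i)]
    exact zero_mul _

/-- For j < p the shifted vertices of the second factor are all above j. The lengths of the second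
path get weight 0, and the moment falls on the first path. -/
theorem pathRealization_join_of_lt {K L : ℕ} (n k p : ℕ) {a b : X} (c : Cube K (PathsFromTo n a b))
    (c' : Cube L (PathsFrom b)) {j : ℕ} (hj : j < p) :
    (pathRealization (n + k) ((forgetStart a).comp (cubeProd (joinPath n a b) c c')) j).comap
        (joinVertex K n p) =
      (pathRealization n ((forgetStart a).comp ((forgetEnd n a b).comp c)) j).comap Prod.fst := by
  refine Realization.ext fun d g => ContinuousMap.ext fun s => ?_
  change ((cubeAt (cubeProd (joinPath n a b) c c')
      (cubePoint (fun l => (joinVertex K n p (g l)).1) s)).1).1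
    (evalTime (n + k) j (fun l => catAt n p ((g l).1.2, (g l).2.2)) (cubeAt (cubeProd (joinPath n a b) c c')
      (cubePoint (fun l => (joinVertex K n p (g l)).1) s)).1.2 s) = _
  rw [cubeAt_joinPath]
  refine (congrArg (joinPath n a b (_, _)).1.1 (evalTime_join n k p j _ _ _ _ s)).trans ?_
  rw [evalTime_eq_zero (v := fun l i => p + (g l).2.2 i) (fun l i => by omega), add_zero]
  exact if_pos (evalTime_le _ _ _ _ _)

/-- For p ≤ j the clamped vertices of the first factor are all at most j. The whole length of the
first path is used up, and the moment falls on the second path. -/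
theorem pathRealization_join_of_le {K L : ℕ} (n k p : ℕ) {a b : X} (c : Cube K (PathsFromTo n a b))
    (c' : Cube L (PathsFrom b)) {j : ℕ} (hj : p ≤ j) :
    (pathRealization (n + k) ((forgetStart a).comp (cubeProd (joinPath n a b) c c')) j).comap
        (joinVertex K n p ∘ Prod.map (Prod.map id (clampAt p)) id) =
      (pathRealization k ((forgetStart b).comp c') (j - p)).comap Prod.snd := by
  refine Realization.ext fun d g => ContinuousMap.ext fun s => ?_
  change ((cubeAt (cubeProd (joinPath n a b) c c')
      (cubePoint (fun l => (joinVertex K n p (g l)).1) s)).1).1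
    (evalTime (n + k) j (fun l => catAt n p (clampAt p (g l).1.2, (g l).2.2))
      (cubeAt (cubeProd (joinPath n a b) c c')
        (cubePoint (fun l => (joinVertex K n p (g l)).1) s)).1.2 s) = _
  rw [cubeAt_joinPath]
  refine (congrArg (joinPath n a b (_, _)).1.1 (evalTime_join n k p j _ _ _ _ s)).trans ?_
  rw [evalTime_eq_sum (v := fun l => clampAt p (g l).1.2) (fun l i => (Nat.min_le_right _ _).trans hj),
    evalTime_congr (j' := j - p) (v' := fun l => (g l).2.2) (fun l i => by omega)]
  exact glueFun_add ((cubeAt c (cubePoint (fun l => (g l).1.1) s)).2.2.trans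
    (cubeAt c' (cubePoint (fun l => (g l).2.1) s)).2.symm) _

end PathRealization

end Chen

namespace Chen

/-! ### Chains of paths paired with ordered chains -/

section PathChain

variable {R : Type v} [CommRing R] {V W : Type*} {X : Type u} [TopologicalSpace X] {Y : Type u}
  [TopologicalSpace Y]

variable (R) in
/-- The Alexander–Whitney map after a family of realizations. -/
def awChain (m : ℕ) (φ : ℕ → Realization V X) : OChains R V →ₗ[R] ⨂[R]^m (SChains R X) :=
  alexanderWhitney R m ∘ₗ (Realization.pi fun j : Fin m => φ j).chain R

theorem awChain_congr {m : ℕ} {φ ψ : ℕ → Realization V X} (h : ∀ j < m, φ j = ψ j) :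
    awChain R m φ = awChain R m ψ := by
  have : (fun j : Fin m => φ j) = fun j : Fin m => ψ j := funext fun j => h j j.isLt
  rw [awChain, awChain, this]

theorem awChain_omap (m : ℕ) (φ : ℕ → Realization V X) (k : W → V) (x : OChains R W) :
    awChain R m φ (omap R k x) = awChain R m (fun j => (φ j).comap k) x :=
  congrArg (alexanderWhitney R m)
    (LinearMap.congr_fun (Realization.chain_omap R k (Realization.pi fun j : Fin m => φ j)) x)

theorem tensorBoundary_awChain (m : ℕ) (φ : ℕ → Realization V X) (x : OChains R V) :
    tensorBoundary R m (awChain R m φ x) = awChain R m φ (odel R x) :=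
  Realization.tensorBoundary_alexanderWhitney m φ x

theorem awChain_mem (m : ℕ) (φ : ℕ → Realization V X) {d : ℕ} {x : OChains R V}
    (hx : x ∈ ocDeg R V d) : awChain R m φ x ∈ tensorDeg R (X := X) m d :=
  Realization.alexanderWhitney_mem m _ hx

theorem map_awChain (f : C(X, Y)) (m : ℕ) (φ : ℕ → Realization V X) (x : OChains R V) :
    PiTensorProduct.map (fun _ => simpMap R f) (awChain R m φ x) =
      awChain R m (fun j => (φ j).map f) x :=
  Realization.map_alexanderWhitney f m φ x

theorem awChain_mul (p q n : ℕ) (h : p + q = n) (φ : ℕ → Realization V X)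
    (ψ : ℕ → Realization W X) (x : OChains R V) (y : OChains R W) :
    proj R n (inc R p (awChain R p φ x) * inc R q (awChain R q ψ y)) =
      awChain R n (fun j => if j < p then (φ j).comap Prod.fst else (ψ (j - p)).comap Prod.snd)
        (oprod R x y) :=
  Realization.alexanderWhitney_mul p q n h φ ψ x y

theorem cofaceSum_awChain (a b : X) (m : ℕ) (φ : ℕ → Realization V X) (x : OChains R V) :
    cofaceSum R a b m (awChain R m φ x) = ∑ i ∈ Finset.range (m + 2), (-1 : R) ^ i •
      awChain R (m + 1) (Realization.coface a b m φ i) x :=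
  Realization.cofaceSum_alexanderWhitney a b m φ x

variable (R) in
/-- Chains of paths with `N` lengths evaluated on chains of sequences of vertices. -/
def pathChain (N m : ℕ) :
    CubeChains R (PathSeq X) →ₗ[R] OChains R (ℕ → ℕ) →ₗ[R] ⨂[R]^m (SChains R X) :=
  liftChains (fun s => awChain R m (pathRealization N s.2) ∘ₗ oprod R (cubeChain R s.1)) (by
    -- A degenerate cube ignores one coordinate, and the fundamental chain vanishes when that
    -- coordinate is forgotten.
    rintro ⟨K, c⟩ ⟨i, hi⟩
    refine LinearMap.ext fun x => ?_
    rw [LinearMap.comp_apply,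
      awChain_congr (R := R) fun j (_ : j < m) => pathRealization_of_indep N c i hi j]
    refine (awChain_omap m (pathRealization N c) _ _).symm.trans ?_
    rw [omap_oprod, omap_update_cubeChain R _ i i.isLt, map_zero, LinearMap.zero_apply, map_zero,
      LinearMap.zero_apply])

theorem pathChain_ccls (N m : ℕ) {K : ℕ} (c : Cube K (PathSeq X)) (x : OChains R (ℕ → ℕ)) :
    pathChain R N m (ccls R c) x =
      awChain R m (pathRealization N c) (oprod R (cubeChain R K) x) := by
  rw [pathChain, liftChains_cls]
  rfl

/-- The Leibniz rule for the shuffle product: the boundary of the fundamental cube turns into the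
cubical boundary of the chain of paths, face by face. -/
theorem tensorBoundary_pathChain (N m : ℕ) (y : CubeChains R (PathSeq X)) (x : OChains R (ℕ → ℕ)) :
    tensorBoundary R m (pathChain R N m y x) =
      pathChain R N m (cubeBoundary R y) x + pathChain R N m (cubePar R y) (odel R x) := by
  induction y using cubeChains_induction with
  | hz => simp only [map_zero, LinearMap.zero_apply, add_zero]
  | hadd y y' hy hy' => simp only [map_add, LinearMap.add_apply, hy, hy']; abel
  | hsmul r y hy => simp only [map_smul, LinearMap.smul_apply, hy, smul_add]
  | hg K c =>
    rw [pathChain_ccls, tensorBoundary_awChain, odel_oprod, map_add, opar_of_mem (cubeChain_mem R K),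
      cubePar_ccls, map_smul, map_smul, LinearMap.smul_apply, LinearMap.smul_apply, map_smul,
      pathChain_ccls, odel_cubeChain, cubeFaces_apply, cubeBoundary_ccls]
    refine congrArg (· + _) ?_
    rw [map_sum, map_sum, LinearMap.sum_apply, LinearMap.sum_apply, map_sum]
    refine Finset.sum_congr rfl fun i hi => ?_
    have hi := Finset.mem_range.1 hi
    have key : ∀ (e : unitInterval) (k : ℕ), e = 0 ∧ k = 1 ∨ e = 1 ∧ k = 0 →
        awChain R m (pathRealization N c) (oprod R (omap R (insAt i k) (cubeChain R (K - 1))) x) =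
          pathChain R N m (ccls R (faceSeq c i e)) x := by
      intro e k h
      rw [pathChain_ccls, awChain_congr (R := R) fun j (_ : j < m) => pathRealization_faceSeq N c hi j h]
      refine Eq.trans ?_ (awChain_omap m (pathRealization N c) _ _)
      rw [omap_oprod, omap_id]
    rw [map_smul, map_smul, map_sub, map_sub, LinearMap.smul_apply, LinearMap.smul_apply,
      LinearMap.sub_apply, LinearMap.sub_apply, map_smul, map_sub, key 0 1 (.inl ⟨rfl, rfl⟩),
      key 1 0 (.inr ⟨rfl, rfl⟩)]

theorem pathChain_mem (N m : ℕ) {k : ℤ} {y : CubeChains R (PathSeq X)} (hy : y ∈ cubeDeg R k)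
    {d : ℕ} {x : OChains R (ℕ → ℕ)} (hx : x ∈ ocDeg R (ℕ → ℕ) d) :
    pathChain R N m y x ∈ tensorDeg R (X := X) m (k + d) := by
  have : cubeDeg R k ≤ (tensorDeg R (X := X) m (k + d)).comap ((pathChain R N m).flip x) := by
    refine Submodule.span_le.2 ?_
    rintro _ ⟨K, c, rfl, rfl⟩
    change pathChain R N m (ccls R c) x ∈ tensorDeg R (X := X) m (K + d)
    rw [pathChain_ccls, ← Nat.cast_add]
    exact awChain_mem m _ (oprod_mem (cubeChain_mem R K) hx)
  exact this hy

variable (X) in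
/-- The map of spaces of paths with a sequence of lengths. -/
def seqMap (f : C(X, Y)) : C(PathSeq X, PathSeq Y) where
  toFun u := (f.comp u.1, u.2)
  continuous_toFun := Continuous.prodMk ((ContinuousMap.continuous_postcomp f).comp (by fun_prop))
    (by fun_prop)

theorem pathChain_cubeMap (N m : ℕ) (f : C(X, Y)) (y : CubeChains R (PathSeq X))
    (x : OChains R (ℕ → ℕ)) : pathChain R N m (cubeMap R (seqMap X f) y) x =
      PiTensorProduct.map (fun _ => simpMap R f) (pathChain R N m y x) := by
  induction y using cubeChains_induction with
  | hz => simp only [map_zero, LinearMap.zero_apply]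
  | hadd y y' hy hy' => simp only [map_add, LinearMap.add_apply, hy, hy']
  | hsmul r y hy => simp only [map_smul, LinearMap.smul_apply, hy]
  | hg K c =>
    rw [cubeMap_ccls, pathChain_ccls, pathChain_ccls]
    refine Eq.trans ?_ (map_awChain f m (pathRealization N c) _).symm
    rw [awChain_congr (R := R) fun j (_ : j < m) => pathRealization_map N c f j _ fun _ => rfl]

theorem pathChain_mergePath (N m p : ℕ) (hp : p < N) (a : X) (y : CubeChains R (PathsFrom a))
    (x : OChains R (ℕ → ℕ)) :
    pathChain R N m (cubeMap R (forgetStart a) (cubeMap R (mergePath p a) y)) x =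
      pathChain R (N + 1) m (cubeMap R (forgetStart a) y) (omap R (dupAt p) x) := by
  induction y using cubeChains_induction with
  | hz => simp only [map_zero, LinearMap.zero_apply]
  | hadd y y' hy hy' => simp only [map_add, LinearMap.add_apply, hy, hy']
  | hsmul r y hy => simp only [map_smul, LinearMap.smul_apply, hy]
  | hg K c =>
    rw [cubeMap_ccls, cubeMap_ccls, cubeMap_ccls, pathChain_ccls, pathChain_ccls,
      awChain_congr (R := R) fun j (_ : j < m) =>
        pathRealization_merge N p hp ((forgetStart a).comp c) _ (fun _ => rfl) j]
    refine (awChain_omap m (pathRealization (N + 1) ((forgetStart a).comp c)) _ _).symm.trans ?_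
    rw [omap_oprod, omap_id]

/-- Here both ends of the paths must be fixed, since the outer cofaces insert the points `a` and
`b`. -/
theorem cofaceSum_pathChain (N m : ℕ) (a b : X) (y : CubeChains R (PathsFromTo N a b))
    {x : OChains R (ℕ → ℕ)} (hx : omap R (clampAt m) x = x) :
    cofaceSum R a b m (pathChain R N m (cubeMap R (forgetStart a) (cubeMap R (forgetEnd N a b) y)) x) =
      pathChain R N (m + 1) (cubeMap R (forgetStart a) (cubeMap R (forgetEnd N a b) y))
        (coface R m x) := by
  induction y using cubeChains_induction with
  | hz => simp only [map_zero, LinearMap.zero_apply]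
  | hadd y y' hy hy' => simp only [map_add, LinearMap.add_apply, hy, hy']
  | hsmul r y hy => simp only [map_smul, LinearMap.smul_apply, hy]
  | hg K c =>
    rw [cubeMap_ccls, cubeMap_ccls, pathChain_ccls, pathChain_ccls, cofaceSum_awChain, coface_apply,
      map_sum, map_sum]
    refine Finset.sum_congr rfl fun i hi => ?_
    have hi := Finset.mem_range.1 hi
    rw [map_smul, map_smul]
    refine congrArg _ ?_
    conv_lhs => rw [← hx]
    conv_rhs => rw [← hx]
    rw [← omap_id (cubeChain R K), omap_omap, ← omap_oprod, ← omap_oprod, awChain_omap, awChain_omap]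
    exact LinearMap.congr_fun (awChain_congr fun j hj => pathRealization_comap_coface N m
      ((forgetStart a).comp ((forgetEnd N a b).comp c)) a b (fun z => (c z).2.1) (fun z => (c z).2.2)
        (i := i) (j := j) (by omega) (by omega)) _

theorem cubePar_pow_ccls (d : ℕ) {K : ℕ} (c : Cube K X) :
    (cubePar R ^ d) (ccls R c) = (-1 : R) ^ (d * K) • ccls R c := by
  induction d with
  | zero => simp
  | succ d ih =>
    rw [pow_succ', Module.End.mul_apply, ih, map_smul, cubePar_ccls, smul_smul, ← pow_add,
      Nat.succ_mul]

theorem pathChain_mul (i j p q n : ℕ) (hn : p + q = n) {a b : X}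
    (y : CubeChains R (PathsFromTo i a b)) (z : CubeChains R (PathsFrom b))
    {d e : ℕ} {x x' : OChains R (ℕ → ℕ)} (hx : x ∈ ocDeg R (ℕ → ℕ) d) (hx' : x' ∈ ocDeg R (ℕ → ℕ) e)
    (hp : omap R (clampAt p) x = x) :
    proj R n (inc R p (pathChain R i p (cubeMap R (forgetStart a) (cubeMap R (forgetEnd i a b) y)) x) *
      inc R q (pathChain R j q (cubeMap R (forgetStart b) z) x')) =
    pathChain R (i + j) n (cubeMap R (forgetStart a)
      (cubeCross R (joinPath i a b) y ((cubePar R ^ d) z))) (omul R i p x x') := by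
  induction z using cubeChains_induction with
  | hz => simp only [map_zero, LinearMap.zero_apply, mul_zero]
  | hadd y y' hy hy' => simp only [map_add, LinearMap.add_apply, mul_add, hy, hy']
  | hsmul r y hy => simp only [map_smul, LinearMap.smul_apply, mul_smul_comm, hy]
  | hg L c' =>
  induction y using cubeChains_induction with
  | hz => simp only [map_zero, LinearMap.zero_apply, zero_mul]
  | hadd y y' hy hy' => simp only [map_add, LinearMap.add_apply, add_mul, hy, hy']
  | hsmul r y hy => simp only [map_smul, LinearMap.smul_apply, smul_mul_assoc, hy]
  | hg K c =>
  -- Clamping can be inserted because `x` is clamped; without it the moments j ≥ p could not be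
  -- located on the second path.
  have h0 : oprod R (oprod R (cubeChain R K) x) (oprod R (cubeChain R L) x') =
      omap R (Prod.map (Prod.map id (clampAt p)) id)
        (oprod R (oprod R (cubeChain R K) x) (oprod R (cubeChain R L) x')) := by
    rw [omap_oprod, omap_oprod, omap_id, omap_id, hp]
  -- Sorting cube, times, cube, times into cubes and times moves `x` of degree d past a cube of
  -- dimension L. The resulting sign (-1)^{dL} is the one that `cubePar R ^ d` compensates.
  have h1 : oprod R (cubeChain R (K + L)) (omul R i p x x') = (-1 : R) ^ (d * L) •
      omap R (joinVertex K i p) (oprod R (oprod R (cubeChain R K) x) (oprod R (cubeChain R L) x')) := by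
    have e1 : joinVertex K i p = Prod.map (joinAt K) (catAt i p) ∘ swapMid := rfl
    rw [e1, ← omap_omap, omap_swapMid_oprod (cubeChain_mem R K) hx (cubeChain_mem R L) hx', map_smul,
      smul_smul, ← mul_pow, neg_one_mul, neg_neg, one_pow, one_smul, omap_oprod, omap_joinAt_cubeChain,
      omul_apply]
  rw [cubePar_pow_ccls, map_smul, map_smul, map_smul, LinearMap.smul_apply, cubeCross_ccls,
    cubeMap_ccls, cubeMap_ccls, cubeMap_ccls, cubeMap_ccls, pathChain_ccls, pathChain_ccls,
    pathChain_ccls, h1, map_smul, smul_smul, ← mul_pow, neg_one_mul, neg_neg, one_pow, one_smul]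
  refine (awChain_mul p q n hn _ _ _ _).trans ?_
  rw [h0, omap_omap, awChain_omap, awChain_omap]
  refine LinearMap.congr_fun (awChain_congr fun r hr => ?_) _
  split_ifs with h
  · exact (congrArg (Realization.comap (Prod.map (Prod.map id (clampAt p)) id))
      (pathRealization_join_of_lt i j p c c' h)).symm
  · exact (pathRealization_join_of_le i j p c c' (not_lt.1 h)).symm

end PathChain

end Chen

namespace Chen

/-! ### The components of the functor -/

section Sign

variable (R : Type v) [CommRing R]

/-- The sign `(-1)^k` as an element of the ring of coefficients. -/
def sgn (k : ℤ) : R := ((k.negOnePow : ℤ) : R)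

variable {R} {M : Type*} [AddCommGroup M] [Module R M]

theorem negOnePow_smul_eq (k : ℤ) (x : M) : k.negOnePow • x = sgn R k • x := by
  rw [sgn, Int.cast_smul_eq_zsmul, Units.smul_def]

theorem sgn_add (k l : ℤ) : sgn R (k + l) = sgn R k * sgn R l := by
  rw [sgn, Int.negOnePow_add, Units.val_mul, Int.cast_mul, sgn, sgn]

theorem sgn_natCast (n : ℕ) : sgn R n = (-1) ^ n := by
  have := negOnePow_smul (R := R) n (1 : R)
  rw [negOnePow_smul_eq (R := R)] at this
  simpa using this

theorem sgn_congr {k l : ℤ} (m : ℤ) (h : k = l + 2 * m) : sgn R k = sgn R l := by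
  have : k.negOnePow = l.negOnePow := (Int.negOnePow_eq_iff k l).2 ⟨m, by rw [h]; ring⟩
  rw [sgn, sgn, this]

theorem sgn_pow (k : ℤ) (n : ℕ) : sgn R k ^ n = sgn R (n * k) := by
  induction n with
  | zero => simp [sgn]
  | succ n ih => rw [pow_succ, ih, ← sgn_add, Nat.cast_succ, add_mul, one_mul]

end Sign

/-! ### The cobar operations on evaluated families -/

section Components

variable {R : Type v} [CommRing R] {X : Type u} [TopologicalSpace X] {Y : Type u}
  [TopologicalSpace Y]

theorem cubePar_eq_sgn {Z : Type*} [TopologicalSpace Z] {k : ℤ} {x : CubeChains R Z}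
    (hx : x ∈ cubeDeg R k) : cubePar R x = sgn R k • x := by
  rw [cubePar_of_mem hx, negOnePow_smul_eq (R := R)]

theorem cubePar_pow_eq_sgn {Z : Type*} [TopologicalSpace Z] {k : ℤ} {x : CubeChains R Z}
    (hx : x ∈ cubeDeg R k) (n : ℕ) : (cubePar R ^ n) x = sgn R (n * k) • x := by
  rw [← sgn_pow]
  induction n with
  | zero => simp
  | succ n ih => rw [pow_succ', Module.End.mul_apply, ih, map_smul, cubePar_eq_sgn hx, smul_smul, pow_succ]

theorem tensorParity_tprod (n : ℕ) (s : Fin n → Σ k, Simp k X) :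
    tensorParity R n (PiTensorProduct.tprod R fun i => cls R IsDegenSimp (s i)) =
      (∏ i, (-1 : R) ^ (s i).1) • PiTensorProduct.tprod R fun i => cls R IsDegenSimp (s i) := by
  refine (PiTensorProduct.map_tprod _ _).trans (Eq.trans ?_ (MultilinearMap.map_smul_univ _ _ _))
  exact congrArg _ (funext fun i => liftChains_cls _ _ _)

theorem tensorParity_of_mem {n : ℕ} {q : ℤ} {z : ⨂[R]^n (SChains R X)} (hz : z ∈ tensorDeg R n q) :
    tensorParity R n z = sgn R q • z := by
  have : tensorDeg R (X := X) n q ≤ LinearMap.eqLocus (tensorParity R n)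
      (sgn R q • (LinearMap.id : ⨂[R]^n (SChains R X) →ₗ[R] ⨂[R]^n (SChains R X))) := by
    refine Submodule.span_le.2 ?_
    rintro _ ⟨s, rfl, rfl⟩
    refine (tensorParity_tprod n s).trans ?_
    rw [LinearMap.smul_apply, LinearMap.id_apply, Finset.prod_pow_eq_pow_sum, ← Nat.cast_sum, sgn_natCast]
  exact this hz

theorem tensorParity_pow_of_mem {n : ℕ} {q : ℤ} {z : ⨂[R]^n (SChains R X)}
    (hz : z ∈ tensorDeg R n q) (p : ℕ) : (tensorParity R n ^ p) z = sgn R (p * q) • z := by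
  rw [← sgn_pow]
  induction p with
  | zero => rw [pow_zero, pow_zero, one_smul, Module.End.one_apply]
  | succ p ih =>
    rw [pow_succ', Module.End.mul_apply, ih, map_smul, tensorParity_of_mem hz, smul_smul, pow_succ]

variable (R X) in
/-- Chains of paths evaluated on a family of ordered chains. -/
def famChain (N : ℕ) :
    Fam R →ₗ[R] CubeChains R (PathSeq X) →ₗ[R] ∀ m : ℕ, ⨂[R]^m (SChains R X) :=
  LinearMap.mk₂ R (fun e y m => pathChain R N m y (e m))
    (fun e e' y => funext fun m => LinearMap.map_add (pathChain R N m y) (e m) (e' m))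
    (fun r e y => funext fun m => LinearMap.map_smul (pathChain R N m y) r (e m))
    (fun e y y' => funext fun m => by rw [map_add]; rfl)
    (fun r e y => funext fun m => by rw [map_smul]; rfl)

theorem famChain_apply (N : ℕ) (e : Fam R) (y : CubeChains R (PathSeq X)) (m : ℕ) :
    famChain R X N e y m = pathChain R N m y (e m) := rfl

/-- Turns the cobar differential into operations on models. The first component of D gives the
boundaries of the cube and of the family, the second the cofaces, and the combination in the last
term is the one governed by the equation of the universal chains. -/
theorem cobarD_famChain (N : ℕ) (a b : X) {k : ℤ} {y : CubeChains R (PathsFromTo N a b)}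
    (hy : y ∈ cubeDeg R k) {l : ℕ} {e : Fam R} (he : ∀ m, e m ∈ ocDeg R _ (l + m)) (hc : IsClamped e) :
    cobarD R a b (famChain R X N e (cubeMap R (forgetStart a) (cubeMap R (forgetEnd N a b) y))) =
      famChain R X N e (cubeBoundary R (cubeMap R (forgetStart a) (cubeMap R (forgetEnd N a b) y))) +
      sgn R k • famChain R X N (fdel R e + (-1 : R) ^ l • fcoface R e)
        (cubeMap R (forgetStart a) (cubeMap R (forgetEnd N a b) y)) := by
  have hy' := cubeMap_mem (forgetStart a) (cubeMap_mem (forgetEnd N a b) hy)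
  funext m
  have h1 : tensorBoundary R m (famChain R X N e
      (cubeMap R (forgetStart a) (cubeMap R (forgetEnd N a b) y)) m) = _ :=
    tensorBoundary_pathChain N m _ (e m)
  have h2 : cobarDelta R a b m (famChain R X N e
      (cubeMap R (forgetStart a) (cubeMap R (forgetEnd N a b) y))) =
      sgn R k • famChain R X N ((-1 : R) ^ l • fcoface R e)
        (cubeMap R (forgetStart a) (cubeMap R (forgetEnd N a b) y)) m := by
    cases m with
    | zero =>
      rw [famChain_apply, Pi.smul_apply, fcoface_zero, smul_zero, map_zero, smul_zero]
      rfl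
    | succ m =>
      have h3 := tensorParity_of_mem (pathChain_mem N m hy' (he m))
      have h4 := cofaceSum_pathChain N m a b y (hc m)
      change (-1 : R) ^ m • cofaceSum R a b m (tensorParity R m (pathChain R N m _ (e m))) = _
      rw [h3, map_smul, h4, famChain_apply, Pi.smul_apply, fcoface_succ, map_smul, smul_smul, smul_smul,
        ← sgn_natCast, ← sgn_natCast, ← sgn_add, ← sgn_add]
      congr 1
      -- The sign involution gives (-1)^{k+l+m}; the factor (-1)^m of the cobar differential reduces
      -- it to (-1)^{k+l}.
      refine sgn_congr m ?_
      push_cast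
      ring
  refine (congrArg₂ (· + ·) h1 h2).trans ?_
  rw [cubePar_eq_sgn hy', Pi.add_apply, Pi.smul_apply, map_add, LinearMap.add_apply, Pi.add_apply,
    famChain_apply, famChain_apply, famChain_apply, fdel_apply, map_smul, LinearMap.smul_apply, smul_add, add_assoc]

theorem cobarComp_famChain (i j : ℕ) {a b : X} {k : ℤ} (y : CubeChains R (PathsFromTo i a b))
    {z : CubeChains R (PathsFrom b)} (hz : z ∈ cubeDeg R k) {l l' : ℕ} {e e' : Fam R}
    (he : ∀ m, e m ∈ ocDeg R _ (l + m)) (he' : ∀ m, e' m ∈ ocDeg R _ (l' + m)) (hc : IsClamped e) :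
    cobarComp R (famChain R X i e (cubeMap R (forgetStart a) (cubeMap R (forgetEnd i a b) y)))
      (famChain R X j e' (cubeMap R (forgetStart b) z)) =
    sgn R (l * k) • famChain R X (i + j) (fmul R i l' e e')
      (cubeMap R (forgetStart a) (cubeCross R (joinPath i a b) y z)) := by
  funext n
  rw [Pi.smul_apply, famChain_apply, fmul_apply, map_sum, Finset.smul_sum]
  change ∑ p ∈ Finset.HasAntidiagonal.antidiagonal n, (-1 : R) ^ (p.1 * p.2) • proj R n (inc R p.1
    (pathChain R i p.1 (cubeMap R (forgetStart a) (cubeMap R (forgetEnd i a b) y)) (e p.1)) *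
      inc R p.2 ((tensorParity R p.2 ^ p.1)
        (pathChain R j p.2 (cubeMap R (forgetStart b) z) (e' p.2)))) = _
  refine Finset.sum_congr rfl fun p hp => ?_
  have hp := Finset.HasAntidiagonal.mem_antidiagonal.1 hp
  have h1 := tensorParity_pow_of_mem (pathChain_mem j p.2 (cubeMap_mem (forgetStart b) hz) (he' p.2)) p.1
  have h2 := pathChain_mul i j p.1 p.2 n hp y z (he p.1) (he' p.2) (hc p.1)
  rw [h1, map_smul, mul_smul_comm, map_smul, h2, cubePar_pow_eq_sgn hz, map_smul, map_smul, map_smul,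
    map_smul, LinearMap.smul_apply, smul_smul, smul_smul, smul_smul, ← sgn_natCast, ← sgn_natCast,
    ← sgn_add, ← sgn_add, ← sgn_add]
  congr 1
  -- With p = p.1 and q = p.2 the collected exponent is pq + p(k + l' + q) + (l + p)k, which is lk +
  -- pl' up to the even number 2(pk + pq).
  refine sgn_congr (p.1 * k + p.1 * p.2) ?_
  push_cast
  ring

end Components

end Chen

namespace Chen

/-! ### The components of the functor and the A_∞ relation -/

section Functor

variable (R : Type v) [CommRing R] {X : Type u} [TopologicalSpace X] {Y : Type u}
  [TopologicalSpace Y]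

/-- The components of the `A_∞`-functor. -/
def pathComponent : ∀ (n : ℕ) (a : Fin (n + 1) → X),
    MultilinearMap R (fun i : Fin n => CubeChains R (MoorePath (a i.castSucc) (a i.succ)))
      (∀ m : ℕ, ⨂[R]^m (SChains R X))
  | 0, _ => 0
  -- The power of `cubePar` is the Koszul sign of a universal chain of degree n, up to m, passing
  -- the product of the arguments.
  | n + 1, a => LinearMap.compMultilinearMap
      (famChain R X (n + 1) (universalChain R n) ∘ₗ (cubePar R ^ n) ∘ₗ
        cubeMap R (forgetStart (a 0)) ∘ₗ cubeMap R (forgetEnd (n + 1) (a 0) (a (Fin.last (n + 1)))))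
      (pathProd R (n + 1) a)

/-- The component number `n` on the first `n` members of a sequence of composable chains. -/
def componentEv (n : ℕ) (a : ℕ → X) (x : ∀ i, CubeChains R (MoorePath (a i) (a (i + 1)))) :
    ∀ m : ℕ, ⨂[R]^m (SChains R X) :=
  pathComponent R n (fun i => a i) fun i => x i

variable {R}

theorem componentEv_succ (n : ℕ) (a : ℕ → X)
    (x : ∀ i, CubeChains R (MoorePath (a i) (a (i + 1)))) :
    componentEv R (n + 1) a x = famChain R X (n + 1) (universalChain R n)
      ((cubePar R ^ n) (cubeMap R (forgetStart (a 0)) (pathFrom R (n + 1) a x))) := rfl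

theorem pathEv_mem (n : ℕ) (a : ℕ → X) {x : ∀ i, CubeChains R (MoorePath (a i) (a (i + 1)))}
    {k : ℕ → ℤ} (h : ∀ i, x i ∈ cubeDeg R (k i)) :
    pathEv R n a x ∈ cubeDeg R (∑ j ∈ Finset.range n, k j) := by
  rw [Finset.sum_range]
  exact pathProd_mem R n (fun i => a i) (fun i => x i) (fun i => k i) fun i => h i

theorem pathFrom_mem (n : ℕ) (a : ℕ → X) {x : ∀ i, CubeChains R (MoorePath (a i) (a (i + 1)))}
    {k : ℕ → ℤ} (h : ∀ i, x i ∈ cubeDeg R (k i)) :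
    pathFrom R n a x ∈ cubeDeg R (∑ j ∈ Finset.range n, k j) :=
  cubeMap_mem (forgetEnd n (a 0) (a n)) (pathEv_mem n a h)

theorem componentEv_of_mem (n : ℕ) (a : ℕ → X)
    {x : ∀ i, CubeChains R (MoorePath (a i) (a (i + 1)))} {k : ℕ → ℤ}
    (h : ∀ i, x i ∈ cubeDeg R (k i)) :
    componentEv R (n + 1) a x = sgn R (n * ∑ j ∈ Finset.range (n + 1), k j) •
      famChain R X (n + 1) (universalChain R n)
        (cubeMap R (forgetStart (a 0)) (pathFrom R (n + 1) a x)) := by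
  rw [componentEv_succ, cubePar_pow_eq_sgn (cubeMap_mem (forgetStart (a 0)) (pathFrom_mem (n + 1) a h)),
    map_smul]

theorem cubePar_pow_cubeBoundary {Z : Type*} [TopologicalSpace Z] (n : ℕ) (x : CubeChains R Z) :
    (cubePar R ^ n) (cubeBoundary R x) = (-1 : R) ^ n • cubeBoundary R ((cubePar R ^ n) x) := by
  induction n with
  | zero => simp
  | succ n ih =>
    rw [pow_succ', pow_succ', Module.End.mul_apply, Module.End.mul_apply, ih, map_smul,
      cubePar_cubeBoundary, smul_neg, neg_one_mul, neg_smul]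

/-- The terms of the relation that involve the differential of one argument. -/
theorem sum_ev_boundary (n : ℕ) (a : ℕ → X) (x : ∀ i, CubeChains R (MoorePath (a i) (a (i + 1))))
    (k : ℕ → ℤ) (h : ∀ i, x i ∈ cubeDeg R (k i)) :
    ∑ p : Fin (n + 1), (n + ∑ j ∈ Finset.range p, k j).negOnePow •
        componentEv R (n + 1) a (Function.update x p (cubeBoundary R (x p))) =
      sgn R (n * ∑ j ∈ Finset.range (n + 1), k j) • famChain R X (n + 1) (universalChain R n)
        (cubeBoundary R (cubeMap R (forgetStart (a 0)) (pathFrom R (n + 1) a x))) := by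
  have h1 : ∀ p : ℕ, (n + ∑ j ∈ Finset.range p, k j).negOnePow •
        componentEv R (n + 1) a (Function.update x p (cubeBoundary R (x p))) =
      sgn R n • famChain R X (n + 1) (universalChain R n)
        ((cubePar R ^ n) (cubeMap R (forgetStart (a 0)) ((∑ j ∈ Finset.range p, k j).negOnePow •
          pathFrom R (n + 1) a (Function.update x p (cubeBoundary R (x p)))))) := fun p => by
    rw [negOnePow_smul_eq (R := R), negOnePow_smul_eq (R := R), map_smul, map_smul, map_smul, smul_smul,
      ← sgn_add]
    rfl
  refine (Finset.sum_range fun p => (n + ∑ j ∈ Finset.range p, k j).negOnePow •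
        componentEv R (n + 1) a (Function.update x p (cubeBoundary R (x p)))).symm.trans ?_
  rw [Finset.sum_congr rfl fun p _ => h1 p, ← Finset.smul_sum, ← map_sum, ← map_sum, ← map_sum,
    ← cubeBoundary_pathFrom R (n + 1) a x k h, ← cubeBoundary_cubeMap, cubePar_pow_cubeBoundary,
    cubePar_pow_eq_sgn (cubeMap_mem (forgetStart (a 0)) (pathFrom_mem (n + 1) a h)), map_smul, map_smul,
    map_smul, smul_smul, smul_smul, sgn_natCast, ← mul_pow, neg_one_mul, neg_neg, one_pow,
    one_mul]

theorem castHom_cobarProd {a b b' : (cobarProd R X).Obj} (h : b = b')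
    (x : (cobarProd R X).Hom a b) : (cobarProd R X).castHom h x = x := by
  subst h
  rfl

/-- Composing two neighbouring arguments merges two lengths, and evaluation turns this into a
duplication in the universal chain. -/
theorem ev_contract (n : ℕ) (a : ℕ → X) (x : ∀ i, CubeChains R (MoorePath (a i) (a (i + 1))))
    (k : ℕ → ℤ) (h : ∀ i, x i ∈ cubeDeg R (k i)) (p : ℕ) (hp : p < n + 1) :
    componentEv R (n + 1) (contractObj a p) (contractHom (pathCubes R X) a x p) =
      sgn R (n * ∑ j ∈ Finset.range (n + 2), k j) • famChain R X (n + 2)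
        (fdup R p (universalChain R n))
        (cubeMap R (forgetStart (a 0)) (pathFrom R (n + 2) a x)) := by
  refine (componentEv_succ n _ _).trans ?_
  have h1 := pathFrom_contract R p (n + 1) hp a x
  have h2 := cubeMap_mem (R := R) (mergePath p (a 0))
    (pathFrom_mem (n + 2) a h)
  have h3 := cubePar_pow_eq_sgn (cubeMap_mem (forgetStart (a 0)) h2) n
  refine (congrArg (fun z => famChain R X (n + 1) (universalChain R n)
    ((cubePar R ^ n) (cubeMap R (forgetStart (a 0)) z))) h1).trans ?_
  refine (congrArg (famChain R X (n + 1) (universalChain R n)) h3).trans ?_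
  rw [map_smul]
  refine congrArg _ (funext fun m => ?_)
  exact pathChain_mergePath (n + 1) m p hp (a 0) (pathFrom R (n + 2) a x) (universalChain R n m)

/-- The equation of the universal chains replaces ∂e + (-1)^n δe in `cobarD_famChain` by
`universalRhs`. -/
theorem cobarD_ev (n : ℕ) (a : ℕ → X) (x : ∀ i, CubeChains R (MoorePath (a i) (a (i + 1))))
    (k : ℕ → ℤ) (h : ∀ i, x i ∈ cubeDeg R (k i)) :
    cobarD R (a 0) (a (n + 1)) (componentEv R (n + 1) a x) =
      sgn R (n * ∑ j ∈ Finset.range (n + 1), k j) • famChain R X (n + 1) (universalChain R n)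
        (cubeBoundary R (cubeMap R (forgetStart (a 0)) (pathFrom R (n + 1) a x))) +
      sgn R ((n + 1) * ∑ j ∈ Finset.range (n + 1), k j) • famChain R X (n + 1) (universalRhs R n)
        (cubeMap R (forgetStart (a 0)) (pathFrom R (n + 1) a x)) := by
  have h1 := cobarD_famChain (n + 1) (a 0) (a (n + 1)) (pathEv_mem (n + 1) a h)
    (fun m => universalChain_mem n m) (isClamped_universalChain (R := R) n)
  rw [fdel_universalChain, sub_add_cancel] at h1
  refine (congrArg (cobarD R (a 0) (a (n + 1))) (componentEv_of_mem n a h)).trans ?_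
  refine (map_smul _ _ _).trans ((congrArg _ h1).trans ?_)
  rw [smul_add, smul_smul, ← sgn_add, add_mul, one_mul]
  rfl

/-- The equations for `m` and `N` make the statement applicable to m = n - i and N = n + 1 without
rewriting under dependent types. -/
theorem cobarComp_ev (i r m N : ℕ) (hm : m = r + 1) (hN : N = i + 1 + (r + 1)) (a : ℕ → X)
    (x : ∀ i, CubeChains R (MoorePath (a i) (a (i + 1)))) (k : ℕ → ℤ)
    (h : ∀ i, x i ∈ cubeDeg R (k i)) :
    cobarComp R (componentEv R (i + 1) a x)
      (componentEv R m (fun j => a (i + 1 + j)) fun j => x (i + 1 + j)) =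
      sgn R ((i + r) * (∑ j ∈ Finset.range N, k j) - r * ∑ j ∈ Finset.range (i + 1), k j) •
        famChain R X N (fmul R (i + 1) r (universalChain R i) (universalChain R r))
          (cubeMap R (forgetStart (a 0)) (pathFrom R N a x)) := by
  subst hm hN
  have h1 := componentEv_of_mem i a h
  have h2 := componentEv_of_mem r (fun j => a (i + 1 + j)) (x := fun j => x (i + 1 + j))
    fun j => h (i + 1 + j)
  have h3 := cobarComp_famChain (i + 1) (r + 1) (pathEv R (i + 1) a x)
    (pathFrom_mem (r + 1) (fun j => a (i + 1 + j)) (x := fun j => x (i + 1 + j))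
      fun j => h (i + 1 + j))
    (fun m => universalChain_mem i m) (fun m => universalChain_mem r m)
    (isClamped_universalChain (R := R) i)
  refine (congrArg₂ (fun y z => cobarComp R y z) h1 h2).trans ?_
  rw [map_smul, map_smul, LinearMap.smul_apply]
  refine (congrArg (fun z => _ • _ • z) h3).trans ?_
  rw [pathFrom_add R (i + 1) (r + 1) a x, smul_smul, smul_smul, ← sgn_add, ← sgn_add,
    Finset.sum_range_add k (i + 1) (r + 1)]
  congr 2
  ring

theorem pathComponent_mem (n : ℕ) (hn : 1 ≤ n) (a : Fin (n + 1) → X)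
    (x : ∀ i : Fin n, CubeChains R (MoorePath (a i.castSucc) (a i.succ))) (k : Fin n → ℤ)
    (hx : ∀ i, x i ∈ cubeDeg R (k i)) : pathComponent R n a x ∈
      Submodule.pi Set.univ fun m : ℕ => tensorDeg R (X := X) m (∑ i, k i + n - 1 + m) := by
  obtain ⟨n, rfl⟩ : ∃ l, n = l + 1 := ⟨n - 1, by omega⟩
  have h1 := cubeMap_mem (forgetStart (a 0)) (cubeMap_mem (forgetEnd (n + 1) (a 0) (a (Fin.last (n + 1))))
    (pathProd_mem R (n + 1) a x k hx))
  change (famChain R X (n + 1) (universalChain R n)) ((cubePar R ^ n) (cubeMap R (forgetStart (a 0))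
    (cubeMap R (forgetEnd (n + 1) (a 0) (a (Fin.last (n + 1)))) (pathProd R (n + 1) a x)))) ∈
    Submodule.pi Set.univ fun m : ℕ => tensorDeg R m (∑ i, k i + (n + 1 : ℕ) - 1 + m)
  rw [cubePar_pow_eq_sgn h1, map_smul]
  refine Submodule.smul_mem _ _ fun m _ => ?_
  have h2 := pathChain_mem (n + 1) m h1 (universalChain_mem (R := R) n m)
  rw [Nat.cast_add, ← add_assoc] at h2
  rw [Nat.cast_succ, ← add_assoc, add_sub_cancel_right]
  exact h2

/-- The terms with the boundary of the cube agree on both sides. All others carry a common sign, and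
without it they are the definition of `universalRhs`. The maps κ and κ' stand for transports between
objects, which are trivial since the morphism modules of the cobar category do not depend on the
objects. -/
theorem componentEv_relation (n : ℕ) (a : ℕ → X)
    (x : ∀ i, CubeChains R (MoorePath (a i) (a (i + 1)))) (k : ℕ → ℤ)
    (h : ∀ i, x i ∈ cubeDeg R (k i))
    (κ κ' : Fin n → (∀ m : ℕ, ⨂[R]^m (SChains R X)) → ∀ m : ℕ, ⨂[R]^m (SChains R X))
    (hκ : ∀ i z, κ i z = z) (hκ' : ∀ i z, κ' i z = z) :
    ∑ p : Fin (n + 1), (n + ∑ j ∈ Finset.range p, k j).negOnePow •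
        componentEv R (n + 1) a (Function.update x p (cubeBoundary R (x p)))
      + ∑ p : Fin n, (p : ℤ).negOnePow •
        κ p (componentEv R n (contractObj a p) (contractHom (pathCubes R X) a x p))
    = cobarD R (a 0) (a (n + 1)) (componentEv R (n + 1) a x)
      + ∑ i : Fin n, (i + (n - i - 1) * ∑ j ∈ Finset.range (i + 1), k j : ℤ).negOnePow •
          κ' i (cobarComp R (componentEv R (i + 1) a x)
            (componentEv R (n - i) (fun j => a ((i + 1 : ℕ) + j)) fun j => x ((i + 1 : ℕ) + j))) := by
  simp only [hκ, hκ']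
  have h1 : ∑ p : Fin (n + 1), (n + ∑ j ∈ Finset.range p, k j).negOnePow •
      componentEv R (n + 1) a (Function.update x p (cubeBoundary R (x p))) = _ :=
    sum_ev_boundary n a x k h
  have h2 : ∀ p : Fin n, (p : ℤ).negOnePow • componentEv R n (contractObj a p) (contractHom (pathCubes R X) a x p) =
      sgn R ((n - 1) * ∑ j ∈ Finset.range (n + 1), k j) • (-1 : R) ^ (p : ℕ) •
        famChain R X (n + 1) (fdup R p (universalChain R (n - 1)))
          (cubeMap R (forgetStart (a 0)) (pathFrom R (n + 1) a x)) := by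
    intro p
    obtain ⟨n, rfl⟩ : ∃ l, n = l + 1 := ⟨n - 1, by have := p.isLt; omega⟩
    refine (negOnePow_smul (R := R) _ _).trans ((congrArg _ (ev_contract n a x k h p p.isLt)).trans ?_)
    rw [Nat.cast_succ, add_sub_cancel_right, smul_comm]
    rfl
  have h3 := cobarD_ev n a x k h
  have h4 : ∀ i : Fin n, (i + (n - i - 1) * ∑ j ∈ Finset.range (i + 1), k j : ℤ).negOnePow •
        cobarComp R (componentEv R (i + 1) a x)
          (componentEv R (n - i) (fun j => a ((i + 1 : ℕ) + j)) fun j => x ((i + 1 : ℕ) + j)) =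
      sgn R ((n - 1) * ∑ j ∈ Finset.range (n + 1), k j) • (-1 : R) ^ (i : ℕ) •
        famChain R X (n + 1) (fmul R (i + 1) (n - 1 - i) (universalChain R i)
          (universalChain R (n - 1 - i)))
          (cubeMap R (forgetStart (a 0)) (pathFrom R (n + 1) a x)) := by
    intro i
    refine (congrArg _ (cobarComp_ev i (n - 1 - i) (n - i) (n + 1) (by omega) (by omega) a x k h)).trans ?_
    refine (negOnePow_smul_eq (R := R) _ _).trans ?_
    rw [smul_smul, smul_smul, ← sgn_natCast, ← sgn_add, ← sgn_add]
    congr 2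
    have : ((n - 1 - i : ℕ) : ℤ) = n - i - 1 := by omega
    rw [this]
    ring
  refine (congrArg₂ (· + ·) h1 (Finset.sum_congr rfl fun p _ => h2 p)).trans
    (Eq.trans ?_ (congrArg₂ (· + ·) h3 (Finset.sum_congr rfl fun i _ => h4 i)).symm)
  rw [add_assoc]
  refine congrArg _ ?_
  rw [← Finset.smul_sum, ← Finset.smul_sum]
  -- The factors n + 1 and n - 1 have the same parity.
  have h5 : sgn R ((n + 1) * ∑ j ∈ Finset.range (n + 1), k j) =
      sgn R ((n - 1) * ∑ j ∈ Finset.range (n + 1), k j) :=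
    sgn_congr (∑ j ∈ Finset.range (n + 1), k j) (by ring)
  rw [h5, ← smul_add]
  refine congrArg _ ?_
  cases n with
  | zero => simp [universalRhs]
  | succ n =>
    rw [universalRhs, Finset.Nat.sum_antidiagonal_eq_sum_range_succ_mk, Finset.sum_range,
      Finset.sum_range, map_sub, map_sum, map_sum, LinearMap.sub_apply, LinearMap.sum_apply,
      LinearMap.sum_apply]
    simp only [map_smul, LinearMap.smul_apply, Nat.add_sub_cancel]
    exact (sub_add_cancel _ _).symm

variable (R X) in
/-- The `A_∞`-functor from cubical chains on spaces of Moore paths to the cobar construction. -/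
def pathFunctor : AInfinityFunctor (pathCubes R X) (cobarProd R X) (fun a => a) where
  map := pathComponent R (X := X)
  map_zero _ := rfl
  map_mem := pathComponent_mem (R := R) (X := X)
  relation n a x k h :=
    componentEv_relation (R := R) (X := X) n a x k h (fun _ => (cobarProd R X).castHom _)
      (fun _ => (cobarProd R X).castHom _) (fun _ _ => castHom_cobarProd _ _)
      fun _ _ => castHom_cobarProd _ _

end Functor

end Chen

namespace Chen

/-! ### Triangulations of cubes and shuffles -/

section Triangulation

open Equiv

/-- The permutation that sends `i` to `0` and restricts to `τ` on the remaining elements. -/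
def permCons {n : ℕ} (i : Fin (n + 1)) (τ : Perm (Fin n)) : Perm (Fin (n + 1)) :=
  Perm.decomposeFin.symm (0, τ) * i.cycleRange

theorem permCons_self {n : ℕ} (i : Fin (n + 1)) (τ : Perm (Fin n)) : permCons i τ i = 0 := by
  rw [permCons, Perm.mul_apply, Fin.cycleRange_self, Perm.decomposeFin_symm_apply_zero]

theorem permCons_succAbove {n : ℕ} (i : Fin (n + 1)) (τ : Perm (Fin n)) (r : Fin n) :
    permCons i τ (i.succAbove r) = (τ r).succ := by
  rw [permCons, Perm.mul_apply, Fin.cycleRange_succAbove, Perm.decomposeFin_symm_apply_succ, swap_self,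
    refl_apply]

theorem sign_permCons {n : ℕ} (i : Fin (n + 1)) (τ : Perm (Fin n)) :
    Perm.sign (permCons i τ) = (-1) ^ (i : ℕ) * Perm.sign τ := by
  rw [permCons, Perm.sign_mul, Fin.sign_cycleRange, Perm.decomposeFin.symm_sign, if_pos rfl, one_mul,
    mul_comm]

/-- A permutation is determined by the place that it sends to 0 and by its effect on the other
places. -/
theorem permCons_bijective (n : ℕ) :
    Function.Bijective fun q : Fin (n + 1) × Perm (Fin n) => permCons q.1 q.2 := by
  refine (Fintype.bijective_iff_injective_and_card _).2 ⟨?_, ?_⟩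
  · rintro ⟨i, τ⟩ ⟨i', τ'⟩ h
    dsimp only at h
    obtain rfl : i = i' := (permCons i τ).injective (by
      rw [permCons_self, h, permCons_self])
    refine Prod.ext rfl (Equiv.ext fun r => ?_)
    have := DFunLike.congr_fun h (i.succAbove r)
    rw [permCons_succAbove, permCons_succAbove] at this
    exact Fin.succ_injective _ this
  · rw [Fintype.card_prod, Fintype.card_perm, Fintype.card_perm, Fintype.card_fin, Fintype.card_fin,
      Nat.factorial_succ]

/-- The vertices of the simplex of a cube that belongs to a permutation. -/
def triVertex {n : ℕ} (τ : Perm (Fin n)) (l i : ℕ) : ℕ :=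
  if h : i < n then if l ≤ τ ⟨i, h⟩ then 0 else 1 else 0

theorem triVertex_zero {n : ℕ} (τ : Perm (Fin n)) : triVertex τ 0 = 0 := by
  funext i
  rw [triVertex]
  split_ifs with h1 h2
  · rfl
  · exact absurd (Nat.zero_le _) h2
  · rfl

/-- After the first step, along the coordinate i, the path of vertices stays in the face where this
coordinate is 1. -/
theorem triVertex_succ {n : ℕ} (i : Fin (n + 1)) (τ : Perm (Fin n)) (l : ℕ) :
    triVertex (permCons i τ) (l + 1) = insAt i 1 (triVertex τ l) := by
  funext j
  rw [triVertex]
  by_cases hj : j < n + 1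
  · rw [dif_pos hj]
    obtain h | ⟨r, h⟩ := Fin.eq_self_or_eq_succAbove i ⟨j, hj⟩
    · have h' : j = i := congrArg Fin.val h
      rw [h, permCons_self, Fin.val_zero, if_neg (Nat.not_succ_le_zero l), insAt, if_neg h'.not_lt, if_pos h']
    · have h' : j = if (r : ℕ) < i then (r : ℕ) else r + 1 := by rw [← val_succAbove, ← h]
      have h'' : insAt i 1 (triVertex τ l) j = triVertex τ l r := by
        rw [insAt]
        split_ifs at h' with h1
        · rw [if_pos (by omega), h']
        · rw [if_neg (by omega), if_neg (by omega), h', Nat.add_sub_cancel]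
      rw [h, permCons_succAbove, h'', triVertex, dif_pos r.isLt, Fin.val_succ]
      exact if_congr Nat.succ_le_succ_iff rfl rfl
  · rw [dif_neg hj, insAt, if_neg (by omega), if_neg (by omega), triVertex, dif_neg (by omega)]

/-- The recursion for the cube chooses the first step of a maximal edge path; the choice of i
contributes the sign (-1)^i of the cycle in `permCons`. -/
theorem cubeChain_eq_sum (R : Type v) [CommRing R] (n : ℕ) : cubeChain R n =
    ∑ τ : Perm (Fin n), ((Perm.sign τ : ℤ) : R) • ocls R fun l : Fin (n + 1) => triVertex τ l := by
  induction n with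
  | zero =>
    rw [Fintype.sum_unique, cubeChain]
    simp only [Perm.default_eq, Perm.sign_one, Units.val_one, Int.cast_one, one_smul]
    refine congrArg (ocls R) (funext fun l => ?_)
    rw [Fin.val_eq_zero, triVertex_zero]
  | succ n ih =>
    rw [← (permCons_bijective n).sum_comp fun τ => ((Perm.sign τ : ℤ) : R) •
        ocls R fun l : Fin (n + 2) => triVertex τ l,
      Fintype.sum_prod_type, cubeChain, Finset.sum_range, map_sum]
    refine Finset.sum_congr rfl fun i _ => ?_
    rw [ih, map_sum, Finset.smul_sum, map_sum]
    refine Finset.sum_congr rfl fun τ _ => ?_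
    rw [map_smul, map_smul, omap_ocls, map_smul, ocons_ocls, smul_smul, sign_permCons]
    refine congrArg₂ (· • ·) ?_ (congrArg (ocls R) (funext fun l => ?_))
    · push_cast
      rfl
    · cases l using Fin.cases with
      | zero => exact (triVertex_zero _).symm
      | succ l => exact (triVertex_succ i τ l).symm

end Triangulation

/-! ### The recursive shuffle product as a sum over shuffles -/

section Shuffles

/-- The set of the successors of the members of `S`, together with `0` if `b` is true. -/
def consSet {N : ℕ} (b : Bool) (S : Finset (Fin N)) : Finset (Fin (N + 1)) :=
  Finset.univ.filter fun s => Fin.cases (motive := fun _ => Bool) b (fun s => decide (s ∈ S)) s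

theorem zero_mem_consSet {N : ℕ} (b : Bool) (S : Finset (Fin N)) : 0 ∈ consSet b S ↔ b = true := by
  simp [consSet]

theorem succ_mem_consSet {N : ℕ} (b : Bool) (S : Finset (Fin N)) (s : Fin N) :
    s.succ ∈ consSet b S ↔ s ∈ S := by
  simp [consSet]

theorem compl_consSet {N : ℕ} (b : Bool) (S : Finset (Fin N)) : (consSet b S)ᶜ = consSet (!b) Sᶜ := by
  ext s
  cases s using Fin.cases with
  | zero => rw [Finset.mem_compl, zero_mem_consSet, zero_mem_consSet]; simp
  | succ s => rw [Finset.mem_compl, succ_mem_consSet, succ_mem_consSet, Finset.mem_compl]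

theorem consSet_bijective (N : ℕ) :
    Function.Bijective fun q : Bool × Finset (Fin N) => consSet q.1 q.2 := by
  refine (Fintype.bijective_iff_injective_and_card _).2 ⟨?_, ?_⟩
  · rintro ⟨b, S⟩ ⟨b', S'⟩ h
    dsimp only at h
    refine Prod.ext ?_ (Finset.ext fun s => ?_)
    · rw [Bool.eq_iff_iff, ← zero_mem_consSet b S, h, zero_mem_consSet]
    · rw [← succ_mem_consSet b S, h, succ_mem_consSet]
  · rw [Fintype.card_prod, Fintype.card_finset, Fintype.card_finset, Fintype.card_fin, Fintype.card_fin,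
      Fintype.card_bool, pow_succ']

theorem countBelow_zero {N : ℕ} (S : Finset (Fin N)) : countBelow S 0 = 0 := by
  simp [countBelow]

theorem countBelow_last {N : ℕ} (S : Finset (Fin N)) : countBelow S (Fin.last N) = S.card := by
  simp [countBelow, Fin.castSucc_lt_last]

theorem countBelow_consSet {N : ℕ} (b : Bool) (S : Finset (Fin N)) (k : Fin (N + 1)) :
    countBelow (consSet b S) k.succ = countBelow S k + if b then 1 else 0 := by
  induction k using Fin.induction with
  | zero =>
    rw [countBelow_succ, Fin.castSucc_zero, countBelow_zero, countBelow_zero]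
    exact congrArg _ (if_congr (zero_mem_consSet b S) rfl rfl)
  | succ k ih =>
    rw [countBelow_succ, ← Fin.succ_castSucc, ih, countBelow_succ, add_right_comm]
    exact congrArg (_ + · + _) (if_congr (succ_mem_consSet b S k) rfl rfl)

theorem card_consSet {N : ℕ} (b : Bool) (S : Finset (Fin N)) :
    (consSet b S).card = S.card + if b then 1 else 0 := by
  rw [← countBelow_last, ← Fin.succ_last, countBelow_consSet, countBelow_last]

theorem inversions_eq_sum {N : ℕ} (S : Finset (Fin N)) :
    inversions S = ∑ s : Fin N, if s ∈ S then countBelow Sᶜ s.castSucc else 0 := by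
  rw [inversions, Finset.card_filter, Finset.sum_product, ← Finset.sum_filter,
    Finset.filter_mem_eq_inter, Finset.univ_inter]
  refine Finset.sum_congr rfl fun s _ => ?_
  rw [countBelow, Finset.card_filter]
  rfl

/-- A first step in the second direction precedes every member of `S` and adds one inversion for
each. This is the sign of the second branch of `prodGen`. -/
theorem inversions_consSet {N : ℕ} (b : Bool) (S : Finset (Fin N)) :
    inversions (consSet b S) = inversions S + if b then 0 else S.card := by
  rw [inversions_eq_sum, inversions_eq_sum, Fin.sum_univ_succ, Fin.castSucc_zero, countBelow_zero,
    ite_self, zero_add]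
  have : ∀ s : Fin N, (if s.succ ∈ consSet b S then countBelow (consSet b S)ᶜ s.succ.castSucc else 0) =
      (if s ∈ S then countBelow Sᶜ s.castSucc else 0) + if s ∈ S then if b then 0 else 1 else 0 := by
    intro s
    rw [if_congr (succ_mem_consSet b S s) rfl rfl, compl_consSet, ← Fin.succ_castSucc,
      countBelow_consSet]
    cases b <;> split_ifs <;> simp_all
  rw [Finset.sum_congr rfl fun s _ => this s, Finset.sum_add_distrib]
  cases b <;> simp

variable {R : Type v} [CommRing R] {V W : Type*}

/-- Shuffles are split by the direction of their first step. Summing over all subsets, with the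
cardinality as a condition, keeps this splitting a plain product of index types. -/
theorem prodGen_eq_sum (g : ℕ → V) (h : ℕ → W) (N : ℕ) : ∀ p q : ℕ, p + q = N →
    prodGen R p q (fun l => g l) (fun l => h l) = ∑ S : Finset (Fin N), if S.card = p then
      (-1 : R) ^ inversions S • ocls R fun k : Fin (N + 1) => (g (countBelow S k), h (countBelow Sᶜ k))
      else 0 := by
  induction N generalizing g h with
  | zero =>
    intro p q hpq
    obtain ⟨rfl, rfl⟩ : p = 0 ∧ q = 0 := by omega
    rw [Fintype.sum_unique, if_pos (Finset.card_eq_zero.2 (Subsingleton.elim _ _)), prodGen]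
    have : inversions (default : Finset (Fin 0)) = 0 := by simp [inversions]
    rw [this, pow_zero, one_smul]
    refine congrArg (ocls R) (funext fun k => ?_)
    obtain rfl : k = 0 := Fin.ext (by omega)
    rw [countBelow_zero, countBelow_zero]
    rfl
  | succ N ih =>
    intro p q hpq
    have key : ∀ (b : Bool) (S : Finset (Fin N)), (ocls R fun k : Fin (N + 2) =>
        (g (countBelow (consSet b S) k), h (countBelow (consSet b S)ᶜ k))) =
        ocons R (g 0, h 0) (ocls R fun k : Fin (N + 1) =>
          (g (countBelow S k + if b then 1 else 0), h (countBelow Sᶜ k + if b then 0 else 1))) := by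
      intro b S
      rw [ocons_ocls]
      refine congrArg (ocls R) (funext fun k => ?_)
      cases k using Fin.cases with
      | zero =>
        rw [countBelow_zero, countBelow_zero]
        rfl
      | succ k =>
        rw [compl_consSet, countBelow_consSet, countBelow_consSet]
        cases b <;> rfl
    rw [← (consSet_bijective N).sum_comp fun S : Finset (Fin (N + 1)) => if S.card = p then
      (-1 : R) ^ inversions S • ocls R fun k : Fin (N + 2) =>
        (g (countBelow S k), h (countBelow Sᶜ k)) else 0, Fintype.sum_prod_type, Fintype.sum_bool]
    simp only [card_consSet, inversions_consSet, key, if_true, Bool.false_eq_true, if_false, add_zero]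
    have h1 : ∀ p', p = p' + 1 → (∑ S : Finset (Fin N), if S.card + 1 = p then (-1 : R) ^ inversions S •
        ocons R (g 0, h 0) (ocls R fun k : Fin (N + 1) =>
          (g (countBelow S k + 1), h (countBelow Sᶜ k))) else 0) =
        ocons R (g 0, h 0) (prodGen R p' q (fun l => g (l + 1)) fun l => h l) := by
      rintro p' rfl
      rw [ih (fun l => g (l + 1)) h p' q (by omega), map_sum]
      refine Finset.sum_congr rfl fun S _ => ?_
      simp only [Nat.add_right_cancel_iff]
      split_ifs
      · rw [map_smul]
      · rw [map_zero]
    have h2 : ∀ q', q = q' + 1 → (∑ S : Finset (Fin N), if S.card = p then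
        (-1 : R) ^ (inversions S + S.card) • ocons R (g 0, h 0) (ocls R fun k : Fin (N + 1) =>
          (g (countBelow S k), h (countBelow Sᶜ k + 1))) else 0) =
        ocons R (g 0, h 0) ((-1 : R) ^ p • prodGen R p q' (fun l => g l) fun l => h (l + 1)) := by
      rintro q' rfl
      rw [ih g (fun l => h (l + 1)) p q' (by omega), Finset.smul_sum, map_sum]
      refine Finset.sum_congr rfl fun S _ => ?_
      split_ifs with hS
      · rw [map_smul, map_smul, smul_smul, hS, pow_add, mul_comm]
      · rw [smul_zero, map_zero]
    -- If one of the dimensions is 0, no shuffle starts in that direction.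
    have h3 : p = 0 → (∑ S : Finset (Fin N), if S.card + 1 = p then (-1 : R) ^ inversions S •
        ocons R (g 0, h 0) (ocls R fun k : Fin (N + 1) =>
          (g (countBelow S k + 1), h (countBelow Sᶜ k))) else 0) = 0 := fun hp =>
      Finset.sum_eq_zero fun S _ => if_neg (by omega)
    have h4 : q = 0 → (∑ S : Finset (Fin N), if S.card = p then
        (-1 : R) ^ (inversions S + S.card) • ocons R (g 0, h 0) (ocls R fun k : Fin (N + 1) =>
          (g (countBelow S k), h (countBelow Sᶜ k + 1))) else 0) = 0 := fun hq =>
      Finset.sum_eq_zero fun S _ => if_neg (by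
        have := Finset.card_le_univ S
        rw [Fintype.card_fin] at this
        omega)
    match p, q, hpq with
    | 0, 0, hpq => omega
    | 0, q + 1, hpq =>
      refine Eq.trans ?_ (congrArg₂ (· + ·) (h3 rfl) (h2 q rfl)).symm
      rw [pow_zero, one_smul]
      refine Eq.trans ?_ (zero_add _).symm
      rw [prodGen]
      rfl
    | p + 1, 0, hpq =>
      rw [h1 p rfl, h4 rfl, add_zero, prodGen]
      rfl
    | p + 1, q + 1, hpq =>
      rw [h1 p rfl, h2 q rfl, prodGen, map_add]
      rfl

end Shuffles

end Chen

namespace Chen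

/-! ### The first component as the iterated integral, and naturality -/

section IteratedIntegral

variable {R : Type v} [CommRing R] {X : Type u} [TopologicalSpace X] {Y : Type u}
  [TopologicalSpace Y]

theorem cubeCross_point_right {A B Z : Type*} [TopologicalSpace A] [TopologicalSpace B]
    [TopologicalSpace Z] (μ : C(A × B, Z)) (b : B) (x : CubeChains R A) :
    cubeCross R μ x (ccls R (n := 0) (ContinuousMap.const _ b)) =
      cubeMap R (μ.comp ⟨fun a => (a, b), by fun_prop⟩) x := by
  induction x using cubeChains_induction with
  | hz => simp
  | hadd z z' hz hz' => simp only [map_add, LinearMap.add_apply, hz, hz']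
  | hsmul r z hz => simp only [map_smul, LinearMap.smul_apply, hz]
  | hg l c =>
    rw [cubeCross_ccls, cubeMap_ccls]
    rfl

/-- A Moore path as a path with a sequence of lengths. -/
def singlePath (a b : X) : C(MoorePath a b, PathSeq X) :=
  (forgetStart a).comp ((forgetEnd 1 a b).comp ((consPathTo 0 a b b).comp
    ⟨fun p => (p, constPath b), by fun_prop⟩))

theorem singlePath_apply {a b : X} (p : MoorePath a b) (t : ℝ≥0) :
    (singlePath a b p).1 t = p.1.1 t := by
  change (if t ≤ p.1.2 then p.1.1 t else b) = p.1.1 t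
  split_ifs with h
  · rfl
  · exact (p.2.2 t (not_le.1 h).le).symm

theorem pathComponent_one (a : Fin 2 → X)
    (x : ∀ i : Fin 1, CubeChains R (MoorePath (a i.castSucc) (a i.succ))) :
    pathComponent R 1 a x =
      famChain R X 1 (universalChain R 0) (cubeMap R (singlePath (a 0) (a 1)) (x 0)) := by
  change famChain R X 1 (universalChain R 0) ((cubePar R ^ 0) (cubeMap R (forgetStart (a 0))
    (cubeMap R (forgetEnd 1 (a 0) (a 1)) (cubeCross R (consPathTo 0 (a 0) (a 1) (a 1)) (x 0)
      (ccls R (n := 0) (ContinuousMap.const _ (constPath (a 1)))))))) = _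
  rw [cubeCross_point_right, cubeMap_cubeMap, cubeMap_cubeMap, pow_zero]
  rfl

/-- Each coordinate of the cube and each moment is the weight of the vertices below a threshold.
Pulling back along a lattice path counts its steps, so both simplices have the same coordinates. The
lattice path enters only through the values of θ and θ'. -/
theorem realization_shuffle {a b : X} {K m : ℕ} (c : Cube K (MoorePath a b))
    (τ : Equiv.Perm (Fin K)) (S : Finset (Fin (K + m)))
    (θ : Fin (K + m + 1) → Fin (K + 1)) (θ' : Fin (K + m + 1) → Fin (m + 1))
    (hθ : ∀ k, (θ k : ℕ) = countBelow S k) (hθ' : ∀ k, (θ' k : ℕ) = countBelow Sᶜ k) :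
    (Realization.pi fun j : Fin m => pathRealization 1 ((singlePath a b).comp c) j).simp (K + m)
      (fun k => (triVertex τ (countBelow S k), fun _ => countBelow Sᶜ k)) =
    (evalMap a b m).comp (ContinuousMap.prodMk (pull θ (cubeSimplex τ c))
      (pull θ' (ContinuousMap.id (stdSimplex ℝ (Fin (m + 1)))))) := by
  refine ContinuousMap.ext fun s => funext fun j => ?_
  have h1 : cubeAt c (cubePoint (fun k : Fin (K + m + 1) => triVertex τ (countBelow S k)) s) =
      c fun i => tCoord (τ i) (stdSimplex.map θ s) := by
    refine congrArg c (funext fun i => ?_)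
    refine Eq.trans (weight_congr (fun l => ?_) s) (weight_map _ θ s).symm
    change triVertex τ (countBelow S l) i = 0 ↔ θ l ≤ (τ i).castSucc
    rw [triVertex, dif_pos i.isLt, Fin.le_def, hθ]
    change (if _ ≤ (τ i : ℕ) then 0 else 1) = 0 ↔ _ ≤ (τ i : ℕ)
    split_ifs with h <;> simp [h]
  have h2 : weight (fun k : Fin (K + m + 1) => countBelow Sᶜ k ≤ j) s =
      tCoord j (stdSimplex.map θ' s) := by
    refine Eq.trans (weight_congr (fun l => ?_) s) (weight_map _ θ' s).symm
    rw [Fin.le_def, hθ', Fin.val_castSucc]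
  change (singlePath a b (cubeAt c (cubePoint (fun k : Fin (K + m + 1) =>
    triVertex τ (countBelow S k)) s))).1 (∑ i ∈ Finset.range 1, unitInterval.toNNReal
      (weight (fun k : Fin (K + m + 1) => countBelow Sᶜ k ≤ j) s) *
      (singlePath a b (cubeAt c (cubePoint (fun k : Fin (K + m + 1) =>
        triVertex τ (countBelow S k)) s))).2 i) =
    (c fun i => tCoord (τ i) (stdSimplex.map θ s)).1.1
      (unitInterval.toNNReal (tCoord j (stdSimplex.map θ' s)) *
        (c fun i => tCoord (τ i) (stdSimplex.map θ s)).1.2)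
  rw [h1, h2, Finset.sum_range_one, singlePath_apply]
  rfl

theorem chain_prodGen {a b : X} {K m : ℕ} (c : Cube K (MoorePath a b)) (τ : Equiv.Perm (Fin K)) :
    (Realization.pi fun j : Fin m => pathRealization 1 ((singlePath a b).comp c) j).chain R
      (prodGen R K m (fun l => triVertex τ l) fun l _ => (l : ℕ)) =
    simpMap R (evalMap a b m) (crossGen R (ContinuousMap.id (stdSimplex ℝ (Fin (m + 1))))
      ⟨K, cubeSimplex τ c⟩) := by
  rw [prodGen_eq_sum (fun l => triVertex τ l) (fun l _ => l) (K + m) K m rfl,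
    ← Finset.sum_filter, Finset.sum_subtype (p := fun S : Finset (Fin (K + m)) => S.card = K) _ (by simp),
    crossGen, map_sum, map_sum]
  refine Finset.sum_congr rfl fun S _ => ?_
  rw [map_smul, map_smul, Realization.chain_ocls]
  refine congrArg _ ?_
  refine Eq.trans ?_ (liftChains_cls _ _ _).symm
  exact congrArg (scls R) (realization_shuffle c τ S.1 _ _ (fun _ => rfl) fun _ => rfl)

/-- Both sides are signed sums of the same simplices over permutations and shuffles, and the sign
(-1)^m is already part of the universal chain. -/
theorem pathChain_singlePath {a b : X} (m : ℕ) (y : CubeChains R (MoorePath a b)) :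
    pathChain R 1 m (cubeMap R (singlePath a b) y) (universalChain R 0 m) =
      iteratedIntegral R a b y m := by
  induction y using cubeChains_induction with
  | hz => simp only [map_zero, LinearMap.zero_apply, Pi.zero_apply]
  | hadd y y' hy hy' => simp only [map_add, LinearMap.add_apply, Pi.add_apply, hy, hy']
  | hsmul r y hy => simp only [map_smul, LinearMap.smul_apply, Pi.smul_apply, hy]
  | hg K c =>
    change _ = (-1 : R) ^ m • alexanderWhitney R m (simpMap R (evalMap a b m)
      (crossWith R (ContinuousMap.id (stdSimplex ℝ (Fin (m + 1)))) (triangulate R (ccls R c))))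
    have h1 : triangulate R (ccls R c) = ∑ τ : Equiv.Perm (Fin K),
      ((Equiv.Perm.sign τ : ℤ) : R) • scls R (cubeSimplex τ c) := liftChains_cls _ _ _
    have h2 : ∀ τ : Equiv.Perm (Fin K), crossWith R (ContinuousMap.id (stdSimplex ℝ (Fin (m + 1))))
      (scls R (cubeSimplex τ c)) = crossGen R (ContinuousMap.id (stdSimplex ℝ (Fin (m + 1))))
        ⟨K, cubeSimplex τ c⟩ := fun τ => liftChains_cls _ _ _
    rw [cubeMap_ccls, pathChain_ccls, universalChain, map_smul, map_smul, h1, cubeChain_eq_sum, map_sum,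
      map_sum, LinearMap.sum_apply]
    refine congrArg (fun z => (-1 : R) ^ m • alexanderWhitney R m z) ?_
    rw [map_sum, map_sum]
    refine Finset.sum_congr rfl fun τ _ => ?_
    rw [map_smul, map_smul, map_smul, LinearMap.smul_apply, map_smul, h2, oprod_ocls, chain_prodGen]

theorem pathComponent_one_eq_iteratedIntegral (a : Fin 2 → X)
    (x : ∀ i : Fin 1, CubeChains R (MoorePath (a i.castSucc) (a i.succ))) :
    pathComponent R 1 a x = iteratedIntegral R (a 0) (a 1) (x 0) :=
  (pathComponent_one a x).trans (funext fun m => pathChain_singlePath m _)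

/-- The components of the functor are natural. -/
theorem pathComponent_natural (f : C(X, Y)) : ∀ (n : ℕ) (a : Fin (n + 1) → X)
    (x : ∀ i : Fin n, CubeChains R (MoorePath (a i.castSucc) (a i.succ))),
    pathComponent R n (fun i => f (a i))
      (fun i => cubeMap R (pathMap f (a i.castSucc) (a i.succ)) (x i)) =
      cobarMap R f (pathComponent R n a x)
  | 0, a, x => (map_zero (cobarMap R f)).symm
  | n + 1, a, x => by
    have h1 := cubeMap_pathProd R f (n + 1) a x
    have h2 : cubeMap R (forgetStart (f (a 0))) (cubeMap R
        (forgetEnd (n + 1) (f (a 0)) (f (a (Fin.last (n + 1))))) (pathProd R (n + 1) (fun i => f (a i))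
          (fun i => cubeMap R (pathMap f (a i.castSucc) (a i.succ)) (x i)))) =
        cubeMap R (seqMap X f) (cubeMap R (forgetStart (a 0)) (cubeMap R
          (forgetEnd (n + 1) (a 0) (a (Fin.last (n + 1)))) (pathProd R (n + 1) a x))) := by
      rw [h1, cubeMap_cubeMap, cubeMap_cubeMap, cubeMap_cubeMap, cubeMap_cubeMap]
      rfl
    have h3 : ∀ (k : ℕ) (y : CubeChains R (PathSeq X)), (cubePar R ^ k) (cubeMap R (seqMap X f) y) =
        cubeMap R (seqMap X f) ((cubePar R ^ k) y) := by
      intro k y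
      induction k with
      | zero => rfl
      | succ k ih => rw [pow_succ', Module.End.mul_apply, ih, cubePar_cubeMap, pow_succ',
          Module.End.mul_apply]
    funext m
    refine (congrArg (fun z => pathChain R (n + 1) m ((cubePar R ^ n) z) (universalChain R n m)) h2).trans ?_
    rw [h3]
    exact pathChain_cubeMap (n + 1) m f _ (universalChain R n m)

end IteratedIntegral

end Chen

end

theorem mainTheorem1 (R : Type v) [CommRing R] :
    ∃ I : ∀ (X : Type u) [TopologicalSpace X],
        Chen.AInfinityFunctor (Chen.pathCubes R X) (Chen.cobarProd R X) (fun a => a),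
      (∀ (X : Type u) [TopologicalSpace X] (a : Fin 2 → X)
        (x : ∀ i : Fin 1, Chen.CubeChains R (Chen.MoorePath (a i.castSucc) (a i.succ))),
        (I X).map 1 a x = Chen.iteratedIntegral R (a 0) (a 1) (x 0)) ∧
      (∀ (X Y : Type u) [TopologicalSpace X] [TopologicalSpace Y] (f : C(X, Y)) (n : ℕ)
        (a : Fin (n + 1) → X)
        (x : ∀ i : Fin n, Chen.CubeChains R (Chen.MoorePath (a i.castSucc) (a i.succ))),
        (I Y).map n (fun i => f (a i))
            (fun i => Chen.cubeMap R (Chen.pathMap f (a i.castSucc) (a i.succ)) (x i)) =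
          Chen.cobarMap R f ((I X).map n a x)) :=
  ⟨fun X _ => Chen.pathFunctor R X,
    fun _ _ a x => Chen.pathComponent_one_eq_iteratedIntegral a x,
    fun _ _ _ _ f n a x => Chen.pathComponent_natural f n a x⟩
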